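/- **Setting.** Let $\mathbb T=\mathbb R/\mathbb Z$ and let $\|\cdot\|$ denote the usual metric on $\mathbb T$ and the flat Euclidean metric on $\mathbb T^2$. Fix once and for all: - a minimal rotation $T(x,y)=(x+a,y+b)$ of $\mathbb T^2$ (every orbit is dense) and a point $z_0\in\mathbb T^2$; put $z_{2n}=(x_{2n},y_{2n})=T^nz_0$ and $z_{2n+1}=(x_{2n+1},y_{2n+1})=T^{-n-1}z_0$ for $n\ge 0$, let $\sigma,\tau$ be the bijections of $\mathbb N=\{0,1,2,\dots\}$ with $Tz_n=z_{\sigma(n)}$, $T^{-1}z_n=z_{\tau(n)}$, and let $X=(\mathbb T\setminus\{x_n:n\in\mathbb N\})\times\mathbb T$; - a dense sequence $(q_k)_{k\ge0}$ in $[0,1]$; - numbers $1=\epsilon_0>\epsilon_1>\cdots\to0$, and $e^1_k,e^2_k,e^3_k$ with $\epsilon_{k+1}<e^1_k<e^2_k<e^3_k<\epsilon_k$ for every $k\ge0$. **The functions $h^\alpha_t$.** For $\alpha\in[0,1]^\omega$ let $p_\alpha:(0,1]\to[0,\tfrac14]$ be the continuous function with $p_\alpha(1)=\frac14$; $p_\alpha=\alpha(0)/4$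 on $[e^2_0,e^3_0]$ and $p_\alpha=q_0/4$ on $[\epsilon_1,e^1_0]$; for $k\ge1$, $p_\alpha=\alpha(k)/4$ on $[\epsilon_{k+1},e^1_k]$ and $p_\alpha=q_k/4$ on $[e^2_k,e^3_k]$; and $p_\alpha$ affine on each $[e^1_k,e^2_k]$ and each $[e^3_k,\epsilon_k]$. For $0<t\le1$ let $h^\alpha_t=h^\alpha_{-t}:[-1,1]\to[-1,1]$ be the function whose graph is the polyline through $$(-1,-1),\ \left(-\tfrac{1+t}2,-t\right),\ \left(-\tfrac12,-\tfrac t2\right),\ \left(-p_\alpha(t),\tfrac t4\right),\ \left(\tfrac12,\tfrac t2\right),\ \left(\tfrac{1+t}2,t\right),\ (1,1),$$ and let $h^\alpha_0$ be the function given by the polyline through $(-1,-1),(-\frac12,0),(\frac12,0),(1,1)$. For $t\neq0$, $h^\alpha_t$ is a homeomorphism of $[-1,1]$. **The maps $\Lambda_{\alpha,n}$, $\Phi_\alpha$.** Given numbers $0<\delta_{\alpha,n}<\frac12$ ($n\ge0$), let $A_{\alpha,n}=\{z_n+(t,s):|t|,|s|\le\delta_{\alpha,n}\}$, let $\Lambda_{\alpha,n}:\mathbb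 T^2\to\mathbb T^2$ be the identity off $A_{\alpha,n}$ and $$\Lambda_{\alpha,n}(z_n+(t,s))=z_n+\bigl(t,\ h^\alpha_t\bigl((h^\alpha_{\delta_{\alpha,n}})^{-1}(s)\bigr)\bigr)\qquad(|t|,|s|\le\delta_{\alpha,n}),$$ and put $\Phi_{\alpha,n}=\Lambda_{\alpha,n}\circ\cdots\circ\Lambda_{\alpha,0}$, $\Phi^\sigma_{\alpha,n}=\Lambda_{\alpha,\sigma(n)}\circ\cdots\circ\Lambda_{\alpha,\sigma(0)}$, $\Phi^\tau_{\alpha,n}=\Lambda_{\alpha,\tau(n)}\circ\cdots\circ\Lambda_{\alpha,\tau(0)}$. The sequence $(\delta_{\alpha,n})_n$ is called *admissible* for $\alpha$ if 1. $A_{\alpha,m}\cap A_{\alpha,n}=\emptyset$ whenever $0<|m-n|\le5$; 2. for all $n$, $0<\delta_{\alpha,n}<2^{-n}$; for all $m<n$, $A_{\alpha,n}\cap(\{x_m\}\times\mathbb T)=\emptyset$ and $\delta_{\alpha,n}<\|x_m-x_n\|/n$; and for all $n\ge1$ and $x,y\in\{x_n\}\times\mathbb T$, $\|\Phi_{\alpha,n-1}(x)-\Phi_{\alpha,n-1}(y)\|\le\delta_{\alpha,n}$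 implies $\|x-y\|<1/n$; 3. there are integers $a_n\ge2$ with $\prod_{n\ge1}(1-1/a_n)>0$ such that, for all $m>n\ge1$ and all $x,y\in\mathbb T^2$ with $\|x-y\|\ge1/n$, $$\|\Phi_{\alpha,m}(x)-\Phi_{\alpha,m}(y)\|\ge\prod_{r=n+1}^m\Bigl(1-\frac1{a_r}\Bigr)\,\|\Phi_{\alpha,n}(x)-\Phi_{\alpha,n}(y)\|;$$ 4. the maps $(\Phi^\sigma_{\alpha,n})^{-1}\circ T\circ\Phi_{\alpha,n}$ and $(\Phi^\tau_{\alpha,n})^{-1}\circ T^{-1}\circ\Phi_{\alpha,n}$, where inverses are taken on $X$, are uniformly continuous on $X$ for every $n$, and both sequences of maps are uniformly Cauchy on $X$. For admissible $(\delta_{\alpha,n})_n$ let $\Phi_\alpha=\lim_n\Phi_{\alpha,n}$, and let $S_\alpha:\mathbb T^2\to\mathbb T^2$ be the continuous extension of $\Phi_\alpha^{-1}\circ T\circ\Phi_\alpha:X\to X$. **Theorem.** Every $\alpha\in[0,1]^\omega$ has an admissible sequence, and for every admissible sequence $S_\alpha$ is a (well-defined) homeomorphism of $\mathbb T^2$.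 Let $\alpha,\beta\in[0,1]^\omega$ with any admissible sequences for $\alpha$ and for $\beta$. If $\alpha$ and $\beta$ are not $c_0$-equivalent, i.e. $|\alpha(n)-\beta(n)|\not\to0$, then $(\mathbb T^2,S_\alpha)$ and $(\mathbb T^2,S_\beta)$ are not topologically conjugate: there is no homeomorphism $g$ of $\mathbb T^2$ with $g\circ S_\alpha=S_\beta\circ g$. -/

import Mathlib

open Filter Topology

noncomputable section

namespace DenjoyRees

/-- The two-dimensional torus `𝕋² = (ℝ/ℤ)²`. -/
abbrev Torus : Type := UnitAddCircle × UnitAddCircle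

/-- The usual (flat, Euclidean) distance on the torus. -/
def torusDist (p q : Torus) : ℝ := dist (WithLp.toLp 2 p) (WithLp.toLp 2 q)

/-- The representative of a point of `ℝ/ℤ` in `[-1/2, 1/2)`. -/
def rep (u : UnitAddCircle) : ℝ := (AddCircle.equivIco (1 : ℝ) (-1 / 2) u : ℝ)

/-- The affine function through `(x₁, y₁)` and `(x₂, y₂)`, evaluated at `s`. -/
def seg (x₁ y₁ x₂ y₂ s : ℝ) : ℝ := y₁ + (y₂ - y₁) * ((s - x₁) / (x₂ - x₁))

/-- The relation `c₀` on sequences in `[0,1]`. -/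
def C0Equiv (α β : ℕ → unitInterval) : Prop :=
  Tendsto (fun n => |(α n : ℝ) - (β n : ℝ)|) atTop (𝓝 0)

/-- Topological conjugacy of two self-maps of the torus. -/
def TopConj (f g : Torus → Torus) : Prop :=
  ∃ h : Torus ≃ₜ Torus, ∀ p, h (f p) = g (h p)

/-- The objects that are fixed once and for all before the construction starts: a minimal rotation
`T p = p + v`, a base point `z₀`, a dense sequence `q` in `[0,1]`, and the division points
`ε (k+1) < e₁ k < e₂ k < e₃ k < ε k` of a sequence `1 = ε 0 > ε 1 > ⋯ → 0`. -/
structure Params where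
  v : Torus
  minimal : ∀ p : Torus, Dense (Set.range fun n : ℤ => p + n • v)
  z₀ : Torus
  q : ℕ → unitInterval
  q_dense : DenseRange q
  ε : ℕ → ℝ
  ε_zero : ε 0 = 1
  ε_tendsto : Tendsto ε atTop (𝓝 0)
  e₁ : ℕ → ℝ
  e₂ : ℕ → ℝ
  e₃ : ℕ → ℝ
  lt_e₁ : ∀ k, ε (k + 1) < e₁ k
  e₁_lt_e₂ : ∀ k, e₁ k < e₂ k
  e₂_lt_e₃ : ∀ k, e₂ k < e₃ k
  e₃_lt : ∀ k, e₃ k < ε k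

/-- The permutation of `ℕ` with `T zₙ = z_{σ n}`. -/
def sigma (n : ℕ) : ℕ := if Even n then n + 2 else if n = 1 then 0 else n - 2

/-- The permutation of `ℕ` with `T⁻¹ zₙ = z_{τ n}`. -/
def tau (n : ℕ) : ℕ := if n = 0 then 1 else if Even n then n - 2 else n + 2

namespace Params

variable (P : Params)

/-- The enumeration `z_{2n} = Tⁿ z₀`, `z_{2n+1} = T^{-n-1} z₀` of the orbit of `z₀`. -/
def z (n : ℕ) : Torus :=
  if Even n then P.z₀ + (n / 2) • P.v else P.z₀ - (n / 2 + 1) • P.v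

theorem z_sigma (n : ℕ) : P.z (sigma n) = P.z n + P.v := by
  rcases Nat.even_or_odd' n with ⟨m, rfl | rfl⟩
  · have h2 : (2 * m + 2) / 2 = m + 1 := by omega
    simp [z, sigma, h2, Nat.even_add, add_smul, add_assoc]
  · rcases m with _ | m
    · simp [z, sigma]
    · have h1 : sigma (2 * (m + 1) + 1) = 2 * m + 1 := by
        have : ¬ Even (2 * (m + 1) + 1) := by simp
        simp only [sigma, this, if_false]
        split_ifs <;> omega
      have h2 : (2 * m + 1) / 2 = m := by omega
      have h3 : (2 * (m + 1) + 1) / 2 = m + 1 := by omega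
      rw [h1]
      simp only [z, h2, h3, Nat.even_add_one, even_two_mul, not_true_eq_false, if_false]
      simp only [add_smul]
      abel

theorem z_tau (n : ℕ) : P.z (tau n) = P.z n - P.v := by
  have h : sigma (tau n) = n := by
    rcases Nat.even_or_odd' n with ⟨m, rfl | rfl⟩
    · rcases m with _ | m
      · simp [tau, sigma]
      · have h1 : tau (2 * (m + 1)) = 2 * m := by
          have h0 : 2 * (m + 1) ≠ 0 := by omega
          have h2 : Even (2 * (m + 1)) := even_two_mul _
          simp only [tau, h0, h2, if_true, if_false]
          omega
        rw [h1]
        simp only [sigma, even_two_mul, if_true]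
        omega
    · have h1 : tau (2 * m + 1) = 2 * m + 1 + 2 := by
        simp [tau]
      have h2 : ¬ Even (2 * m + 1 + 2) := by simp [Nat.even_add_one]
      rw [h1]
      simp [sigma, h2]
  have := P.z_sigma (tau n)
  rw [h] at this
  rw [this, add_sub_cancel_right]

/-- The comeager set `X = (𝕋 \ {xₙ}) × 𝕋`, where `zₙ = (xₙ, yₙ)`. -/
def X : Set Torus := {p | ∀ n, p.1 ≠ (P.z n).1}

/-- The value of `p_α` on `[ε (k+1), e₁ k]`. -/
def low (α : ℕ → unitInterval) : ℕ → ℝ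
  | 0 => (P.q 0 : ℝ) / 4
  | k + 1 => (α (k + 1) : ℝ) / 4

/-- The value of `p_α` on `[e₂ k, e₃ k]`. -/
def high (α : ℕ → unitInterval) : ℕ → ℝ
  | 0 => (α 0 : ℝ) / 4
  | k + 1 => (P.q (k + 1) : ℝ) / 4

/-- The value of `p_α` at `ε k`. -/
def top (α : ℕ → unitInterval) : ℕ → ℝ
  | 0 => 1 / 4
  | k + 1 => P.low α k

/-- The restriction of `p_α` to the interval `[ε (k+1), ε k]`. -/
def pPiece (α : ℕ → unitInterval) (k : ℕ) (t : ℝ) : ℝ :=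
  if t ≤ P.e₁ k then P.low α k
  else if t ≤ P.e₂ k then seg (P.e₁ k) (P.low α k) (P.e₂ k) (P.high α k) t
  else if t ≤ P.e₃ k then P.high α k
  else seg (P.e₃ k) (P.high α k) (P.ε k) (P.top α k) t

/-- The function `p_α` on `(0, 1]`; the index below is the `k` with `ε (k+1) < t ≤ ε k`. -/
def pFun (α : ℕ → unitInterval) (t : ℝ) : ℝ := P.pPiece α (sInf {k | P.ε (k + 1) < t}) t

/-- The function `h^α_t(s)` on `[-1,1]²`, even in `t`. With `r = |t|` it is the polyline through
`(-1,-1)`, `(-(1+r)/2,-r)`, `(-1/2,-r/2)`, `(-p_α(r),r/4)`, `(1/2,r/2)`, `((1+r)/2,r)`, `(1,1)`;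
for `r = 0` this is the polyline through `(-1,-1)`, `(-1/2,0)`, `(1/2,0)`, `(1,1)`,
whatever the value of `p_α` at `0` is. -/
def h (α : ℕ → unitInterval) (t s : ℝ) : ℝ :=
  if t = 0 then
    if s ≤ -1 / 2 then seg (-1) (-1) (-1 / 2) 0 s
    else if s ≤ 1 / 2 then 0
    else seg (1 / 2) 0 1 1 s
  else
    if s ≤ -(1 + |t|) / 2 then seg (-1) (-1) (-(1 + |t|) / 2) (-|t|) s
    else if s ≤ -1 / 2 then seg (-(1 + |t|) / 2) (-|t|) (-1 / 2) (-|t| / 2) s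
    else if s ≤ -P.pFun α |t| then seg (-1 / 2) (-|t| / 2) (-P.pFun α |t|) (|t| / 4) s
    else if s ≤ 1 / 2 then seg (-P.pFun α |t|) (|t| / 4) (1 / 2) (|t| / 2) s
    else if s ≤ (1 + |t|) / 2 then seg (1 / 2) (|t| / 2) ((1 + |t|) / 2) |t| s
    else seg ((1 + |t|) / 2) |t| 1 1 s

/-- The inverse of the homeomorphism `h^α_t` of `[-1,1]`, for `t ≠ 0`. -/
def hInv (α : ℕ → unitInterval) (t s : ℝ) : ℝ :=
  Function.invFunOn (P.h α t) (Set.Icc (-1) 1) s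

variable (α : ℕ → unitInterval) (δ : ℕ → ℝ)

/-- The square `A_{α,n}` with centre `zₙ` and side `2 δₙ`. -/
def A (n : ℕ) : Set Torus :=
  {p | ‖p.1 - (P.z n).1‖ ≤ δ n ∧ ‖p.2 - (P.z n).2‖ ≤ δ n}

open Classical in
/-- `Λ_{α,n}(zₙ + (t,s)) = zₙ + (t, h^α_t ((h^α_{δₙ})⁻¹ s))` on the square, the identity outside. -/
def Lam (n : ℕ) (p : Torus) : Torus :=
  if p ∈ P.A δ n then
    (p.1, (P.z n).2 +
      ((P.h α (rep (p.1 - (P.z n).1)) (P.hInv α (δ n) (rep (p.2 - (P.z n).2))) : ℝ) :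
        UnitAddCircle))
  else p

/-- `Λ_{α,g(n)} ∘ ⋯ ∘ Λ_{α,g(1)} ∘ Λ_{α,g(0)}`. -/
def lamComp (g : ℕ → ℕ) : ℕ → Torus → Torus
  | 0 => P.Lam α δ (g 0)
  | n + 1 => P.Lam α δ (g (n + 1)) ∘ lamComp g n

/-- `Φ_{α,n} = Λ_{α,n} ∘ ⋯ ∘ Λ_{α,0}`. -/
def PhiN (n : ℕ) : Torus → Torus := P.lamComp α δ id n

/-- `(Φ^σ_{α,n})⁻¹ ∘ T ∘ Φ_{α,n}` on `X`, where `Φ^σ_{α,n} = Λ_{α,σ(n)} ∘ ⋯ ∘ Λ_{α,σ(0)}` is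
inverted as a bijection of `X`. -/
def fwd (n : ℕ) (p : Torus) : Torus :=
  Function.invFunOn (P.lamComp α δ sigma n) P.X (P.PhiN α δ n p + P.v)

/-- `(Φ^τ_{α,n})⁻¹ ∘ T⁻¹ ∘ Φ_{α,n}` on `X`. -/
def bwd (n : ℕ) (p : Torus) : Torus :=
  Function.invFunOn (P.lamComp α δ tau n) P.X (P.PhiN α δ n p - P.v)

/-- The conditions that the construction imposes on the half-sides `δₙ = δ_{α,n}` of the squares. -/
structure Admissible : Prop where
  pos : ∀ n, 0 < δ n
  lt_two_pow : ∀ n, δ n < 1 / 2 ^ n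
  disjoint_squares : ∀ m n, m < n → n ≤ m + 5 → Disjoint (P.A δ m) (P.A δ n)
  disjoint_columns : ∀ m n, m < n → ∀ p ∈ P.A δ n, p.1 ≠ (P.z m).1
  lt_dist : ∀ m n, m < n → δ n < ‖(P.z m).1 - (P.z n).1‖ / n
  fibre_small : ∀ n, ∀ p q : Torus, p.1 = (P.z (n + 1)).1 → q.1 = (P.z (n + 1)).1 →
    torusDist (P.PhiN α δ n p) (P.PhiN α δ n q) ≤ δ (n + 1) → torusDist p q < 1 / ((n : ℝ) + 1)
  expansion : ∃ a : ℕ → ℕ, (∀ n, 2 ≤ a n) ∧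
    (∃ c : ℝ, 0 < c ∧
      Tendsto (fun m => ∏ r ∈ Finset.Icc 1 m, (1 - 1 / (a r : ℝ))) atTop (𝓝 c)) ∧
    ∀ n m : ℕ, 1 ≤ n → n < m → ∀ p q : Torus, 1 / (n : ℝ) ≤ torusDist p q →
      (∏ r ∈ Finset.Icc (n + 1) m, (1 - 1 / (a r : ℝ))) *
          torusDist (P.PhiN α δ n p) (P.PhiN α δ n q) ≤
        torusDist (P.PhiN α δ m p) (P.PhiN α δ m q)
  fwd_uniformContinuous : ∀ n, UniformContinuousOn (P.fwd α δ n) P.X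
  bwd_uniformContinuous : ∀ n, UniformContinuousOn (P.bwd α δ n) P.X
  fwd_cauchy : UniformCauchySeqOn (P.fwd α δ) atTop P.X
  bwd_cauchy : UniformCauchySeqOn (P.bwd α δ) atTop P.X

/-- `Φ_α = lim Φ_{α,n}`. -/
def Phi (p : Torus) : Torus := limUnder atTop fun n => P.PhiN α δ n p

/-- `S_α`: the continuous extension to the torus of `Φ_α⁻¹ ∘ T ∘ Φ_α`, which is defined on the
dense set `X`, where `Φ_α` is inverted as a bijection of `X`. -/
def S : Torus → Torus :=
  extendFrom P.X fun p => Function.invFunOn (P.Phi α δ) P.X (P.Phi α δ p + P.v)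

end Params

end DenjoyRees

end

open Filter Topology

noncomputable section

namespace DenjoyRees

/-! The limit `Phi` preserves first coordinates and semiconjugates `S` to the rotation T. It is
injective over `X` by the expansion condition (`Phi_ne`), and every nondegenerate fibre lies over a
point zₙ, because h₀ has a plateau (`exists_Phi_eq_z`).

Homeomorphism: squares with nearby indices are disjoint, so their maps commute, and the compositions
reordered by `sigma` and `tau` still converge to `Phi`. Passing to the limit in Φ^σₙ ∘ fwdₙ = T ∘ Φₙ
gives a continuous lift of T through `Phi`, and `tau` gives a lift of T⁻¹ (`exists_lift`). The two
are mutually inverse, since a continuous lift of the identity is the identity on the dense set `X`.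

Non-conjugacy: if g conjugates S_α to S_β, then Φ_β ∘ g - Φ_α is S_α-invariant, hence constant by
minimality (`eq_univ_of_isClosed`). The fibre over z₀ is nondegenerate, so the constant takes z₀ to
some zₙ and is a multiple of v. After composing g with a lift of a power of T, one has Φ_β ∘ g =
Φ_α. Put E_α(a) = z₀ + (0, h_{δ₀}(-a)). Over the column x₀ + t, `Phi` differs from Λ₀ by o(t)
(`eventually_dist_Phi_Lam_le`), while h_t takes -p_α(t) to t/4 and has slopes at least t/3. Hence
points over z₀ + (t, t/4) are asymptotic to E_α(p_α(t)), and dist(g(E_α(p_α(t))), E_β(p_β(t))) → 0.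
At t = e₃ k both parameters are q_k/4, and density gives g ∘ E_α = E_β on [0, 1/4]. At t = e₁ k they
are α(k)/4 and β(k)/4, and the lower Lipschitz bound for E_β forces α(k) - β(k) → 0
(`c0Equiv_of_semiconj`).

Existence: δₙ is chosen recursively, small enough. The delicate condition is the Cauchy property.
Conjugating Λₙ₊₁ by the translation gives a map of the same kind at z_{g(n+1)}, but with half-side
δₙ₊₁ instead of δ_{g(n+1)}. The two differ by a homeomorphism of the larger square
(`exists_resize`), which lifts through an earlier Φ_k to a map Q that moves points by at most 4/2ⁿ
(`exists_correction`). Successive approximants of `S` therefore differ by a summable amount. -/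

/-! ### A closed formula for the polylines and its slope bounds. -/

theorem seg_left (x₁ y₁ x₂ y₂ : ℝ) : seg x₁ y₁ x₂ y₂ x₁ = y₁ := by simp [seg]

theorem seg_right {x₁ x₂ : ℝ} (y₁ y₂ : ℝ) (h : x₁ < x₂) : seg x₁ y₁ x₂ y₂ x₂ = y₂ := by
  have : x₂ - x₁ ≠ 0 := by linarith
  simp [seg, div_self this]

theorem continuous_seg (x₁ y₁ x₂ y₂ : ℝ) : Continuous (seg x₁ y₁ x₂ y₂) := by
  unfold seg; fun_prop

theorem seg_mem_Icc {a b x₁ y₁ x₂ y₂ s : ℝ} (hx : x₁ < x₂) (hs : s ∈ Set.Icc x₁ x₂)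
    (h₁ : y₁ ∈ Set.Icc a b) (h₂ : y₂ ∈ Set.Icc a b) : seg x₁ y₁ x₂ y₂ s ∈ Set.Icc a b := by
  have h0 : 0 < x₂ - x₁ := by linarith
  have hl : 0 ≤ (s - x₁) / (x₂ - x₁) := div_nonneg (by linarith [hs.1]) h0.le
  have hr : (s - x₁) / (x₂ - x₁) ≤ 1 := (div_le_one h0).2 (by linarith [hs.2])
  unfold seg
  generalize (s - x₁) / (x₂ - x₁) = l at hl hr
  obtain ⟨a1, b1⟩ := h₁
  obtain ⟨a2, b2⟩ := h₂
  constructor <;> nlinarith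

/-- The truncation of a real number to `[-1/2, 1/2]`. -/
def clamp (s : ℝ) : ℝ := max (-1 / 2) (min s (1 / 2))

/-- The polyline through `(-1/2, -1/2)`, `(-p, 1/4)`, `(1/2, 1/2)`. -/
def kink (p c : ℝ) : ℝ :=
  min (-1 / 2 + 3 / 4 * ((c + 1 / 2) / (1 / 2 - p))) (1 / 4 + 1 / 4 * ((c + p) / (1 / 2 + p)))

/-- A formula for the polyline `h^α_t` in terms of `r = |t|` and `p = p_α(r)`. -/
def hModel (r p s : ℝ) : ℝ :=
  s - clamp s + max 0 (s - (1 + r) / 2) + min 0 (s + (1 + r) / 2) + r * kink p (clamp s)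

theorem clamp_mem (s : ℝ) : clamp s ∈ Set.Icc (-1 / 2 : ℝ) (1 / 2) := by
  unfold clamp
  exact ⟨le_max_left _ _, max_le (by norm_num) (min_le_right _ _)⟩

theorem clamp_of_mem {s : ℝ} (h : s ∈ Set.Icc (-1 / 2 : ℝ) (1 / 2)) : clamp s = s := by
  unfold clamp
  rw [min_eq_left h.2, max_eq_right h.1]

theorem clamp_of_ge {s : ℝ} (h : 1 / 2 ≤ s) : clamp s = 1 / 2 := by
  unfold clamp
  rw [min_eq_right h, max_eq_right (by norm_num)]

theorem clamp_of_le {s : ℝ} (h : s ≤ -1 / 2) : clamp s = -1 / 2 := by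
  unfold clamp
  rw [min_eq_left (by linarith), max_eq_left h]

theorem clamp_mono : Monotone clamp := fun a b h => by
  unfold clamp
  gcongr

theorem clamp_sub_le {s s' : ℝ} (h : s ≤ s') : clamp s' - clamp s ≤ s' - s := by
  unfold clamp
  rcases max_cases (-1 / 2) (min s (1 / 2)) with ⟨h1, _⟩ | ⟨h1, _⟩ <;>
  rcases max_cases (-1 / 2) (min s' (1 / 2)) with ⟨h2, _⟩ | ⟨h2, _⟩ <;>
  rcases min_cases s (1 / 2) with ⟨h3, _⟩ | ⟨h3, _⟩ <;>
  rcases min_cases s' (1 / 2) with ⟨h4, _⟩ | ⟨h4, _⟩ <;> linarith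

theorem continuous_clamp : Continuous clamp := by unfold clamp; fun_prop

section kink

variable {p : ℝ}

theorem kink_neg_half (hp : p ∈ Set.Icc (0 : ℝ) (1 / 4)) : kink p (-1 / 2) = -1 / 2 := by
  obtain ⟨h0, h1⟩ := hp
  have h2 : -1 ≤ (-1 / 2 + p) / (1 / 2 + p) := by
    rw [le_div_iff₀ (by linarith)]; linarith
  unfold kink
  rw [min_eq_left]
  · norm_num
  · norm_num
    norm_num at h2
    linarith

theorem kink_half (hp : p ∈ Set.Icc (0 : ℝ) (1 / 4)) : kink p (1 / 2) = 1 / 2 := by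
  obtain ⟨h0, h1⟩ := hp
  have h2 : 2 ≤ (1 / 2 + 1 / 2) / (1 / 2 - p) := by
    rw [le_div_iff₀ (by linarith)]; linarith
  unfold kink
  rw [div_self (a := 1 / 2 + p) (by linarith), min_eq_right]
  · norm_num
  · linarith

theorem kink_neg (hp : p ∈ Set.Icc (0 : ℝ) (1 / 4)) : kink p (-p) = 1 / 4 := by
  obtain ⟨h0, h1⟩ := hp
  have : -p + 1 / 2 = 1 / 2 - p := by ring
  unfold kink
  rw [this, div_self (by linarith)]
  norm_num

/-- For p in [0, 1/4] the two lines have slopes in [3/2, 3] and [1/3, 1/2]. Their minimum inherits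
the lower bound 1/3 here and the upper bound 3 in `kink_sub_le`. -/
theorem kink_sub_ge (hp : p ∈ Set.Icc (0 : ℝ) (1 / 4)) {c c' : ℝ} (h : c ≤ c') :
    (c' - c) / 3 ≤ kink p c' - kink p c := by
  obtain ⟨h0, h1⟩ := hp
  have e1 : 2 * (c' - c) ≤ (c' + 1 / 2) / (1 / 2 - p) - (c + 1 / 2) / (1 / 2 - p) := by
    rw [← sub_div, le_div_iff₀ (by linarith)]; nlinarith
  have e2 : 4 / 3 * (c' - c) ≤ (c' + p) / (1 / 2 + p) - (c + p) / (1 / 2 + p) := by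
    rw [← sub_div, le_div_iff₀ (by linarith)]; nlinarith
  unfold kink
  rw [le_sub_iff_add_le]
  refine le_min ?_ ?_
  · refine le_trans (add_le_add_right (min_le_left _ _) _) ?_
    linarith
  · refine le_trans (add_le_add_right (min_le_right _ _) _) ?_
    linarith

theorem kink_sub_le (hp : p ∈ Set.Icc (0 : ℝ) (1 / 4)) {c c' : ℝ} (h : c ≤ c') :
    kink p c' - kink p c ≤ 3 * (c' - c) := by
  obtain ⟨h0, h1⟩ := hp
  have e1 : (c' + 1 / 2) / (1 / 2 - p) - (c + 1 / 2) / (1 / 2 - p) ≤ 4 * (c' - c) := by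
    rw [← sub_div, div_le_iff₀ (by linarith)]; nlinarith
  have e2 : (c' + p) / (1 / 2 + p) - (c + p) / (1 / 2 + p) ≤ 2 * (c' - c) := by
    rw [← sub_div, div_le_iff₀ (by linarith)]; nlinarith
  unfold kink
  rw [sub_le_iff_le_add, ← sub_le_iff_le_add']
  refine le_min ?_ ?_
  · have := min_le_left (-1 / 2 + 3 / 4 * ((c' + 1 / 2) / (1 / 2 - p)))
      (1 / 4 + 1 / 4 * ((c' + p) / (1 / 2 + p)))
    linarith
  · have := min_le_right (-1 / 2 + 3 / 4 * ((c' + 1 / 2) / (1 / 2 - p)))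
      (1 / 4 + 1 / 4 * ((c' + p) / (1 / 2 + p)))
    linarith

theorem abs_kink_le (hp : p ∈ Set.Icc (0 : ℝ) (1 / 4)) {c : ℝ}
    (hc : c ∈ Set.Icc (-1 / 2 : ℝ) (1 / 2)) : |kink p c| ≤ 1 / 2 := by
  have h1 := kink_sub_ge hp hc.1
  have h2 := kink_sub_ge hp hc.2
  rw [kink_neg_half hp] at h1
  rw [kink_half hp] at h2
  rw [abs_le]
  constructor <;> linarith [hc.1, hc.2]

end kink

/-- The central part has slope at least r/3 and the outer parts at least 1 ≥ r/3. This bound turns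
an error o(t) in the value of h_t into an error o(1) in its argument. -/
theorem hModel_sub_ge {r p s s' : ℝ} (hp : p ∈ Set.Icc (0 : ℝ) (1 / 4)) (hr0 : 0 ≤ r) (hr1 : r ≤ 1)
    (h : s ≤ s') : r / 3 * (s' - s) ≤ hModel r p s' - hModel r p s := by
  have h1 := kink_sub_ge hp (clamp_mono h)
  have h2 := clamp_sub_le h
  have h3 : max 0 (s - (1 + r) / 2) ≤ max 0 (s' - (1 + r) / 2) := by gcongr
  have h4 : min 0 (s + (1 + r) / 2) ≤ min 0 (s' + (1 + r) / 2) := by gcongr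
  have h5 := mul_le_mul_of_nonneg_left h1 hr0
  unfold hModel
  nlinarith

theorem hModel_sub_le {r p s s' : ℝ} (hp : p ∈ Set.Icc (0 : ℝ) (1 / 4)) (hr0 : 0 ≤ r) (hr1 : r ≤ 1)
    (h : s ≤ s') : hModel r p s' - hModel r p s ≤ 6 * (s' - s) := by
  have h1 := kink_sub_le hp (clamp_mono h)
  have h2 := clamp_sub_le h
  have h0 := clamp_mono h
  have h3 : max 0 (s' - (1 + r) / 2) ≤ max 0 (s - (1 + r) / 2) + (s' - s) :=
    max_le (by linarith [le_max_left 0 (s - (1 + r) / 2)])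
      (by linarith [le_max_right 0 (s - (1 + r) / 2)])
  have h4 : min 0 (s' + (1 + r) / 2) - (s' - s) ≤ min 0 (s + (1 + r) / 2) :=
    le_min (by linarith [min_le_left 0 (s' + (1 + r) / 2)])
      (by linarith [min_le_right 0 (s' + (1 + r) / 2)])
  have h5 := mul_le_mul_of_nonneg_left h1 hr0
  unfold hModel
  nlinarith

theorem hModel_of_ge {r p s : ℝ} (hp : p ∈ Set.Icc (0 : ℝ) (1 / 4)) (hr0 : 0 ≤ r)
    (h : (1 + r) / 2 ≤ s) : hModel r p s = 2 * s - 1 := by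
  unfold hModel
  rw [clamp_of_ge (by linarith), kink_half hp, max_eq_right (by linarith), min_eq_left (by linarith)]
  ring

theorem hModel_of_le {r p s : ℝ} (hp : p ∈ Set.Icc (0 : ℝ) (1 / 4)) (hr0 : 0 ≤ r)
    (h : s ≤ -(1 + r) / 2) : hModel r p s = 2 * s + 1 := by
  unfold hModel
  rw [clamp_of_le (by linarith), kink_neg_half hp, max_eq_left (by linarith),
    min_eq_right (by linarith)]
  ring

theorem hModel_of_mem {r p s : ℝ} (hr0 : 0 ≤ r) (h : s ∈ Set.Icc (-1 / 2 : ℝ) (1 / 2)) :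
    hModel r p s = r * kink p s := by
  unfold hModel
  rw [clamp_of_mem h, max_eq_left (by linarith [h.2]), min_eq_left (by linarith [h.1])]
  ring

theorem continuous_hModel (r p : ℝ) : Continuous (hModel r p) := by
  have := continuous_clamp
  unfold hModel kink
  fun_prop

/-! ### The functions p_α and h^α_t. -/

namespace Params

variable (P : Params) (α : ℕ → unitInterval)

theorem ε_succ_lt (k : ℕ) : P.ε (k + 1) < P.ε k :=
  (P.lt_e₁ k).trans ((P.e₁_lt_e₂ k).trans ((P.e₂_lt_e₃ k).trans (P.e₃_lt k)))

theorem ε_strictAnti : StrictAnti P.ε := strictAnti_nat_of_succ_lt P.ε_succ_lt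

theorem ε_pos (k : ℕ) : 0 < P.ε k :=
  (P.ε_strictAnti.antitone.le_of_tendsto P.ε_tendsto (k + 1)).trans_lt (P.ε_succ_lt k)

theorem low_mem (k : ℕ) : P.low α k ∈ Set.Icc (0 : ℝ) (1 / 4) := by
  rcases k with _ | k
  · have := (P.q 0).2
    simp only [low]
    exact ⟨by linarith [this.1], by linarith [this.2]⟩
  · have := (α (k + 1)).2
    simp only [low]
    exact ⟨by linarith [this.1], by linarith [this.2]⟩

theorem high_mem (k : ℕ) : P.high α k ∈ Set.Icc (0 : ℝ) (1 / 4) := by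
  rcases k with _ | k
  · have := (α 0).2
    simp only [high]
    exact ⟨by linarith [this.1], by linarith [this.2]⟩
  · have := (P.q (k + 1)).2
    simp only [high]
    exact ⟨by linarith [this.1], by linarith [this.2]⟩

theorem top_mem (k : ℕ) : P.top α k ∈ Set.Icc (0 : ℝ) (1 / 4) := by
  rcases k with _ | k
  · simp only [top]; norm_num
  · exact P.low_mem α k

theorem pPiece_mem (k : ℕ) {t : ℝ} (ht : t ≤ P.ε k) : P.pPiece α k t ∈ Set.Icc (0 : ℝ) (1 / 4) := by
  unfold pPiece
  split_ifs with h1 h2 h3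
  · exact P.low_mem α k
  · exact seg_mem_Icc (P.e₁_lt_e₂ k) ⟨(not_le.1 h1).le, h2⟩ (P.low_mem α k) (P.high_mem α k)
  · exact P.high_mem α k
  · exact seg_mem_Icc (P.e₃_lt k) ⟨(not_le.1 h3).le, ht⟩ (P.high_mem α k) (P.top_mem α k)

theorem continuous_pPiece (k : ℕ) : Continuous (P.pPiece α k) := by
  unfold pPiece
  refine Continuous.if_le continuous_const (Continuous.if_le (continuous_seg _ _ _ _)
    (Continuous.if_le continuous_const (continuous_seg _ _ _ _) continuous_id continuous_const ?_)
    continuous_id continuous_const ?_) continuous_id continuous_const ?_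
  · rintro t rfl
    rw [seg_left]
  · rintro t rfl
    rw [seg_right _ _ (P.e₁_lt_e₂ k), if_pos (P.e₂_lt_e₃ k).le]
  · rintro t rfl
    rw [if_pos (P.e₁_lt_e₂ k).le, seg_left]

theorem pPiece_right (k : ℕ) : P.pPiece α k (P.ε k) = P.top α k := by
  unfold pPiece
  have h1 := P.e₁_lt_e₂ k
  have h2 := P.e₂_lt_e₃ k
  have h3 := P.e₃_lt k
  rw [if_neg (by linarith), if_neg (by linarith), if_neg (by linarith), seg_right _ _ h3]

theorem pFun_eq {k : ℕ} {t : ℝ} (h1 : P.ε (k + 1) < t) (h2 : t ≤ P.ε k) :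
    P.pFun α t = P.pPiece α k t := by
  have : sInf {k | P.ε (k + 1) < t} = k := by
    refine le_antisymm (Nat.sInf_le h1) (le_csInf ⟨k, h1⟩ fun j hj => ?_)
    by_contra hlt
    have : P.ε k ≤ P.ε (j + 1) := P.ε_strictAnti.antitone (by omega)
    have hj' : P.ε (j + 1) < t := hj
    linarith
  rw [pFun, this]

theorem exists_ε_interval {t : ℝ} (h0 : 0 < t) (h1 : t ≤ 1) :
    ∃ k, P.ε (k + 1) < t ∧ t ≤ P.ε k := by
  have hex : ∃ k, P.ε (k + 1) < t :=
    (((tendsto_add_atTop_iff_nat 1).2 P.ε_tendsto).eventually_lt_const h0).exists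
  classical
  refine ⟨Nat.find hex, Nat.find_spec hex, ?_⟩
  rcases hk : Nat.find hex with _ | k
  · rw [P.ε_zero]; exact h1
  · exact not_lt.1 (Nat.find_min hex (m := k) (by omega))

theorem pFun_mem {t : ℝ} (ht : t ≤ 1) : P.pFun α t ∈ Set.Icc (0 : ℝ) (1 / 4) := by
  rcases le_or_gt t 0 with h0 | h0
  -- For t ≤ 0 the infimum is over the empty set, hence 0, and the formula of the piece with index 0
  -- applies.
  · have : {k | P.ε (k + 1) < t} = ∅ := by
      ext k
      simp only [Set.mem_ofPred_eq, Set.mem_empty_iff_false, iff_false, not_lt]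
      exact h0.trans (P.ε_pos _).le
    rw [pFun, this, Nat.sInf_empty]
    exact P.pPiece_mem α 0 (by rw [P.ε_zero]; exact ht)
  · obtain ⟨k, h1, h2⟩ := P.exists_ε_interval h0 ht
    rw [P.pFun_eq α h1 h2]
    exact P.pPiece_mem α k h2

theorem pFun_of_low {k : ℕ} {t : ℝ} (h1 : P.ε (k + 1) < t) (h2 : t ≤ P.e₁ k) :
    P.pFun α t = P.low α k := by
  rw [P.pFun_eq α h1 (by linarith [P.e₁_lt_e₂ k, P.e₂_lt_e₃ k, P.e₃_lt k]), pPiece, if_pos h2]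

theorem pFun_of_high {k : ℕ} {t : ℝ} (h1 : P.e₂ k < t) (h2 : t ≤ P.e₃ k) :
    P.pFun α t = P.high α k := by
  have := P.e₁_lt_e₂ k
  rw [P.pFun_eq α (by linarith [P.lt_e₁ k]) (by linarith [P.e₃_lt k]), pPiece,
    if_neg (by linarith), if_neg (by linarith), if_pos h2]

theorem continuousAt_pFun {t : ℝ} (h0 : 0 < t) (h1 : t < 1) : ContinuousAt (P.pFun α) t := by
  -- Two adjacent pieces are glued on an open interval around ε (k + 1), so that the division points
  -- need no separate treatment.
  have key : ∀ k, P.ε (k + 2) < t → t < P.ε k → ContinuousAt (P.pFun α) t := by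
    intro k hl hr
    have hc : Continuous fun t => if t ≤ P.ε (k + 1) then P.pPiece α (k + 1) t
        else P.pPiece α k t := by
      refine Continuous.if_le (P.continuous_pPiece α _) (P.continuous_pPiece α _) continuous_id
        continuous_const ?_
      rintro s rfl
      rw [pPiece_right, top, pPiece, if_pos (P.lt_e₁ k).le]
    refine hc.continuousAt.congr ?_
    filter_upwards [Ioo_mem_nhds hl hr] with s hs
    split_ifs with h
    · exact (P.pFun_eq α hs.1 h).symm
    · exact (P.pFun_eq α (not_le.1 h) hs.2.le).symm
  obtain ⟨k, hl, hr⟩ := P.exists_ε_interval h0 h1.le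
  rcases hr.lt_or_eq with hr | rfl
  · exact key k ((P.ε_succ_lt (k + 1)).trans hl) hr
  · rcases k with _ | k
    · exact absurd P.ε_zero h1.ne
    · exact key k hl (P.ε_succ_lt k)

/-- At |t| = 1 the outer segments degenerate, hence the strict bound; the squares only use |t| <
1/2. -/
theorem h_eq_hModel {t : ℝ} (ht : |t| < 1) (s : ℝ) :
    P.h α t s = hModel |t| (P.pFun α |t|) s := by
  have hp := P.pFun_mem α ht.le
  unfold h
  split_ifs with h0 h1 h2 h3 h4 h5 h6 h7
  · subst h0
    rw [hModel_of_le hp (abs_nonneg _) (by simpa using h1)]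
    simp only [seg]; ring
  · subst h0
    rw [hModel_of_mem (abs_nonneg _) ⟨(not_le.1 h1).le, h2⟩]
    simp
  · subst h0
    rw [hModel_of_ge hp (abs_nonneg _) (by simpa using (not_le.1 h2).le)]
    simp only [seg]; ring
  all_goals have hr : 0 < |t| := abs_pos.2 h0
  all_goals generalize |t| = r at *
  all_goals generalize P.pFun α r = p at *
  · rw [hModel_of_le hp hr.le h3]
    have h1 : (1 - r) ≠ 0 := by linarith
    have : -(1 + r) / 2 - -1 = (1 - r) / 2 := by ring
    simp only [seg, this]; field_simp; ring
  · have h3' := not_le.1 h3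
    unfold hModel
    rw [clamp_of_le h4, kink_neg_half hp, max_eq_left (by linarith), min_eq_left (by linarith)]
    simp only [seg]
    have : -1 / 2 - -(1 + r) / 2 = r / 2 := by ring
    rw [this]
    field_simp; ring
  · have h4' := not_le.1 h4
    rw [hModel_of_mem hr.le ⟨h4'.le, by linarith [hp.1]⟩]
    have e1 : 0 < 1 / 2 - p := by linarith [hp.2]
    have e2 : 0 < 1 / 2 + p := by linarith [hp.1]
    -- The two lines cross at s = -p and the first is the steeper, so it gives the minimum to the
    -- left of -p.
    have hk : kink p s = -1 / 2 + 3 / 4 * ((s + 1 / 2) / (1 / 2 - p)) := by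
      unfold kink
      refine min_eq_left ?_
      have a1 : (s + 1 / 2) / (1 / 2 - p) = 1 + (s + p) / (1 / 2 - p) := by
        rw [show s + 1 / 2 = (1 / 2 - p) + (s + p) by ring, add_div, div_self e1.ne']
      have a2 : (s + p) / (1 / 2 - p) ≤ (s + p) / (1 / 2 + p) := by
        rw [div_le_div_iff₀ e1 e2]
        nlinarith [hp.1]
      have a3 : (s + p) / (1 / 2 - p) ≤ 0 := div_nonpos_of_nonpos_of_nonneg (by linarith) e1.le
      rw [a1]; linarith
    rw [hk]
    have : -p - -1 / 2 = 1 / 2 - p := by ring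
    simp only [seg, this]
    ring
  · have h5' := not_le.1 h5
    rw [hModel_of_mem hr.le ⟨by linarith [hp.2], h6⟩]
    have e1 : 0 < 1 / 2 - p := by linarith [hp.2]
    have e2 : 0 < 1 / 2 + p := by linarith [hp.1]
    have hk : kink p s = 1 / 4 + 1 / 4 * ((s + p) / (1 / 2 + p)) := by
      unfold kink
      refine min_eq_right ?_
      have a1 : (s + 1 / 2) / (1 / 2 - p) = 1 + (s + p) / (1 / 2 - p) := by
        rw [show s + 1 / 2 = (1 / 2 - p) + (s + p) by ring, add_div, div_self e1.ne']
      have a2 : (s + p) / (1 / 2 + p) ≤ (s + p) / (1 / 2 - p) := by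
        rw [div_le_div_iff₀ e2 e1]
        nlinarith [hp.1]
      have a3 : 0 ≤ (s + p) / (1 / 2 - p) := div_nonneg (by linarith) e1.le
      rw [a1]; linarith
    rw [hk]
    have : 1 / 2 - -p = 1 / 2 + p := by ring
    simp only [seg, this]
    ring
  · have h6' := not_le.1 h6
    unfold hModel
    rw [clamp_of_ge h6'.le, kink_half hp, max_eq_left (by linarith), min_eq_left (by linarith)]
    simp only [seg]
    have : (1 + r) / 2 - 1 / 2 = r / 2 := by ring
    rw [this]
    field_simp; ring
  · rw [hModel_of_ge hp hr.le (not_le.1 h7).le]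
    have : 1 - (1 + r) / 2 = (1 - r) / 2 := by ring
    have : (1 - r) ≠ 0 := by linarith
    simp only [seg]; rw [‹1 - (1 + r) / 2 = _›]; field_simp; ring

theorem h_abs (t s : ℝ) : P.h α |t| s = P.h α t s := by
  simp [h]

theorem h_sub_ge {t s s' : ℝ} (ht : |t| < 1) (hs : s ≤ s') :
    |t| / 3 * (s' - s) ≤ P.h α t s' - P.h α t s := by
  rw [P.h_eq_hModel α ht, P.h_eq_hModel α ht]
  exact hModel_sub_ge (P.pFun_mem α ht.le) (abs_nonneg t) ht.le hs

theorem abs_h_sub_ge {t : ℝ} (s s' : ℝ) (ht : |t| < 1) :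
    |t| / 3 * |s' - s| ≤ |P.h α t s' - P.h α t s| := by
  rcases le_total s s' with hs | hs
  · rw [abs_of_nonneg (sub_nonneg.2 hs)]
    exact (P.h_sub_ge α ht hs).trans (le_abs_self _)
  · rw [abs_sub_comm s', abs_sub_comm (P.h α t s'), abs_of_nonneg (sub_nonneg.2 hs)]
    exact (P.h_sub_ge α ht hs).trans (le_abs_self _)

theorem abs_h_sub_le {t : ℝ} (s s' : ℝ) (ht : |t| < 1) :
    |P.h α t s' - P.h α t s| ≤ 6 * |s' - s| := by
  have hp := P.pFun_mem α ht.le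
  have key : ∀ s s' : ℝ, s ≤ s' → |P.h α t s' - P.h α t s| ≤ 6 * |s' - s| := by
    intro s s' hs
    have h0 := P.h_sub_ge α ht hs
    have h2 : 0 ≤ |t| / 3 * (s' - s) := by
      have := sub_nonneg.2 hs
      positivity
    rw [abs_of_nonneg (sub_nonneg.2 hs), abs_of_nonneg (h2.trans h0),
      P.h_eq_hModel α ht, P.h_eq_hModel α ht]
    exact hModel_sub_le hp (abs_nonneg t) ht.le hs
  rcases le_total s s' with hs | hs
  · exact key s s' hs
  · rw [abs_sub_comm s', abs_sub_comm (P.h α t s')]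
    exact key s' s hs

theorem h_mono {t : ℝ} (ht : |t| < 1) : Monotone (P.h α t) := fun s s' hs => by
  have h0 := P.h_sub_ge α ht hs
  have : 0 ≤ |t| / 3 * (s' - s) := by
    have := sub_nonneg.2 hs
    positivity
  linarith

theorem h_injective {t : ℝ} (h0 : t ≠ 0) (ht : |t| < 1) : Function.Injective (P.h α t) := by
  intro s s' hs
  have h1 := P.abs_h_sub_ge α s s' ht
  rw [hs, sub_self, abs_zero] at h1
  have h2 : 0 < |t| / 3 := by have := abs_pos.2 h0; positivity
  have h3 : |s' - s| ≤ 0 := by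
    by_contra h
    have := mul_pos h2 (not_le.1 h)
    linarith
  linarith [abs_nonpos_iff.1 h3]

theorem h_of_ge {t s : ℝ} (ht : |t| < 1) (h : (1 + |t|) / 2 ≤ s) : P.h α t s = 2 * s - 1 := by
  rw [P.h_eq_hModel α ht, hModel_of_ge (P.pFun_mem α ht.le) (abs_nonneg t) h]

theorem h_of_le {t s : ℝ} (ht : |t| < 1) (h : s ≤ -(1 + |t|) / 2) : P.h α t s = 2 * s + 1 := by
  rw [P.h_eq_hModel α ht, hModel_of_le (P.pFun_mem α ht.le) (abs_nonneg t) h]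

theorem h_neg_pFun {t : ℝ} (ht : |t| < 1) : P.h α t (-P.pFun α |t|) = |t| / 4 := by
  have hp := P.pFun_mem α ht.le
  rw [P.h_eq_hModel α ht, hModel_of_mem (abs_nonneg t) ⟨by linarith [hp.2], by linarith [hp.1]⟩,
    kink_neg hp]
  ring

theorem h_zero_of_mem {s : ℝ} (hs : s ∈ Set.Icc (-1 / 2 : ℝ) (1 / 2)) : P.h α 0 s = 0 := by
  rw [P.h_eq_hModel α (by simp), hModel_of_mem (abs_nonneg _) hs]
  simp

theorem continuous_h {t : ℝ} (ht : |t| < 1) : Continuous (P.h α t) := by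
  have : P.h α t = hModel |t| (P.pFun α |t|) := funext (P.h_eq_hModel α ht)
  rw [this]
  exact continuous_hModel _ _

/-- Although p_α(t) may oscillate as t → 0, it enters only through a bounded function multiplied by
|t|. -/
theorem continuousAt_h {t : ℝ} (ht : |t| < 1) (s : ℝ) :
    ContinuousAt (fun x : ℝ × ℝ => P.h α x.1 x.2) (t, s) := by
  have hev : ∀ᶠ x : ℝ × ℝ in 𝓝 (t, s), |x.1| < 1 :=
    (continuous_fst.abs.continuousAt (x := (t, s))).eventually_lt_const ht
  refine ContinuousAt.congr (f := fun x : ℝ × ℝ => hModel |x.1| (P.pFun α |x.1|) x.2) ?_ ?_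
  swap
  · filter_upwards [hev] with x hx
    rw [P.h_eq_hModel α hx]
  have hcl := continuous_clamp
  unfold hModel
  refine ContinuousAt.add (by fun_prop) ?_
  rcases eq_or_ne t 0 with rfl | h0
  · have hz : Tendsto (fun x : ℝ × ℝ => |x.1| * kink (P.pFun α |x.1|) (clamp x.2)) (𝓝 (0, s))
        (𝓝 0) := by
      have hb : Tendsto (fun x : ℝ × ℝ => |x.1|) (𝓝 (0, s)) (𝓝 0) := by
        have : Continuous fun x : ℝ × ℝ => |x.1| := by fun_prop
        simpa using this.tendsto (0, s)
      refine squeeze_zero_norm' ?_ hb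
      filter_upwards [hev] with x hx
      rw [Real.norm_eq_abs, abs_mul, abs_abs]
      have := abs_kink_le (P.pFun_mem α hx.le) (clamp_mem x.2)
      nlinarith [abs_nonneg x.1]
    simpa [ContinuousAt] using hz
  · have hp := P.pFun_mem α ht.le
    have hpc : ContinuousAt (fun x : ℝ × ℝ => P.pFun α |x.1|) (t, s) :=
      ContinuousAt.comp (g := P.pFun α) (f := fun x : ℝ × ℝ => |x.1|)
        (P.continuousAt_pFun α (abs_pos.2 h0) ht) (by fun_prop)
    refine ContinuousAt.mul (by fun_prop) ?_
    unfold kink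
    refine Filter.Tendsto.min ?_ ?_
    · refine continuousAt_const.add (continuousAt_const.mul (ContinuousAt.div (by fun_prop)
        (continuousAt_const.sub hpc) ?_))
      change (1 / 2 - P.pFun α |t|) ≠ 0
      linarith [hp.2]
    · refine continuousAt_const.add (continuousAt_const.mul (ContinuousAt.div
        (ContinuousAt.add (by fun_prop) hpc) (continuousAt_const.add hpc) ?_))
      change (1 / 2 + P.pFun α |t|) ≠ 0
      linarith [hp.1]

theorem h_half_add {t d : ℝ} (htd : |t| ≤ d) (hd : d < 1) : P.h α t ((1 + d) / 2) = d := by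
  rw [P.h_of_ge α (by linarith) (by linarith)]; ring

theorem h_neg_half_add {t d : ℝ} (htd : |t| ≤ d) (hd : d < 1) : P.h α t (-(1 + d) / 2) = -d := by
  rw [P.h_of_le α (by linarith) (by linarith)]; ring

/-- For `|t| ≤ d`, `h_t` maps `[-(1+d)/2, (1+d)/2]` onto `[-d, d]`. -/
theorem h_mem {t d u : ℝ} (htd : |t| ≤ d) (hd : d < 1) (hu : |u| ≤ (1 + d) / 2) :
    |P.h α t u| ≤ d := by
  have hm := P.h_mono α (htd.trans_lt hd)
  rw [abs_le] at hu ⊢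
  rw [← neg_div] at hu
  exact ⟨(P.h_neg_half_add α htd hd).symm.le.trans (hm hu.1),
    (hm hu.2).trans (P.h_half_add α htd hd).le⟩

theorem exists_h_eq {t d s : ℝ} (htd : |t| ≤ d) (hd : d < 1) (hs : |s| ≤ d) :
    ∃ u, |u| ≤ (1 + d) / 2 ∧ P.h α t u = s := by
  have hd0 : 0 ≤ d := (abs_nonneg t).trans htd
  have := intermediate_value_Icc (a := -(1 + d) / 2) (b := (1 + d) / 2) (by linarith)
    (P.continuous_h α (htd.trans_lt hd)).continuousOn
  rw [P.h_neg_half_add α htd hd, P.h_half_add α htd hd] at this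
  obtain ⟨u, hu, rfl⟩ := this (abs_le.1 hs)
  exact ⟨u, abs_le.2 ⟨by linarith [hu.1], hu.2⟩, rfl⟩

section hInv

variable {d : ℝ}

theorem hInv_h (hd0 : 0 < d) (hd : d < 1) {u : ℝ} (hu : |u| ≤ (1 + d) / 2) :
    P.hInv α d (P.h α d u) = u := by
  have had : |d| = d := abs_of_pos hd0
  have hu' : u ∈ Set.Icc (-1 : ℝ) 1 := abs_le.1 (by linarith)
  exact (P.h_injective α hd0.ne' (by linarith)).injOn.leftInvOn_invFunOn hu'

theorem h_hInv (hd0 : 0 < d) (hd : d < 1) {s : ℝ} (hs : |s| ≤ d) :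
    P.h α d (P.hInv α d s) = s := by
  obtain ⟨u, hu, rfl⟩ := P.exists_h_eq α (abs_of_pos hd0).le hd hs
  rw [P.hInv_h α hd0 hd hu]

theorem hInv_mem (hd0 : 0 < d) (hd : d < 1) {s : ℝ} (hs : |s| ≤ d) :
    |P.hInv α d s| ≤ (1 + d) / 2 := by
  obtain ⟨u, hu, rfl⟩ := P.exists_h_eq α (abs_of_pos hd0).le hd hs
  rwa [P.hInv_h α hd0 hd hu]

theorem continuousOn_hInv (hd0 : 0 < d) (hd : d < 1) :
    ContinuousOn (P.hInv α d) (Set.Icc (-d) d) := by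
  refine (LipschitzOnWith.of_dist_le_mul (K := ⟨3 / d, by positivity⟩) ?_).continuousOn
  intro s hs s' hs'
  have h1 := P.abs_h_sub_ge α (P.hInv α d s') (P.hInv α d s) (t := d) (by rwa [abs_of_pos hd0])
  rw [P.h_hInv α hd0 hd (abs_le.2 hs), P.h_hInv α hd0 hd (abs_le.2 hs'), abs_of_pos hd0] at h1
  rw [Real.dist_eq, Real.dist_eq]
  change _ ≤ 3 / d * _
  rw [div_mul_eq_mul_div, le_div_iff₀ hd0]
  linarith

end hInv

end Params

/-! ### Coordinates on the circle and on small squares. -/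

theorem coe_rep (u : UnitAddCircle) : ((rep u : ℝ) : UnitAddCircle) = u :=
  (AddCircle.equivIco (1 : ℝ) (-1 / 2)).symm_apply_apply u

theorem rep_mem (u : UnitAddCircle) : rep u ∈ Set.Ico (-1 / 2 : ℝ) (1 / 2) := by
  have := (AddCircle.equivIco (1 : ℝ) (-1 / 2) u).2
  norm_num at this ⊢
  exact this

theorem norm_coe_of_abs_le {t : ℝ} (ht : |t| ≤ 1 / 2) : ‖(t : UnitAddCircle)‖ = |t| :=
  (AddCircle.norm_coe_eq_abs_iff (1 : ℝ) one_ne_zero).2 (by simpa using ht)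

theorem abs_rep (u : UnitAddCircle) : |rep u| = ‖u‖ := by
  have h := rep_mem u
  conv_rhs => rw [← coe_rep u]
  exact (norm_coe_of_abs_le (abs_le.2 ⟨by linarith [h.1], h.2.le⟩)).symm

theorem norm_le_half (u : UnitAddCircle) : ‖u‖ ≤ 1 / 2 := by
  have h := rep_mem u
  rw [← abs_rep]
  exact abs_le.2 ⟨by linarith [h.1], h.2.le⟩

theorem coe_injOn {t t' : ℝ} (ht : |t| < 1 / 2) (ht' : |t'| < 1 / 2)
    (h : (t : UnitAddCircle) = t') : t = t' := by
  rw [abs_lt] at ht ht'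
  exact (AddCircle.coe_eq_coe_iff_of_mem_Ico (a := (-1 / 2 : ℝ))
    ⟨by linarith, by linarith⟩ ⟨by linarith, by linarith⟩).1 h

theorem rep_coe {t : ℝ} (ht : |t| < 1 / 2) : rep (t : UnitAddCircle) = t := by
  have : ‖(t : UnitAddCircle)‖ < 1 / 2 := by rwa [norm_coe_of_abs_le ht.le]
  exact coe_injOn (by rwa [abs_rep]) ht (coe_rep _)

theorem continuousAt_rep {u : UnitAddCircle} (hu : ‖u‖ < 1 / 2) : ContinuousAt rep u := by
  refine continuousAt_subtype_val.comp (AddCircle.continuousAt_equivIco (1 : ℝ) (-1 / 2) ?_)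
  rintro rfl
  rw [norm_coe_of_abs_le (by norm_num [abs_le])] at hu
  norm_num [abs_lt] at hu


theorem continuous_coe_circle : Continuous fun t : ℝ => (t : UnitAddCircle) :=
  AddCircle.continuous_mk' 1

/-- The closed square with centre `z` and half-side `d`. -/
def sq (z : Torus) (d : ℝ) : Set Torus := {p | ‖p.1 - z.1‖ ≤ d ∧ ‖p.2 - z.2‖ ≤ d}

/-- The point `z + (t, s)`. -/
def pt (z : Torus) (t s : ℝ) : Torus := (z.1 + (t : UnitAddCircle), z.2 + (s : UnitAddCircle))

theorem sq_mono (z : Torus) {d d' : ℝ} (h : d ≤ d') : sq z d ⊆ sq z d' :=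
  fun _ hp => ⟨hp.1.trans h, hp.2.trans h⟩

theorem isClosed_sq (z : Torus) (d : ℝ) : IsClosed (sq z d) := by
  have h1 : Continuous fun p : Torus => ‖p.1 - z.1‖ := by fun_prop
  have h2 : Continuous fun p : Torus => ‖p.2 - z.2‖ := by fun_prop
  exact (isClosed_le h1 continuous_const).inter (isClosed_le h2 continuous_const)

theorem mem_sq_self (z : Torus) {d : ℝ} (hd : 0 ≤ d) : z ∈ sq z d := by
  simp [sq, hd]

theorem pt_mem_sq (z : Torus) {d t s : ℝ} (hd : d < 1 / 2) (ht : |t| ≤ d) (hs : |s| ≤ d) :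
    pt z t s ∈ sq z d := by
  simp only [sq, pt, Set.mem_ofPred_eq, add_sub_cancel_left]
  rw [norm_coe_of_abs_le (by linarith), norm_coe_of_abs_le (by linarith)]
  exact ⟨ht, hs⟩

theorem exists_pt_of_mem_sq {z : Torus} {d : ℝ} {p : Torus} (hp : p ∈ sq z d) :
    ∃ t s, |t| ≤ d ∧ |s| ≤ d ∧ p = pt z t s := by
  refine ⟨rep (p.1 - z.1), rep (p.2 - z.2), (abs_rep _).trans_le hp.1, (abs_rep _).trans_le hp.2, ?_⟩
  simp [pt, coe_rep]

theorem pt_fst_inj {z : Torus} {t s t' s' : ℝ} (ht : |t| < 1 / 2) (ht' : |t'| < 1 / 2)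
    (h : (pt z t s).1 = (pt z t' s').1) : t = t' :=
  coe_injOn ht ht' (add_left_cancel h)

theorem pt_snd_inj {z : Torus} {t s t' s' : ℝ} (hs : |s| < 1 / 2) (hs' : |s'| < 1 / 2)
    (h : (pt z t s).2 = (pt z t' s').2) : s = s' :=
  coe_injOn hs hs' (add_left_cancel h)

/-- Conditions on the profile `m` under which `vmap` is continuous. -/
structure IsProfile (d : ℝ) (m : ℝ → ℝ) : Prop where
  continuous : Continuous m
  abs_le : ∀ t, |t| ≤ d → |m t| ≤ d
  abs_eq : ∀ t, |t| = d → |m t| = d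

theorem isProfile_id (d : ℝ) : IsProfile d id := ⟨continuous_id, fun _ h => h, fun _ h => h⟩

/-- Freezing |t| at d' leaves to the square of half-side d' exactly the remaining part of the
collapse. For d' > 0 this profile never vanishes, so the corresponding map is bijective. -/
theorem isProfile_max {d d' : ℝ} (h0 : 0 ≤ d') (h : d' ≤ d) :
    IsProfile d fun t => max d' |t| := by
  refine ⟨by fun_prop, fun t ht => ?_, fun t ht => ?_⟩
  · rw [abs_of_nonneg (h0.trans (le_max_left _ _))]
    exact max_le h ht
  · rw [abs_of_nonneg (h0.trans (le_max_left _ _)), ht, max_eq_right h]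

/-! ### Fibred maps supported in a square. -/

namespace Params

variable (P : Params) (α : ℕ → unitInterval)

open Classical in
/-- The map `z + (t, s) ↦ z + (t, h_{m t} (h_d⁻¹ s))` on the square, the identity outside. -/
def vmap (z : Torus) (d : ℝ) (m : ℝ → ℝ) (p : Torus) : Torus :=
  if p ∈ sq z d then
    (p.1, z.2 + ((P.h α (m (rep (p.1 - z.1))) (P.hInv α d (rep (p.2 - z.2))) : ℝ) : UnitAddCircle))
  else p

theorem Lam_eq_vmap (δ : ℕ → ℝ) (n : ℕ) : P.Lam α δ n = P.vmap α (P.z n) (δ n) id := rfl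

variable {z : Torus} {d : ℝ} {m : ℝ → ℝ}

theorem vmap_fst (p : Torus) : (P.vmap α z d m p).1 = p.1 := by
  unfold vmap; split_ifs <;> rfl

theorem vmap_of_notMem {p : Torus} (hp : p ∉ sq z d) : P.vmap α z d m p = p := if_neg hp

theorem exists_pt_h_of_mem_sq (hd0 : 0 < d) (hd : d < 1 / 2) {p : Torus} (hp : p ∈ sq z d) :
    ∃ t u, |t| ≤ d ∧ |u| ≤ (1 + d) / 2 ∧ p = pt z t (P.h α d u) := by
  obtain ⟨t, s, ht, hs, rfl⟩ := exists_pt_of_mem_sq hp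
  exact ⟨t, P.hInv α d s, ht, P.hInv_mem α hd0 (by linarith) hs, by
    rw [P.h_hInv α hd0 (by linarith) hs]⟩

theorem vmap_pt (hd0 : 0 < d) (hd : d < 1 / 2) {t u : ℝ} (ht : |t| ≤ d) (hu : |u| ≤ (1 + d) / 2) :
    P.vmap α z d m (pt z t (P.h α d u)) = pt z t (P.h α (m t) u) := by
  have hs : |P.h α d u| ≤ d := P.h_mem α (abs_of_pos hd0).le (by linarith) hu
  rw [vmap, if_pos (pt_mem_sq z hd ht hs)]
  simp only [pt, add_sub_cancel_left]
  rw [rep_coe (by linarith), rep_coe (by linarith), P.hInv_h α hd0 (by linarith) hu]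

theorem vmap_mem_sq (hd0 : 0 < d) (hd : d < 1 / 2) (hm : IsProfile d m) {p : Torus}
    (hp : p ∈ sq z d) : P.vmap α z d m p ∈ sq z d := by
  obtain ⟨t, u, ht, hu, rfl⟩ := P.exists_pt_h_of_mem_sq α hd0 hd hp
  rw [P.vmap_pt α hd0 hd ht hu]
  exact pt_mem_sq z hd ht (P.h_mem α (hm.abs_le t ht) (by linarith) hu)

theorem vmap_mem_sq_iff (hd0 : 0 < d) (hd : d < 1 / 2) (hm : IsProfile d m) {p : Torus} :
    P.vmap α z d m p ∈ sq z d ↔ p ∈ sq z d := by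
  refine ⟨fun h => ?_, P.vmap_mem_sq α hd0 hd hm⟩
  by_contra hp
  rw [P.vmap_of_notMem α hp] at h
  exact hp h

theorem dist_vmap_le (hd0 : 0 < d) (hd : d < 1 / 2) (hm : IsProfile d m) (p : Torus) :
    dist (P.vmap α z d m p) p ≤ 2 * d := by
  by_cases hp : p ∈ sq z d
  · have h1 := P.vmap_mem_sq α hd0 hd hm hp
    rw [Prod.dist_eq, P.vmap_fst, dist_self, max_eq_right dist_nonneg]
    refine (dist_triangle_right _ _ z.2).trans ?_
    rw [dist_eq_norm, dist_eq_norm]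
    linarith [h1.2, hp.2]
  · rw [P.vmap_of_notMem α hp, dist_self]; linarith

theorem vmap_injective_of_fst_eq (hd0 : 0 < d) (hd : d < 1 / 2) (hm : IsProfile d m) {p q : Torus}
    (hpq : p.1 = q.1) (h0 : ∀ t : ℝ, |t| ≤ d → p.1 = z.1 + (t : UnitAddCircle) → m t ≠ 0)
    (h : P.vmap α z d m p = P.vmap α z d m q) : p = q := by
  by_cases hp : p ∈ sq z d
  · have hq : q ∈ sq z d := by
      rw [← P.vmap_mem_sq_iff α hd0 hd hm, ← h]
      exact P.vmap_mem_sq α hd0 hd hm hp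
    obtain ⟨t, u, ht, hu, rfl⟩ := P.exists_pt_h_of_mem_sq α hd0 hd hp
    obtain ⟨t', u', ht', hu', rfl⟩ := P.exists_pt_h_of_mem_sq α hd0 hd hq
    obtain rfl := pt_fst_inj (by linarith) (by linarith) hpq
    rw [P.vmap_pt α hd0 hd ht hu, P.vmap_pt α hd0 hd ht hu'] at h
    have hmt := hm.abs_le t ht
    have h1 := P.h_mem α hmt (by linarith) hu
    have h2 := P.h_mem α hmt (by linarith) hu'
    have h3 := pt_snd_inj (by linarith) (by linarith) (congrArg Prod.snd h)
    rw [P.h_injective α (h0 t ht rfl) (by linarith) h3]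
  · have hq : q ∉ sq z d := by
      rw [← P.vmap_mem_sq_iff α hd0 hd hm, ← h, P.vmap_mem_sq_iff α hd0 hd hm]
      exact hp
    rwa [P.vmap_of_notMem α hp, P.vmap_of_notMem α hq] at h

theorem vmap_surjective (hd0 : 0 < d) (hd : d < 1 / 2) (hm : IsProfile d m) :
    Function.Surjective (P.vmap α z d m) := by
  intro q
  by_cases hq : q ∈ sq z d
  · obtain ⟨t, s, ht, hs, rfl⟩ := exists_pt_of_mem_sq hq
    obtain ⟨u, hu, rfl⟩ := P.exists_h_eq α (hm.abs_le t ht) (by linarith) hs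
    exact ⟨_, P.vmap_pt α hd0 hd ht hu⟩
  · exact ⟨q, P.vmap_of_notMem α hq⟩

theorem continuous_vmap (hd0 : 0 < d) (hd : d < 1 / 2) (hm : IsProfile d m) :
    Continuous (P.vmap α z d m) := by
  classical
  unfold vmap
  refine continuous_if ?_ ?_ continuousOn_id
  · intro p hp
    have hmem : p ∈ sq z d := (isClosed_sq z d).frontier_subset hp
    have hbd : ‖p.1 - z.1‖ = d ∨ ‖p.2 - z.2‖ = d := by
      by_contra! hne
      refine hp.2 (mem_interior.2 ⟨{p | ‖p.1 - z.1‖ < d ∧ ‖p.2 - z.2‖ < d},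
        fun x hx => ⟨hx.1.le, hx.2.le⟩, ?_, lt_of_le_of_ne hmem.1 hne.1,
        lt_of_le_of_ne hmem.2 hne.2⟩)
      have h1 : Continuous fun p : Torus => ‖p.1 - z.1‖ := by fun_prop
      have h2 : Continuous fun p : Torus => ‖p.2 - z.2‖ := by fun_prop
      exact (isOpen_lt h1 continuous_const).inter (isOpen_lt h2 continuous_const)
    obtain ⟨t, u, ht, hu, rfl⟩ := P.exists_pt_h_of_mem_sq α hd0 hd hmem
    have key := P.vmap_pt α (z := z) (m := m) hd0 hd ht hu
    rw [vmap, if_pos hmem] at key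
    rw [key]
    have had : |d| = d := abs_of_pos hd0
    have hs := P.h_mem α had.le (by linarith) hu
    have hmt := hm.abs_le t ht
    simp only [pt, add_sub_cancel_left] at hbd
    rw [norm_coe_of_abs_le (by linarith), norm_coe_of_abs_le (by linarith)] at hbd
    -- On the vertical sides |m t| = d, so both polylines coincide. On the horizontal sides u = ±(1
    -- + d)/2, where every polyline with parameter at most d takes the value ±d.
    rcases hbd with hbd | hbd
    · rw [← P.h_abs α (m t), hm.abs_eq t hbd]
    · have hinj := P.h_injective α hd0.ne' (by linarith)
      rcases (abs_eq hd0.le).1 hbd with h | h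
      · have := h.trans (P.h_half_add α had.le (by linarith)).symm
        rw [hinj this, P.h_half_add α hmt (by linarith), P.h_half_add α had.le (by linarith)]
      · have := h.trans (P.h_neg_half_add α had.le (by linarith)).symm
        rw [hinj this, P.h_neg_half_add α hmt (by linarith), P.h_neg_half_add α had.le (by linarith)]
  · have hcl : closure {p | p ∈ sq z d} = sq z d := (isClosed_sq z d).closure_eq
    rw [hcl]
    refine continuousOn_fst.prodMk (continuousOn_const.add ?_)
    refine continuous_coe_circle.comp_continuousOn ?_
    have hr1 : ContinuousOn (fun p : Torus => rep (p.1 - z.1)) (sq z d) := fun p hp =>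
      (ContinuousAt.comp (f := fun p : Torus => p.1 - z.1)
        (continuousAt_rep (hp.1.trans_lt hd)) (by fun_prop)).continuousWithinAt
    have hr2 : ContinuousOn (fun p : Torus => rep (p.2 - z.2)) (sq z d) := fun p hp =>
      (ContinuousAt.comp (f := fun p : Torus => p.2 - z.2)
        (continuousAt_rep (hp.2.trans_lt hd)) (by fun_prop)).continuousWithinAt
    have hi : ContinuousOn (fun p : Torus => P.hInv α d (rep (p.2 - z.2))) (sq z d) :=
      (P.continuousOn_hInv α hd0 (by linarith)).comp hr2 fun p hp =>
        abs_le.1 ((abs_rep _).trans_le hp.2)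
    intro p hp
    have hlt : |m (rep (p.1 - z.1))| < 1 :=
      (hm.abs_le _ ((abs_rep _).trans_le hp.1)).trans_lt (by linarith)
    exact ContinuousAt.comp_continuousWithinAt
      (f := fun p : Torus => (m (rep (p.1 - z.1)), P.hInv α d (rep (p.2 - z.2))))
      (P.continuousAt_h α hlt _) (((hm.continuous.comp_continuousOn hr1) p hp).prodMk (hi p hp))

/-- A value beyond ±r is attained only for |u| > (1 + r)/2, and there all polylines with parameter
at most r are 2u - 1 or 2u + 1. -/
theorem h_eq_h_of_le {r t u : ℝ} (hr : r < 1) (htr : |t| ≤ r) (hu : r < |P.h α r u|) :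
    P.h α t u = P.h α r u := by
  have har : |r| = r := abs_of_nonneg ((abs_nonneg t).trans htr)
  have h1 : (1 + r) / 2 < |u| := by
    by_contra! hle
    exact absurd (P.h_mem α har.le hr hle) (not_le.2 hu)
  rcases lt_abs.1 h1 with h | h
  · rw [P.h_of_ge α (by linarith) (by linarith), P.h_of_ge α (by linarith) (by linarith)]
  · rw [P.h_of_le α (by linarith) (by linarith), P.h_of_le α (by linarith) (by linarith)]

/-- Shrinking the square amounts to composing with a homeomorphism. -/
theorem vmap_id_vmap_max {d' : ℝ} (hd0 : 0 < d') (hdd : d' ≤ d) (hd : d < 1 / 2) (p : Torus) :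
    P.vmap α z d' id (P.vmap α z d (fun t => max d' |t|) p) = P.vmap α z d id p := by
  have hd1 : 0 < d := hd0.trans_le hdd
  by_cases hp : p ∈ sq z d
  · obtain ⟨t, u, ht, hu, rfl⟩ := P.exists_pt_h_of_mem_sq α hd1 hd hp
    rw [P.vmap_pt α hd1 hd ht hu, P.vmap_pt α hd1 hd ht hu]
    simp only [id]
    -- Over the columns of the smaller square the first map uses h_{d'}: either its value lies in
    -- the smaller square, where h_{d'} is undone, or h_t and h_{d'} agree at u. Over the other
    -- columns the profile is already |t|.
    rcases le_or_gt |t| d' with h | h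
    · rw [max_eq_left h]
      rcases le_or_gt |P.h α d' u| d' with hs | hs
      · have hd'1 : d' < 1 := by linarith
        have := P.h_hInv α hd0 hd'1 hs
        have e : P.hInv α d' (P.h α d' u) = u :=
          P.h_injective α hd0.ne' (by rwa [abs_of_pos hd0]) this
        have hu' := P.hInv_mem α hd0 hd'1 hs
        rw [e] at hu'
        rw [P.vmap_pt α hd0 (by linarith) h hu']
        rfl
      · rw [P.vmap_of_notMem, P.h_eq_h_of_le α (by linarith) h hs]
        intro hmem
        have h2 := hmem.2
        have hle := P.h_mem α (t := d') (by rwa [abs_of_pos hd0]) (by linarith) hu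
        simp only [pt, add_sub_cancel_left] at h2
        rw [norm_coe_of_abs_le (by linarith)] at h2
        linarith
    · rw [max_eq_right h.le, P.vmap_of_notMem, P.h_abs]
      intro hmem
      have h2 := hmem.1
      simp only [pt, add_sub_cancel_left] at h2
      rw [norm_coe_of_abs_le (by linarith)] at h2
      linarith
  · rw [P.vmap_of_notMem α hp, P.vmap_of_notMem α hp, P.vmap_of_notMem]
    exact fun h => hp (sq_mono z hdd h)

/-- Off the plateau [-1/2, 1/2] the function h₀ is strictly increasing. -/
theorem h_zero_eq {u u' : ℝ} (h : P.h α 0 u = P.h α 0 u') (hne : u ≠ u') : P.h α 0 u = 0 := by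
  have key : ∀ u u' : ℝ, u < u' → P.h α 0 u = P.h α 0 u' → P.h α 0 u = 0 := by
    intro u u' hlt h
    rcases le_or_gt u (-1 / 2) with h1 | h1
    · have e1 := P.h_of_le α (t := 0) (s := u) (by simp) (by simpa using h1)
      rcases le_or_gt u' (-1 / 2) with h2 | h2
      · have e2 := P.h_of_le α (t := 0) (s := u') (by simp) (by simpa using h2)
        linarith
      · have := P.h_mono α (t := 0) (by simp) h2.le
        rw [P.h_zero_of_mem α ⟨le_rfl, by norm_num⟩] at this
        linarith
    · rcases le_or_gt u (1 / 2) with h2 | h2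
      · exact P.h_zero_of_mem α ⟨h1.le, h2⟩
      · have e1 := P.h_of_ge α (t := 0) (s := u) (by simp) (by simpa using h2.le)
        have e2 := P.h_of_ge α (t := 0) (s := u') (by simp) (by simpa using (h2.trans hlt).le)
        linarith
  rcases lt_or_gt_of_ne hne with hlt | hlt
  · exact key u u' hlt h
  · rw [h]; exact key u' u hlt h.symm

theorem vmap_id_eq_center (hd0 : 0 < d) (hd : d < 1 / 2) {p q : Torus} (hpq : p.1 = q.1)
    (hne : p ≠ q) (h : P.vmap α z d id p = P.vmap α z d id q) : P.vmap α z d id p = z := by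
  have hm := isProfile_id d
  by_cases h0 : p.1 = z.1
  · have hp : p ∈ sq z d := by
      by_contra hp
      have hq : q ∉ sq z d := by
        rw [← P.vmap_mem_sq_iff α hd0 hd hm, ← h, P.vmap_mem_sq_iff α hd0 hd hm]
        exact hp
      rw [P.vmap_of_notMem α hp, P.vmap_of_notMem α hq] at h
      exact hne h
    have hq : q ∈ sq z d := by
      rw [← P.vmap_mem_sq_iff α hd0 hd hm, ← h]
      exact P.vmap_mem_sq α hd0 hd hm hp
    obtain ⟨t, u, ht, hu, rfl⟩ := P.exists_pt_h_of_mem_sq α hd0 hd hp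
    obtain ⟨t', u', ht', hu', rfl⟩ := P.exists_pt_h_of_mem_sq α hd0 hd hq
    obtain rfl := pt_fst_inj (by linarith) (by linarith) hpq
    have h00 : (pt z t (P.h α d u)).1 = (pt z 0 0).1 := by simpa [pt] using h0
    obtain rfl := pt_fst_inj (by linarith) (by norm_num) h00
    rw [P.vmap_pt α hd0 hd ht hu, P.vmap_pt α hd0 hd ht hu'] at h
    rw [P.vmap_pt α hd0 hd ht hu]
    simp only [id] at h ⊢
    have h1 := P.h_mem α ht (by linarith) hu
    have h2 := P.h_mem α ht (by linarith) hu'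
    have h3 := pt_snd_inj (by linarith) (by linarith) (congrArg Prod.snd h)
    have hne' : u ≠ u' := by rintro rfl; exact hne rfl
    rw [P.h_zero_eq α h3 hne']
    simp [pt]
  · refine absurd (P.vmap_injective_of_fst_eq α hd0 hd hm hpq ?_ h) hne
    rintro t - ht rfl
    exact h0 (by simpa using ht)

end Params

/-! ### The orbit of z₀, the set `X`, and finite compositions. -/

namespace Params

variable (P : Params)

/-- Otherwise the orbit of 0 stays in a closed proper subgroup, against minimality; the point with
first coordinate 1/(2k) lies outside it. This makes the columns of the zₙ distinct. -/
theorem zsmul_fst_ne_zero {k : ℤ} (hk : k ≠ 0) : k • P.v.1 ≠ 0 := by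
  intro h
  have hcl : IsClosed {p : Torus | k • p.1 = 0} :=
    isClosed_eq (by fun_prop) continuous_const
  have hsub : Set.range (fun n : ℤ => (0 : Torus) + n • P.v) ⊆ {p : Torus | k • p.1 = 0} := by
    rintro _ ⟨n, rfl⟩
    simp [smul_comm k n, h]
  have huniv : ∀ p : Torus, k • p.1 = 0 := fun p => by
    have := hcl.closure_subset_iff.2 hsub (P.minimal 0 p)
    exact this
  have h1 := huniv ((((1 : ℝ) / (2 * k) : ℝ) : UnitAddCircle), 0)
  have hk' : (k : ℝ) ≠ 0 := by exact_mod_cast hk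
  have h2 : k • ((((1 : ℝ) / (2 * k) : ℝ) : UnitAddCircle)) = (((1 / 2 : ℝ)) : UnitAddCircle) := by
    rw [← AddCircle.coe_zsmul]
    congr 1
    rw [zsmul_eq_mul]
    field_simp
  have h3 := congrArg norm (h2.symm.trans h1)
  rw [norm_coe_of_abs_le (by norm_num [abs_le]), norm_zero] at h3
  norm_num at h3

/-- The exponent `k` with `zₙ = T^k z₀`. -/
def expo (n : ℕ) : ℤ := if Even n then ((n / 2 : ℕ) : ℤ) else -((n / 2 + 1 : ℕ) : ℤ)

theorem z_eq (n : ℕ) : P.z n = P.z₀ + expo n • P.v := by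
  unfold z expo
  split_ifs
  · rw [natCast_zsmul]
  · rw [neg_zsmul, natCast_zsmul, sub_eq_add_neg]

theorem expo_injective : Function.Injective expo := by
  intro m n h
  unfold expo at h
  split_ifs at h with h1 h2 h2
  · rw [Nat.even_iff] at h1 h2; omega
  · omega
  · omega
  · rw [Nat.even_iff] at h1 h2; omega

theorem z_zero : P.z 0 = P.z₀ := by simp [z]

theorem fst_z_injective : Function.Injective fun n => (P.z n).1 := by
  intro m n h
  by_contra hne
  have hk : expo m - expo n ≠ 0 := sub_ne_zero.2 fun h => hne (expo_injective h)
  refine P.zsmul_fst_ne_zero hk ?_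
  simp only [P.z_eq, Prod.fst_add, Prod.smul_fst, add_right_inj] at h
  rw [sub_zsmul, h, add_neg_cancel]

theorem mem_X_of_fst_eq {p q : Torus} (hp : p ∈ P.X) (h : q.1 = p.1) : q ∈ P.X :=
  fun n => h ▸ hp n

theorem add_mem_X {p : Torus} (hp : p ∈ P.X) : p + P.v ∈ P.X := fun n h => hp (tau n) <| by
  rw [P.z_tau, Prod.fst_sub, ← h, Prod.fst_add, add_sub_cancel_right]

theorem sub_mem_X {p : Torus} (hp : p ∈ P.X) : p - P.v ∈ P.X := fun n h => hp (sigma n) <| by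
  rw [P.z_sigma, Prod.fst_add, ← h, Prod.fst_sub, sub_add_cancel]

instance neBot_nhdsNE_circle (x : UnitAddCircle) : (𝓝[≠] x).NeBot := by
  have : Nontrivial UnitAddCircle := ⟨0, ((1 / 2 : ℝ) : UnitAddCircle), fun h => by
    have := congrArg norm h
    rw [norm_coe_of_abs_le (by norm_num [abs_le]), norm_zero] at this
    norm_num at this⟩
  infer_instance

theorem dense_X : Dense P.X := by
  have : P.X = ⋂ n, {p : Torus | p.1 ≠ (P.z n).1} := by ext; simp [X]
  rw [this]
  refine dense_iInter_of_isOpen (fun n => isOpen_ne_fun (by fun_prop) continuous_const) fun n => ?_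
  have h1 : Dense ({(P.z n).1}ᶜ : Set UnitAddCircle) := dense_compl_singleton _
  exact h1.preimage isOpenMap_fst

variable (α : ℕ → unitInterval) {δ : ℕ → ℝ}

section Lam

theorem Lam_of_notMem {n : ℕ} {p : Torus} (hp : p ∉ P.A δ n) : P.Lam α δ n p = p :=
  P.vmap_of_notMem α (m := id) hp

theorem Lam_fst (δ : ℕ → ℝ) (n : ℕ) (p : Torus) : (P.Lam α δ n p).1 = p.1 :=
  P.vmap_fst α (m := id) p

variable (hδ : ∀ n, 0 < δ n ∧ δ n < 1 / 2)
include hδ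

theorem continuous_Lam (n : ℕ) : Continuous (P.Lam α δ n) :=
  P.continuous_vmap α (hδ n).1 (hδ n).2 (isProfile_id _)

theorem Lam_surjective (n : ℕ) : Function.Surjective (P.Lam α δ n) :=
  P.vmap_surjective α (hδ n).1 (hδ n).2 (isProfile_id _)

theorem Lam_injective {n : ℕ} {p q : Torus} (hpq : p.1 = q.1) (h0 : p.1 ≠ (P.z n).1)
    (h : P.Lam α δ n p = P.Lam α δ n q) : p = q := by
  refine P.vmap_injective_of_fst_eq α (hδ n).1 (hδ n).2 (isProfile_id _) hpq ?_ h
  rintro t - ht rfl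
  exact h0 (by simpa using ht)

theorem dist_Lam_le (n : ℕ) (p : Torus) : dist (P.Lam α δ n p) p ≤ 2 * δ n :=
  P.dist_vmap_le α (hδ n).1 (hδ n).2 (isProfile_id _) p

theorem Lam_comm {m n : ℕ} (h : Disjoint (P.A δ m) (P.A δ n)) :
    P.Lam α δ m ∘ P.Lam α δ n = P.Lam α δ n ∘ P.Lam α δ m := by
  funext p
  have key : ∀ {i j : ℕ}, Disjoint (P.A δ i) (P.A δ j) → p ∈ P.A δ i →
      P.Lam α δ i (P.Lam α δ j p) = P.Lam α δ j (P.Lam α δ i p) := by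
    intro i j hd hp
    have h1 : P.Lam α δ j p = p :=
      P.Lam_of_notMem α (Set.disjoint_left.1 hd hp)
    have h2 : P.Lam α δ i p ∈ P.A δ i :=
      P.vmap_mem_sq α (hδ i).1 (hδ i).2 (isProfile_id _) hp
    rw [h1]
    exact (P.Lam_of_notMem α (Set.disjoint_left.1 hd h2)).symm
  by_cases hm : p ∈ P.A δ m
  · exact key h hm
  by_cases hn : p ∈ P.A δ n
  · exact (key h.symm hn).symm
  have h1 : P.Lam α δ m p = p := P.Lam_of_notMem α hm
  have h2 : P.Lam α δ n p = p := P.Lam_of_notMem α hn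
  simp [h1, h2]

end Lam

theorem lamComp_fst (δ : ℕ → ℝ) (g : ℕ → ℕ) (n : ℕ) (p : Torus) :
    (P.lamComp α δ g n p).1 = p.1 := by
  induction n with
  | zero => exact P.Lam_fst α δ _ p
  | succ n ih => exact (P.Lam_fst α δ _ _).trans ih

theorem PhiN_fst (δ : ℕ → ℝ) (n : ℕ) (p : Torus) : (P.PhiN α δ n p).1 = p.1 :=
  P.lamComp_fst α δ id n p

theorem PhiN_succ (δ : ℕ → ℝ) (n : ℕ) (p : Torus) :
    P.PhiN α δ (n + 1) p = P.Lam α δ (n + 1) (P.PhiN α δ n p) := rfl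

section lamComp

variable (hδ : ∀ n, 0 < δ n ∧ δ n < 1 / 2) (g : ℕ → ℕ)
include hδ

theorem continuous_lamComp (n : ℕ) : Continuous (P.lamComp α δ g n) := by
  induction n with
  | zero => exact P.continuous_Lam α hδ _
  | succ n ih => exact (P.continuous_Lam α hδ _).comp ih

theorem lamComp_surjective (n : ℕ) : Function.Surjective (P.lamComp α δ g n) := by
  induction n with
  | zero => exact P.Lam_surjective α hδ _
  | succ n ih => exact (P.Lam_surjective α hδ _).comp ih

theorem lamComp_injective {n : ℕ} {p q : Torus} (hpq : p.1 = q.1)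
    (h0 : ∀ i ≤ n, p.1 ≠ (P.z (g i)).1)
    (h : P.lamComp α δ g n p = P.lamComp α δ g n q) : p = q := by
  induction n with
  | zero => exact P.Lam_injective α hδ hpq (h0 0 le_rfl) h
  | succ n ih =>
    refine ih (fun i hi => h0 i (by omega)) (P.Lam_injective α hδ (n := g (n + 1)) ?_ ?_ h)
    · rw [P.lamComp_fst, P.lamComp_fst, hpq]
    · rw [P.lamComp_fst]; exact h0 _ le_rfl

theorem lamComp_injOn_X (n : ℕ) : Set.InjOn (P.lamComp α δ g n) P.X := by
  intro p hp q _ h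
  refine P.lamComp_injective α hδ g ?_ (fun i _ => hp (g i)) h
  rw [← P.lamComp_fst α δ g n p, h, P.lamComp_fst]

theorem invFunOn_lamComp (n : ℕ) {q : Torus} (hq : q ∈ P.X) :
    Function.invFunOn (P.lamComp α δ g n) P.X q ∈ P.X ∧
      P.lamComp α δ g n (Function.invFunOn (P.lamComp α δ g n) P.X q) = q := by
  obtain ⟨p, rfl⟩ := P.lamComp_surjective α hδ g n q
  have hp : p ∈ P.X := P.mem_X_of_fst_eq hq (P.lamComp_fst α δ g n p).symm
  have hex : ∃ a ∈ P.X, P.lamComp α δ g n a = P.lamComp α δ g n p := ⟨p, hp, rfl⟩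
  exact ⟨Function.invFunOn_mem hex, Function.invFunOn_eq hex⟩

end lamComp

section reorder

variable (hδ : ∀ n, 0 < δ n ∧ δ n < 1 / 2)
  (hdis : ∀ m n, m < n → n ≤ m + 5 → Disjoint (P.A δ m) (P.A δ n))
include hδ hdis

/-- The indices σ(0), …, σ(2k+1) are 0, …, 2k and 2k+2. The induction only exchanges maps whose
indices differ by at most three, and these commute. -/
theorem lamComp_sigma_odd (k : ℕ) :
    P.lamComp α δ sigma (2 * k + 1) = P.Lam α δ (2 * k + 2) ∘ P.PhiN α δ (2 * k) := by
  induction k with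
  | zero =>
    change P.Lam α δ 0 ∘ P.Lam α δ 2 = P.Lam α δ 2 ∘ P.Lam α δ 0
    exact P.Lam_comm α hδ (hdis 0 2 (by omega) (by omega))
  | succ k ih =>
    have e1 : sigma (2 * k + 1 + 1) = 2 * k + 4 := by
      simp [sigma, Nat.even_add_one]
    have e2 : sigma (2 * k + 1 + 1 + 1) = 2 * k + 1 := by
      simp [sigma, Nat.even_add_one]
    change P.Lam α δ (sigma (2 * k + 1 + 1 + 1)) ∘ P.Lam α δ (sigma (2 * k + 1 + 1)) ∘
      P.lamComp α δ sigma (2 * k + 1) =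
        P.Lam α δ (2 * k + 4) ∘ P.Lam α δ (2 * k + 2) ∘ P.Lam α δ (2 * k + 1) ∘ P.PhiN α δ (2 * k)
    rw [ih, e1, e2, ← Function.comp_assoc,
      P.Lam_comm α hδ (hdis (2 * k + 1) (2 * k + 4) (by omega) (by omega)), Function.comp_assoc,
      ← Function.comp_assoc (P.Lam α δ (2 * k + 1)),
      P.Lam_comm α hδ (hdis (2 * k + 1) (2 * k + 2) (by omega) (by omega)), Function.comp_assoc]

/-- Here the indices τ(0), …, τ(2k+2) are 0, …, 2k+1 and 2k+3. -/
theorem lamComp_tau_even (k : ℕ) :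
    P.lamComp α δ tau (2 * k + 2) = P.Lam α δ (2 * k + 3) ∘ P.PhiN α δ (2 * k + 1) := by
  induction k with
  | zero =>
    change P.Lam α δ 0 ∘ P.Lam α δ 3 ∘ P.Lam α δ 1 = P.Lam α δ 3 ∘ P.Lam α δ 1 ∘ P.Lam α δ 0
    rw [← Function.comp_assoc, P.Lam_comm α hδ (hdis 0 3 (by omega) (by omega)),
      Function.comp_assoc, P.Lam_comm α hδ (hdis 0 1 (by omega) (by omega))]
  | succ k ih =>
    have e1 : tau (2 * k + 2 + 1) = 2 * k + 5 := by
      simp [tau, Nat.even_add_one]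
    have e2 : tau (2 * k + 2 + 1 + 1) = 2 * k + 2 := by
      simp [tau, Nat.even_add_one]
    change P.Lam α δ (tau (2 * k + 2 + 1 + 1)) ∘ P.Lam α δ (tau (2 * k + 2 + 1)) ∘
      P.lamComp α δ tau (2 * k + 2) =
        P.Lam α δ (2 * k + 5) ∘ P.Lam α δ (2 * k + 3) ∘ P.Lam α δ (2 * k + 2) ∘
          P.PhiN α δ (2 * k + 1)
    rw [ih, e1, e2, ← Function.comp_assoc,
      P.Lam_comm α hδ (hdis (2 * k + 2) (2 * k + 5) (by omega) (by omega)), Function.comp_assoc,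
      ← Function.comp_assoc (P.Lam α δ (2 * k + 2)),
      P.Lam_comm α hδ (hdis (2 * k + 2) (2 * k + 3) (by omega) (by omega)), Function.comp_assoc]

end reorder

theorem sigma_even (k : ℕ) : sigma (2 * k) = 2 * k + 2 := by simp [sigma]

theorem sigma_odd (k : ℕ) : sigma (2 * k + 3) = 2 * k + 1 := by
  have : ¬ Even (2 * k + 3) := by rw [Nat.even_iff]; omega
  simp [sigma, this]

theorem tau_odd (k : ℕ) : tau (2 * k + 1) = 2 * k + 3 := by simp [tau]

theorem tau_even (k : ℕ) : tau (2 * k + 2) = 2 * k := by simp [tau, Nat.even_add]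

end Params

/-! ### Comparison of metrics, infinite products, extension from a dense set. -/

theorem torusDist_eq (p q : Torus) :
    torusDist p q = √(dist p.1 q.1 ^ 2 + dist p.2 q.2 ^ 2) :=
  WithLp.prod_dist_eq_of_L2 _ _

theorem dist_le_torusDist (p q : Torus) : dist p q ≤ torusDist p q := by
  rw [torusDist_eq, Prod.dist_eq]
  refine Real.le_sqrt_of_sq_le ?_
  rcases max_cases (dist p.1 q.1) (dist p.2 q.2) with ⟨h, _⟩ | ⟨h, _⟩ <;> rw [h]
  · linarith [sq_nonneg (dist p.2 q.2)]
  · linarith [sq_nonneg (dist p.1 q.1)]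

theorem torusDist_le (p q : Torus) : torusDist p q ≤ 2 * dist p q := by
  have h1 : dist p.1 q.1 ≤ dist p q := le_max_left _ _
  have h2 : dist p.2 q.2 ≤ dist p q := le_max_right _ _
  rw [torusDist_eq]
  refine Real.sqrt_le_iff.2 ⟨by positivity, ?_⟩
  have h3 := pow_le_pow_left₀ dist_nonneg h1 2
  have h4 := pow_le_pow_left₀ dist_nonneg h2 2
  nlinarith [sq_nonneg (dist p q)]

theorem torusDist_pos {p q : Torus} (h : p ≠ q) : 0 < torusDist p q :=
  (dist_pos.2 h).trans_le (dist_le_torusDist p q)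

theorem torusDist_self (p : Torus) : torusDist p p = 0 := by
  simp [torusDist_eq]

/-- All factors lie in [0, 1], so partial products decrease to c and omitting factors can only
increase them. -/
theorem le_prod_Icc_of_tendsto {b : ℕ → ℝ} (hb : ∀ r, 0 ≤ b r ∧ b r ≤ 1) {c : ℝ}
    (hlim : Tendsto (fun m => ∏ r ∈ Finset.Icc 1 m, b r) atTop (𝓝 c)) (k m : ℕ) :
    c ≤ ∏ r ∈ Finset.Icc (k + 1) m, b r := by
  have hanti : Antitone fun m => ∏ r ∈ Finset.Icc 1 m, b r := by
    refine antitone_nat_of_succ_le fun m => ?_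
    rw [Finset.prod_Icc_succ_top (by omega)]
    exact mul_le_of_le_one_right (Finset.prod_nonneg fun r _ => (hb r).1) (hb _).2
  refine (hanti.le_of_tendsto hlim m).trans ?_
  have hsub : Finset.Icc (k + 1) m ⊆ Finset.Icc 1 m := Finset.Icc_subset_Icc_left (by omega)
  rw [← Finset.prod_sdiff hsub]
  exact mul_le_of_le_one_left (Finset.prod_nonneg fun r _ => (hb r).1)
    (Finset.prod_le_one (fun r _ => (hb r).1) fun r _ => (hb r).2)

theorem continuous_torusDist : Continuous fun x : Torus × Torus => torusDist x.1 x.2 := by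
  simp only [torusDist_eq]
  fun_prop

theorem tendsto_torusDist {u w : ℕ → Torus} {a b : Torus} (hu : Tendsto u atTop (𝓝 a))
    (hw : Tendsto w atTop (𝓝 b)) :
    Tendsto (fun m => torusDist (u m) (w m)) atTop (𝓝 (torusDist a b)) :=
  Tendsto.comp (g := fun x : Torus × Torus => torusDist x.1 x.2) (f := fun m => (u m, w m))
    (continuous_torusDist.tendsto (a, b)) (hu.prodMk_nhds hw)

theorem exists_tendsto_of_uniformContinuousOn {A B : Type*} [UniformSpace A] [UniformSpace B]
    [CompleteSpace B] {s : Set A} (hs : Dense s) {f : A → B} (hf : UniformContinuousOn f s)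
    (x : A) : ∃ y, Tendsto f (𝓝[s] x) (𝓝 y) := by
  obtain ⟨y, hy⟩ := uniformly_extend_exists (isUniformInducing_val s) hs.denseRange_val
    (uniformContinuousOn_iff_restrict.1 hf) x
  refine ⟨y, ?_⟩
  have : Tendsto f (map ((↑) : s → A) (comap (↑) (𝓝 x))) (𝓝 y) := tendsto_map'_iff.2 hy
  rwa [map_comap_setCoe_val] at this

/-! ### The limit `Phi` and the homeomorphism `S`. -/

namespace Params

variable {P : Params} {α : ℕ → unitInterval} {δ : ℕ → ℝ}

namespace Admissible

variable (hA : P.Admissible α δ)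
include hA

/-- The bound 2⁻ⁿ does not suffice for n = 0 and n = 1 is the borderline case. But a square of
half-side at least 1/2 is the whole torus and would meet the next square. -/
theorem pos_lt (n : ℕ) : 0 < δ n ∧ δ n < 1 / 2 := by
  refine ⟨hA.pos n, ?_⟩
  by_contra! h
  refine Set.disjoint_left.1 (hA.disjoint_squares n (n + 1) (by omega) (by omega))
    (show P.z (n + 1) ∈ P.A δ n from ⟨(norm_le_half _).trans h, (norm_le_half _).trans h⟩)
    (mem_sq_self _ (hA.pos _).le)

theorem dist_PhiN_succ_le (n : ℕ) (p : Torus) :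
    dist (P.PhiN α δ n p) (P.PhiN α δ (n + 1) p) ≤ 2 / 2 / 2 ^ n := by
  rw [dist_comm, P.PhiN_succ]
  refine (P.dist_Lam_le α hA.pos_lt _ _).trans ?_
  have := (hA.lt_two_pow (n + 1)).le
  rw [pow_succ] at this
  calc 2 * δ (n + 1) ≤ 2 * (1 / (2 ^ n * 2)) := by gcongr
    _ = 2 / 2 / 2 ^ n := by field_simp

theorem tendsto_PhiN (p : Torus) :
    Tendsto (fun n => P.PhiN α δ n p) atTop (𝓝 (P.Phi α δ p)) :=
  (cauchySeq_of_le_geometric_two (C := 2) fun n => hA.dist_PhiN_succ_le n p).tendsto_limUnder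

theorem dist_PhiN_Phi_le (n : ℕ) (p : Torus) :
    dist (P.PhiN α δ n p) (P.Phi α δ p) ≤ 2 / 2 ^ n :=
  dist_le_of_le_geometric_two_of_tendsto (C := 2) (fun n => hA.dist_PhiN_succ_le n p)
    (hA.tendsto_PhiN p) n

omit hA in
theorem tendsto_const_div_two_pow (C : ℝ) : Tendsto (fun n : ℕ => C / 2 ^ n) atTop (𝓝 0) := by
  have := (tendsto_pow_atTop_nhds_zero_of_lt_one (r := (1 / 2 : ℝ)) (by norm_num)
    (by norm_num)).const_mul C
  simpa [div_eq_mul_inv] using this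

theorem tendstoUniformly_PhiN :
    TendstoUniformly (fun n => P.PhiN α δ n) (P.Phi α δ) atTop := by
  rw [Metric.tendstoUniformly_iff]
  intro ε hε
  filter_upwards [(tendsto_const_div_two_pow 2).eventually_lt_const hε] with n hn p
  rw [dist_comm]
  exact (hA.dist_PhiN_Phi_le n p).trans_lt hn

theorem continuous_Phi : Continuous (P.Phi α δ) :=
  hA.tendstoUniformly_PhiN.continuous
    (Frequently.of_forall fun n => P.continuous_lamComp α hA.pos_lt id n)

theorem Phi_fst (p : Torus) : (P.Phi α δ p).1 = p.1 := by
  have h1 := (continuous_fst.tendsto _).comp (hA.tendsto_PhiN p)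
  have h2 : (Prod.fst ∘ fun n => P.PhiN α δ n p) = fun _ => p.1 :=
    funext fun n => P.PhiN_fst α δ n p
  rw [h2] at h1
  exact tendsto_nhds_unique h1 tendsto_const_nhds

theorem Phi_surjective : Function.Surjective (P.Phi α δ) := by
  have hcl : IsClosed (Set.range (P.Phi α δ)) := (isCompact_range hA.continuous_Phi).isClosed
  intro q
  choose p hp using fun n => P.lamComp_surjective α hA.pos_lt id n q
  suffices h : Tendsto (fun n => P.Phi α δ (p n)) atTop (𝓝 q) from
    hcl.mem_of_tendsto h (Eventually.of_forall fun n => Set.mem_range_self _)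
  rw [tendsto_iff_dist_tendsto_zero]
  refine squeeze_zero (fun _ => dist_nonneg) (fun n => ?_) (tendsto_const_div_two_pow 2)
  have := hA.dist_PhiN_Phi_le n (p n)
  rw [dist_comm] at this
  rwa [← hp n]

/-- The infinite product is positive, so from some index on the distance of the images is bounded
below by c times its value at that index; the bound survives in the limit. -/
theorem Phi_ne {p q : Torus} (h : ∀ n, P.PhiN α δ n p ≠ P.PhiN α δ n q) :
    P.Phi α δ p ≠ P.Phi α δ q := by
  obtain ⟨a, ha, ⟨c, hc, hlim⟩, hexp⟩ := hA.expansion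
  have hpq : p ≠ q := by rintro rfl; exact h 0 rfl
  obtain ⟨k, hk⟩ := exists_nat_one_div_lt (torusDist_pos hpq)
  have hbd : ∀ m, k + 1 < m → c * torusDist (P.PhiN α δ (k + 1) p) (P.PhiN α δ (k + 1) q) ≤
      torusDist (P.PhiN α δ m p) (P.PhiN α δ m q) := by
    intro m hm
    refine le_trans ?_ (hexp (k + 1) m (by omega) hm p q (by push_cast; exact hk.le))
    gcongr
    · exact (torusDist_pos (h _)).le
    refine le_prod_Icc_of_tendsto (fun r => ?_) hlim (k + 1) m
    have h2 : (2 : ℝ) ≤ a r := by exact_mod_cast ha r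
    have h3 : 1 / (a r : ℝ) ≤ 1 := by rw [div_le_one (by linarith)]; linarith
    have h4 : 0 ≤ 1 / (a r : ℝ) := by positivity
    constructor <;> linarith
  have hl : Tendsto (fun m => torusDist (P.PhiN α δ m p) (P.PhiN α δ m q)) atTop
      (𝓝 (torusDist (P.Phi α δ p) (P.Phi α δ q))) := by
    exact tendsto_torusDist (hA.tendsto_PhiN p) (hA.tendsto_PhiN q)
  have hge := ge_of_tendsto hl ((eventually_gt_atTop (k + 1)).mono hbd)
  intro e
  have hpos := mul_pos hc (torusDist_pos (h (k + 1)))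
  rw [e, torusDist_self] at hge
  linarith

theorem Phi_injOn_X : Set.InjOn (P.Phi α δ) P.X := by
  intro p hp q hq h
  by_contra hne
  exact hA.Phi_ne (fun n e => hne (P.lamComp_injOn_X α hA.pos_lt id n hp hq e)) h

theorem mem_X_iff_Phi {p : Torus} : P.Phi α δ p ∈ P.X ↔ p ∈ P.X :=
  ⟨fun h => P.mem_X_of_fst_eq h (hA.Phi_fst p).symm, fun h => P.mem_X_of_fst_eq h (hA.Phi_fst p)⟩

theorem eq_of_Phi_eq {p q : Torus} (hp : p ∈ P.X) (h : P.Phi α δ p = P.Phi α δ q) : p = q :=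
  hA.Phi_injOn_X hp (hA.mem_X_iff_Phi.1 (h ▸ hA.mem_X_iff_Phi.2 hp)) h

/-- Such a composition differs from Φ_k by one square, that is by at most 2δ_j, and Φ_k from `Phi`
by at most 2/2ᵏ. The other parity of n costs one more factor (`dist_lamComp_succ_Phi_le`). -/
theorem dist_lamComp_Phi_le {g : ℕ → ℕ} {n j k : ℕ} (hn : n ≤ k + 1) (hj : n ≤ j)
    (h : P.lamComp α δ g n = P.Lam α δ j ∘ P.PhiN α δ k) (p : Torus) :
    dist (P.Phi α δ p) (P.lamComp α δ g n p) ≤ 6 / 2 ^ n := by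
  rw [h, dist_comm]
  have h1 := hA.dist_PhiN_Phi_le k p
  have h2 := P.dist_Lam_le α hA.pos_lt j (P.PhiN α δ k p)
  have h3 := (hA.lt_two_pow j).le
  have h4 : (1 : ℝ) / 2 ^ j ≤ 1 / 2 ^ n := by gcongr; norm_num
  have h5 : (2 : ℝ) / 2 ^ k ≤ 4 / 2 ^ n := by
    calc (2 : ℝ) / 2 ^ k = 4 / 2 ^ (k + 1) := by rw [pow_succ]; field_simp; norm_num
      _ ≤ 4 / 2 ^ n := by gcongr; norm_num
  calc _ ≤ dist (P.Lam α δ j (P.PhiN α δ k p)) (P.PhiN α δ k p) +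
        dist (P.PhiN α δ k p) (P.Phi α δ p) := dist_triangle _ _ _
    _ ≤ 2 * (1 / 2 ^ n) + 4 / 2 ^ n := by linarith
    _ = 6 / 2 ^ n := by ring

theorem dist_lamComp_succ_Phi_le {g : ℕ → ℕ} {n : ℕ} (hj : n ≤ g (n + 1)) {p : Torus}
    (h : dist (P.Phi α δ p) (P.lamComp α δ g n p) ≤ 6 / 2 ^ n) :
    dist (P.Phi α δ p) (P.lamComp α δ g (n + 1) p) ≤ 16 / 2 ^ (n + 1) := by
  have h2 := P.dist_Lam_le α hA.pos_lt (g (n + 1)) (P.lamComp α δ g n p)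
  have h3 := (hA.lt_two_pow (g (n + 1))).le
  have h4 : (1 : ℝ) / 2 ^ (g (n + 1)) ≤ 1 / 2 ^ n := by gcongr; norm_num
  rw [dist_comm] at h2
  calc _ ≤ dist (P.Phi α δ p) (P.lamComp α δ g n p) +
        dist (P.lamComp α δ g n p) (P.lamComp α δ g (n + 1) p) := dist_triangle _ _ _
    _ ≤ 6 / 2 ^ n + 2 * (1 / 2 ^ n) := add_le_add h (h2.trans (by linarith))
    _ = 16 / 2 ^ (n + 1) := by rw [pow_succ]; field_simp; norm_num

omit hA in
theorem tendstoUniformly_of_dist_le {g : ℕ → ℕ}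
    (h : ∀ n, 2 ≤ n → ∀ p, dist (P.Phi α δ p) (P.lamComp α δ g n p) ≤ 16 / 2 ^ n) :
    TendstoUniformly (P.lamComp α δ g) (P.Phi α δ) atTop := by
  rw [Metric.tendstoUniformly_iff]
  intro ε hε
  filter_upwards [(tendsto_const_div_two_pow 16).eventually_lt_const hε, eventually_ge_atTop 2]
    with n hn h2 p
  exact (h n h2 p).trans_lt hn

theorem tendstoUniformly_sigma :
    TendstoUniformly (P.lamComp α δ sigma) (P.Phi α δ) atTop := by
  refine tendstoUniformly_of_dist_le fun n hn p => ?_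
  have hodd : ∀ k, dist (P.Phi α δ p) (P.lamComp α δ sigma (2 * k + 1) p) ≤ 6 / 2 ^ (2 * k + 1) :=
    fun k => hA.dist_lamComp_Phi_le (by omega) (by omega)
      (P.lamComp_sigma_odd α hA.pos_lt hA.disjoint_squares k) p
  rcases Nat.even_or_odd' n with ⟨k, rfl | rfl⟩
  · obtain ⟨k, rfl⟩ : ∃ j, k = j + 1 := ⟨k - 1, by omega⟩
    refine hA.dist_lamComp_succ_Phi_le (n := 2 * k + 1) ?_ (hodd k)
    have := sigma_even (k + 1)
    change 2 * k + 1 ≤ sigma (2 * (k + 1))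
    omega
  · exact (hodd k).trans (by gcongr; norm_num)

theorem tendstoUniformly_tau :
    TendstoUniformly (P.lamComp α δ tau) (P.Phi α δ) atTop := by
  refine tendstoUniformly_of_dist_le fun n hn p => ?_
  have heven : ∀ k, dist (P.Phi α δ p) (P.lamComp α δ tau (2 * k + 2) p) ≤ 6 / 2 ^ (2 * k + 2) :=
    fun k => hA.dist_lamComp_Phi_le (by omega) (by omega)
      (P.lamComp_tau_even α hA.pos_lt hA.disjoint_squares k) p
  rcases Nat.even_or_odd' n with ⟨k, rfl | rfl⟩
  · obtain ⟨k, rfl⟩ : ∃ j, k = j + 1 := ⟨k - 1, by omega⟩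
    exact (heven k).trans (div_le_div_of_nonneg_right (by norm_num) (by positivity))
  · obtain ⟨k, rfl⟩ : ∃ j, k = j + 1 := ⟨k - 1, by omega⟩
    refine hA.dist_lamComp_succ_Phi_le (n := 2 * k + 2) ?_ (heven k)
    have := tau_odd (k + 1)
    change 2 * k + 2 ≤ tau (2 * (k + 1) + 1)
    omega

/-- The identity Φ^gₙ ∘ fₙ = Φₙ + w passes to the limit on `X` by uniform convergence. Uniform
continuity of the limit of the fₙ extends it to the torus, and the identity extends by density. -/
theorem exists_lift {w : Torus} (hw : ∀ p ∈ P.X, p + w ∈ P.X) {g : ℕ → ℕ} {f : ℕ → Torus → Torus}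
    (hf : ∀ n p, f n p = Function.invFunOn (P.lamComp α δ g n) P.X (P.PhiN α δ n p + w))
    (hg : TendstoUniformly (P.lamComp α δ g) (P.Phi α δ) atTop)
    (hu : ∀ n, UniformContinuousOn (f n) P.X) (hc : UniformCauchySeqOn f atTop P.X) :
    ∃ F : Torus → Torus, Continuous F ∧ (∀ p, P.Phi α δ (F p) = P.Phi α δ p + w) ∧
      ∀ p ∈ P.X, F p = Function.invFunOn (P.Phi α δ) P.X (P.Phi α δ p + w) := by
  set l : Torus → Torus := fun p => limUnder atTop fun n => f n p with hl
  have hlim : ∀ p ∈ P.X, Tendsto (fun n => f n p) atTop (𝓝 (l p)) := fun p hp =>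
    (hc.cauchySeq hp).tendsto_limUnder
  have hluc : UniformContinuousOn l P.X :=
    (hc.tendstoUniformlyOn_of_tendsto hlim).uniformContinuousOn (Frequently.of_forall hu)
  have hPhi : ∀ p ∈ P.X, P.Phi α δ (l p) = P.Phi α δ p + w := by
    intro p hp
    have h1 : Tendsto (fun n => P.lamComp α δ g n (f n p)) atTop (𝓝 (P.Phi α δ (l p))) :=
      tendsto_comp_of_locally_uniform_limit hA.continuous_Phi.continuousAt (hlim p hp)
        fun u hu => ⟨Set.univ, univ_mem, (hg u hu).mono fun n hn y _ => hn y⟩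
    have h2 : (fun n => P.lamComp α δ g n (f n p)) = fun n => P.PhiN α δ n p + w := by
      funext n
      rw [hf]
      exact (P.invFunOn_lamComp α hA.pos_lt g n
        (hw _ (P.mem_X_of_fst_eq hp (P.PhiN_fst α δ n p)))).2
    rw [h2] at h1
    exact tendsto_nhds_unique h1 ((hA.tendsto_PhiN p).add_const w)
  have hcont : Continuous (extendFrom P.X l) :=
    continuous_extendFrom P.dense_X (exists_tendsto_of_uniformContinuousOn P.dense_X hluc)
  have hext : ∀ p ∈ P.X, extendFrom P.X l p = l p := fun p hp =>
    extendFrom_eq (subset_closure hp) (hluc.continuousOn p hp)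
  refine ⟨extendFrom P.X l, hcont, ?_, fun p hp => ?_⟩
  · have := Continuous.ext_on P.dense_X (hA.continuous_Phi.comp hcont)
      (hA.continuous_Phi.add continuous_const) (fun p hp => by
        change P.Phi α δ (extendFrom P.X l p) = P.Phi α δ p + w
        rw [hext p hp, hPhi p hp])
    exact fun p => congrFun this p
  · rw [hext p hp]
    have hX : l p ∈ P.X := by
      rw [← hA.mem_X_iff_Phi, hPhi p hp]
      exact hw _ (hA.mem_X_iff_Phi.2 hp)
    have hex : ∃ a ∈ P.X, P.Phi α δ a = P.Phi α δ p + w := ⟨l p, hX, hPhi p hp⟩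
    exact hA.Phi_injOn_X hX (Function.invFunOn_mem hex)
      ((hPhi p hp).trans (Function.invFunOn_eq hex).symm)

theorem continuous_S_and : Continuous (P.S α δ) ∧
    ∀ p, P.Phi α δ (P.S α δ p) = P.Phi α δ p + P.v := by
  obtain ⟨F, hF, hF1, hF2⟩ := hA.exists_lift (fun p hp => P.add_mem_X hp) (f := P.fwd α δ)
    (fun _ _ => rfl) hA.tendstoUniformly_sigma hA.fwd_uniformContinuous hA.fwd_cauchy
  have : P.S α δ = F := by
    funext p
    refine extendFrom_eq (P.dense_X p) ?_
    refine ((hF.tendsto p).mono_left nhdsWithin_le_nhds).congr' ?_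
    filter_upwards [self_mem_nhdsWithin] with q hq using hF2 q hq
  rw [this]
  exact ⟨hF, hF1⟩

theorem continuous_S : Continuous (P.S α δ) := hA.continuous_S_and.1

theorem Phi_S (p : Torus) : P.Phi α δ (P.S α δ p) = P.Phi α δ p + P.v := hA.continuous_S_and.2 p

/-- Both composites with `S` are continuous lifts of the identity, and such a lift is the identity
on the dense set `X`, where `Phi` is injective. -/
theorem exists_inverse_S : ∃ B : Torus → Torus, Continuous B ∧
    (∀ p, P.Phi α δ (B p) = P.Phi α δ p - P.v) ∧ Function.LeftInverse B (P.S α δ) ∧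
      Function.RightInverse B (P.S α δ) := by
  obtain ⟨B, hB, hB1, -⟩ := hA.exists_lift (w := -P.v)
    (fun p hp => by rw [← sub_eq_add_neg]; exact P.sub_mem_X hp) (f := P.bwd α δ)
    (fun _ _ => by rw [← sub_eq_add_neg]; rfl)
    hA.tendstoUniformly_tau hA.bwd_uniformContinuous hA.bwd_cauchy
  have key : ∀ F : Torus → Torus, Continuous F → (∀ p, P.Phi α δ (F p) = P.Phi α δ p) →
      ∀ p, F p = p := by
    intro F hF h p
    exact congrFun (Continuous.ext_on P.dense_X hF continuous_id
      (fun q hq => (hA.eq_of_Phi_eq hq (h q).symm).symm)) p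
  refine ⟨B, hB, fun p => by rw [hB1, sub_eq_add_neg], key _ (hB.comp hA.continuous_S) fun p => ?_,
    key _ (hA.continuous_S.comp hB) fun p => ?_⟩
  · rw [hB1, hA.Phi_S, add_neg_cancel_right]
  · rw [hA.Phi_S, hB1, neg_add_cancel_right]

theorem isHomeomorph_S : IsHomeomorph (P.S α δ) := by
  obtain ⟨B, -, -, h1, h2⟩ := hA.exists_inverse_S
  exact isHomeomorph_iff_continuous_bijective.2 ⟨hA.continuous_S, h1.injective, h2.surjective⟩

end Admissible

end Params

/-! ### Fibres of `Phi`, asymptotics at the column of z₀, and non-conjugacy. -/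

theorem norm_coe_le (x : ℝ) : ‖(x : UnitAddCircle)‖ ≤ |x| := by
  rcases le_total |x| (1 / 2) with h | h
  · exact (norm_coe_of_abs_le h).le
  · exact (norm_le_half _).trans h

theorem dist_pt (z : Torus) (t s t' s' : ℝ) : dist (pt z t s) (pt z t' s') =
    max ‖((t - t' : ℝ) : UnitAddCircle)‖ ‖((s - s' : ℝ) : UnitAddCircle)‖ := by
  rw [Prod.dist_eq, dist_eq_norm, dist_eq_norm, AddCircle.coe_sub, AddCircle.coe_sub]
  simp only [pt, add_sub_add_left_eq_sub]

namespace Params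

variable {P : Params} {α : ℕ → unitInterval} {δ : ℕ → ℝ}

namespace Admissible

variable (hA : P.Admissible α δ)
include hA

theorem exists_Phi_add_zsmul (k : ℤ) :
    ∃ G : Torus → Torus, Continuous G ∧ ∀ p, P.Phi α δ (G p) = P.Phi α δ p + k • P.v := by
  obtain ⟨B, hB, hB1, -, -⟩ := hA.exists_inverse_S
  induction k with
  | zero => exact ⟨id, continuous_id, fun p => by simp⟩
  | succ n ih =>
    obtain ⟨G, hG, h⟩ := ih
    refine ⟨P.S α δ ∘ G, hA.continuous_S.comp hG, fun p => ?_⟩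
    change P.Phi α δ (P.S α δ (G p)) = _
    rw [hA.Phi_S, h, add_zsmul, one_zsmul, add_assoc]
  | pred n ih =>
    obtain ⟨G, hG, h⟩ := ih
    refine ⟨B ∘ G, hB.comp hG, fun p => ?_⟩
    change P.Phi α δ (B (G p)) = _
    rw [hB1, h, sub_zsmul, one_zsmul]
    abel

/-- Minimality of `S`: the image of K under `Phi` is closed and contains a full orbit of T, hence is
the torus. As `Phi` is injective over `X`, K contains the dense set `X`. -/
theorem eq_univ_of_isClosed {K : Set Torus} (hK : IsClosed K) {p₀ : Torus} (hp₀ : p₀ ∈ K)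
    (hS : ∀ p, P.S α δ p ∈ K ↔ p ∈ K) : K = Set.univ := by
  obtain ⟨B, -, hB1, -, hB2⟩ := hA.exists_inverse_S
  have horb : ∀ k : ℤ, ∃ p ∈ K, P.Phi α δ p = P.Phi α δ p₀ + k • P.v := by
    intro k
    induction k with
    | zero => exact ⟨p₀, hp₀, by simp⟩
    | succ n ih =>
      obtain ⟨p, hp, h⟩ := ih
      refine ⟨P.S α δ p, (hS p).2 hp, ?_⟩
      rw [hA.Phi_S, h, add_zsmul, one_zsmul, add_assoc]
    | pred n ih =>
      obtain ⟨p, hp, h⟩ := ih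
      refine ⟨B p, (hS (B p)).1 (by rwa [hB2 p]), ?_⟩
      rw [hB1, h, sub_zsmul, one_zsmul]
      abel
  have hcl : IsClosed (P.Phi α δ '' K) := (hK.isCompact.image hA.continuous_Phi).isClosed
  have himg : ∀ q, q ∈ P.Phi α δ '' K := by
    intro q
    refine hcl.closure_subset_iff.2 ?_ (P.minimal (P.Phi α δ p₀) q)
    rintro _ ⟨k, rfl⟩
    obtain ⟨p, hp, h⟩ := horb k
    exact ⟨p, hp, h⟩
  have hX : P.X ⊆ K := by
    intro p hp
    obtain ⟨q, hq, h⟩ := himg (P.Phi α δ p)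
    rwa [hA.eq_of_Phi_eq hp h.symm]
  exact Set.eq_univ_of_univ_subset (P.dense_X.closure_eq ▸ hK.closure_subset_iff.2 hX)

theorem Lam_pt {n : ℕ} {t u : ℝ} (ht : |t| ≤ δ n) (hu : |u| ≤ (1 + δ n) / 2) :
    P.Lam α δ n (pt (P.z n) t (P.h α (δ n) u)) = pt (P.z n) t (P.h α t u) :=
  P.vmap_pt α (m := id) (hA.pos_lt n).1 (hA.pos_lt n).2 ht hu

omit hA in
theorem PhiN_succ_of_notMem {n : ℕ} {p : Torus} (h : δ (n + 1) < ‖p.1 - (P.z (n + 1)).1‖) :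
    P.PhiN α δ (n + 1) p = P.PhiN α δ n p := by
  rw [P.PhiN_succ]
  refine P.Lam_of_notMem α fun hmem => ?_
  have := hmem.1
  rw [P.PhiN_fst] at this
  linarith

/-- Squares with index larger than n avoid the column of zₙ. -/
theorem Phi_eq_PhiN {n : ℕ} {p : Torus} (hp : p.1 = (P.z n).1) :
    P.Phi α δ p = P.PhiN α δ n p := by
  have h : ∀ m, n ≤ m → P.PhiN α δ m p = P.PhiN α δ n p := by
    intro m hm
    induction m, hm using Nat.le_induction with
    | base => rfl
    | succ m hm ih =>
      rw [PhiN_succ_of_notMem, ih]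
      by_contra! hle
      refine hA.disjoint_columns n (m + 1) (by omega) (p.1, (P.z (m + 1)).2) ⟨hle, ?_⟩ hp
      simpa using (hA.pos _).le
  refine tendsto_nhds_unique (hA.tendsto_PhiN p) (tendsto_const_nhds.congr' ?_)
  filter_upwards [eventually_ge_atTop n] with m hm using (h m hm).symm

/-- A nondegenerate fibre lies in some column of zₙ. There Φₙ₋₁ is injective, because the earlier
collapses happen in other columns, and Λₙ identifies points only at zₙ. -/
theorem exists_Phi_eq_z {p q : Torus} (hne : p ≠ q) (h : P.Phi α δ p = P.Phi α δ q) :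
    ∃ n, P.Phi α δ p = P.z n := by
  have hX : p ∉ P.X := fun hp => hne (hA.eq_of_Phi_eq hp h)
  have hfst : p.1 = q.1 := by rw [← hA.Phi_fst p, h, hA.Phi_fst]
  simp only [X, Set.mem_ofPred_eq, not_forall, not_not] at hX
  obtain ⟨n, hn⟩ := hX
  refine ⟨n, ?_⟩
  rw [hA.Phi_eq_PhiN hn, hA.Phi_eq_PhiN (hfst ▸ hn)] at h
  rw [hA.Phi_eq_PhiN hn]
  rcases n with _ | n
  · exact P.vmap_id_eq_center α (hA.pos_lt _).1 (hA.pos_lt _).2 hfst hne h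
  · refine P.vmap_id_eq_center α (hA.pos_lt _).1 (hA.pos_lt _).2 ?_ (fun e => hne ?_) h
    · change (P.PhiN α δ n p).1 = (P.PhiN α δ n q).1
      rw [P.PhiN_fst, P.PhiN_fst, hfst]
    · refine P.lamComp_injective α hA.pos_lt id hfst (fun i hi hi' => ?_) e
      have := P.fst_z_injective (hn.symm.trans hi')
      simp only [id] at this
      omega

theorem exists_ne_Phi_eq_z_zero :
    ∃ p q, p ≠ q ∧ P.Phi α δ p = P.z 0 ∧ P.Phi α δ q = P.z 0 := by
  obtain ⟨h0, h1⟩ := hA.pos_lt 0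
  have had : |δ 0| = δ 0 := abs_of_pos h0
  have key : ∀ u : ℝ, |u| ≤ 1 / 2 →
      P.Phi α δ (pt (P.z 0) 0 (P.h α (δ 0) u)) = P.z 0 := by
    intro u hu
    rw [hA.Phi_eq_PhiN (n := 0) (by simp [pt])]
    change P.Lam α δ 0 _ = _
    rw [hA.Lam_pt (by simpa using h0.le) (by linarith), P.h_zero_of_mem α ⟨by linarith [(abs_le.1 hu).1], (abs_le.1 hu).2⟩]
    simp [pt]
  refine ⟨_, _, fun e => ?_, key 0 (by simp), key (1 / 2) (by norm_num [abs_le])⟩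
  have e1 := P.h_mem α (u := 0) had.le (by linarith) (by simp; linarith)
  have e2 := P.h_mem α (u := 1 / 2) had.le (by linarith)
    (by rw [abs_of_pos (by norm_num)]; linarith)
  have := P.h_injective α h0.ne' (by linarith)
    (pt_snd_inj (by linarith) (by linarith) (congrArg Prod.snd e))
  norm_num at this

/-- If the columns of squares l < n both contain p, then (n - 1)δₙ ≤ ‖p.1 - x_l‖ ≤ δ_l. The
half-sides of the squares that can move p therefore at least halve each time, and the first is at
most ‖p.1 - x₀‖/(N - 1). -/
theorem dist_PhiN_Lam_le {N : ℕ} (hN : 2 ≤ N) {p : Torus}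
    (hp : ∀ n, 1 ≤ n → n < N → δ n < ‖p.1 - (P.z n).1‖) (m : ℕ) :
    dist (P.PhiN α δ m p) (P.Lam α δ 0 p) ≤ 4 * (‖p.1 - (P.z 0).1‖ / (N - 1)) := by
  set B := ‖p.1 - (P.z 0).1‖ / ((N : ℝ) - 1) with hB
  have hN' : (2 : ℝ) ≤ N := by exact_mod_cast hN
  have hB0 : 0 ≤ B := div_nonneg (norm_nonneg _) (by linarith)
  have hgap : ∀ l n, l < n → 1 ≤ n → ‖p.1 - (P.z n).1‖ ≤ δ n →
      ((n : ℝ) - 1) * δ n ≤ ‖p.1 - (P.z l).1‖ := by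
    intro l n hln hn hmeet
    have h1 := hA.lt_dist l n hln
    have hn' : (0 : ℝ) < n := by exact_mod_cast hn
    rw [lt_div_iff₀ hn'] at h1
    have h2 : ‖(P.z l).1 - (P.z n).1‖ ≤ ‖p.1 - (P.z l).1‖ + ‖p.1 - (P.z n).1‖ := by
      rw [← dist_eq_norm, ← dist_eq_norm, ← dist_eq_norm]
      exact dist_triangle_left _ _ _
    linarith
  have hfirst : ∀ n, N ≤ n → ‖p.1 - (P.z n).1‖ ≤ δ n → δ n ≤ B := by
    intro n hn hmeet
    have h1 := hgap 0 n (by omega) (by omega) hmeet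
    have hn' : (N : ℝ) ≤ n := by exact_mod_cast hn
    rw [hB, le_div_iff₀ (by linarith)]
    nlinarith [hA.pos n]
  -- The term -2δ_l, with l a square already met, makes the geometric sum inductive: adding 2δₘ₊₁ ≤
  -- δ_l leaves at most 4B - 2δₘ₊₁.
  have key : ∀ m, P.PhiN α δ m p = P.Lam α δ 0 p ∨ ∃ l, N ≤ l ∧ l ≤ m ∧ ‖p.1 - (P.z l).1‖ ≤ δ l ∧
      dist (P.PhiN α δ m p) (P.Lam α δ 0 p) ≤ 4 * B - 2 * δ l := by
    intro m
    induction m with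
    | zero => exact Or.inl rfl
    | succ m ih =>
      by_cases hmeet : ‖p.1 - (P.z (m + 1)).1‖ ≤ δ (m + 1)
      · have hNm : N ≤ m + 1 := by
          by_contra! hlt
          exact absurd hmeet (not_le.2 (hp (m + 1) (by omega) hlt))
        have hstep := P.dist_Lam_le α hA.pos_lt (m + 1) (P.PhiN α δ m p)
        rw [← P.PhiN_succ] at hstep
        refine Or.inr ⟨m + 1, hNm, le_rfl, hmeet, ?_⟩
        rcases ih with ih | ⟨l, hl1, hl2, hl3, hl4⟩
        · rw [← ih]
          linarith [hfirst (m + 1) hNm hmeet]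
        · have h1 := hgap l (m + 1) (by omega) (by omega) hmeet
          have h2 : (3 : ℝ) ≤ ((m + 1 : ℕ) : ℝ) := by exact_mod_cast (by omega : 3 ≤ m + 1)
          have h3 : 2 * δ (m + 1) ≤ δ l := by nlinarith [hA.pos (m + 1)]
          have := dist_triangle (P.PhiN α δ (m + 1) p) (P.PhiN α δ m p) (P.Lam α δ 0 p)
          linarith
      · rw [PhiN_succ_of_notMem (not_le.1 hmeet)]
        rcases ih with ih | ⟨l, hl1, hl2, hl⟩
        · exact Or.inl ih
        · exact Or.inr ⟨l, hl1, by omega, hl⟩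
  rcases key m with h | ⟨l, -, -, -, h⟩
  · rw [h, dist_self]; positivity
  · linarith [hA.pos l]

/-- Each square other than the one at z₀ stays away from the column x₀, so for small t none of the
first N can act over x₀ + t; letting N grow gives o(t). -/
theorem eventually_dist_Phi_Lam_le {η : ℝ} (hη : 0 < η) :
    ∀ᶠ t : ℝ in 𝓝[>] 0, ∀ p : Torus, p.1 = (P.z 0).1 + (t : UnitAddCircle) →
      dist (P.Phi α δ p) (P.Lam α δ 0 p) ≤ η * t := by
  obtain ⟨k, hk⟩ := exists_nat_ge (4 / η)
  have hN : ∀ n, n < k + 2 → ∀ᶠ t : ℝ in 𝓝[>] 0, 1 ≤ n → t + δ n < ‖(P.z 0).1 - (P.z n).1‖ := by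
    intro n _
    rcases Nat.eq_zero_or_pos n with rfl | hn
    · exact Eventually.of_forall fun t h => by omega
    · have h1 := hA.lt_dist 0 n hn
      have hn' : (1 : ℝ) ≤ n := by exact_mod_cast hn
      have h2 : δ n < ‖(P.z 0).1 - (P.z n).1‖ :=
        h1.trans_le (div_le_self (norm_nonneg _) hn')
      have : ∀ᶠ t : ℝ in 𝓝 0, t < ‖(P.z 0).1 - (P.z n).1‖ - δ n :=
        eventually_lt_nhds (by linarith)
      filter_upwards [nhdsWithin_le_nhds this] with t ht _
      linarith
  have hall := (Filter.eventually_all_finite (Set.finite_Iio (k + 2))).2 fun n hn => hN n hn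
  filter_upwards [hall, self_mem_nhdsWithin] with t ht ht0 p hp
  have ht0' : 0 < t := ht0
  have hpt : ‖p.1 - (P.z 0).1‖ ≤ t := by
    rw [hp, add_sub_cancel_left]
    exact (norm_coe_le t).trans_eq (abs_of_pos ht0')
  have hlim : Tendsto (fun m => dist (P.PhiN α δ m p) (P.Lam α δ 0 p)) atTop
      (𝓝 (dist (P.Phi α δ p) (P.Lam α δ 0 p))) := (hA.tendsto_PhiN p).dist tendsto_const_nhds
  refine le_of_tendsto' hlim fun m => ?_
  refine (hA.dist_PhiN_Lam_le (N := k + 2) (by omega) (fun n hn1 hn2 => ?_) m).trans ?_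
  · have h1 := ht n hn2 hn1
    have h2 : ‖(P.z 0).1 - (P.z n).1‖ ≤ ‖p.1 - (P.z 0).1‖ + ‖p.1 - (P.z n).1‖ := by
      rw [← dist_eq_norm, ← dist_eq_norm, ← dist_eq_norm]
      exact dist_triangle_left _ _ _
    linarith
  · rw [div_le_iff₀ hη] at hk
    push_cast
    rw [← mul_div_assoc, div_le_iff₀ (by linarith [(Nat.cast_nonneg k : (0 : ℝ) ≤ k)])]
    nlinarith

/-- As `t → 0`, a point over `z₀ + (t, t/4)` is close to `z₀ + (0, h_{δ₀} (-p_α t))`. -/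
theorem eventually_dist_lt {ε : ℝ} (hε : 0 < ε) :
    ∀ᶠ t : ℝ in 𝓝[>] 0, ∀ p : Torus, P.Phi α δ p = pt (P.z 0) t (t / 4) →
      dist p (pt (P.z 0) 0 (P.h α (δ 0) (-P.pFun α t))) < ε := by
  obtain ⟨h0, h1⟩ := hA.pos_lt 0
  -- The bound 1/2 keeps t/4 + w within δ₀. Dividing by the slope t/3 gives 3η, and the Lipschitz
  -- constant 6 of h_{δ₀} gives 18η ≤ ε/2.
  set η := min (1 / 2) (ε / 36) with hη
  have hη0 : 0 < η := by positivity
  have hη1 : η ≤ 1 / 2 := min_le_left _ _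
  have hη2 : η ≤ ε / 36 := min_le_right _ _
  have ht1 : ∀ᶠ t : ℝ in 𝓝 0, t < δ 0 := eventually_lt_nhds h0
  have ht2 : ∀ᶠ t : ℝ in 𝓝 0, t < ε := eventually_lt_nhds hε
  filter_upwards [hA.eventually_dist_Phi_Lam_le hη0, nhdsWithin_le_nhds ht1,
    nhdsWithin_le_nhds ht2, self_mem_nhdsWithin] with t ht htδ htε ht0 p hp
  have ht0' : 0 < t := ht0
  have hat : |t| = t := abs_of_pos ht0'
  have hfst : p.1 = (P.z 0).1 + (t : UnitAddCircle) := by rw [← hA.Phi_fst p, hp]; rfl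
  have hd := ht p hfst
  set q := P.Lam α δ 0 p with hq
  set w := rep (q.2 - ((P.z 0).2 + ((t / 4 : ℝ) : UnitAddCircle))) with hw
  have hwle : |w| ≤ η * t := by
    rw [hw, abs_rep, ← dist_eq_norm, dist_comm]
    refine le_trans ?_ hd
    rw [hp]
    exact le_max_right _ _
  have hqpt : q = pt (P.z 0) t (t / 4 + w) := by
    refine Prod.ext ?_ ?_
    · rw [hq, P.Lam_fst, hfst]; rfl
    · have := coe_rep (q.2 - ((P.z 0).2 + ((t / 4 : ℝ) : UnitAddCircle)))
      rw [← hw] at this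
      simp only [pt, AddCircle.coe_add]
      rw [this]; abel
  have hηt : η * t ≤ 1 / 2 * t := by gcongr
  have hs : |t / 4 + w| ≤ δ 0 := by
    rw [abs_le] at hwle ⊢
    constructor <;> linarith [hwle.1, hwle.2]
  have hqA : q ∈ P.A δ 0 := hqpt ▸ pt_mem_sq (P.z 0) h1 (by linarith) hs
  have hpA : p ∈ sq (P.z 0) (δ 0) := (P.vmap_mem_sq_iff α h0 h1 (isProfile_id _)).1 hqA
  obtain ⟨t', u, ht', hu, rfl⟩ := P.exists_pt_h_of_mem_sq α h0 h1 hpA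
  obtain rfl : t' = t := pt_fst_inj (s' := 0) (by linarith) (by linarith) hfst
  have hqu : q = pt (P.z 0) t' (P.h α t' u) := hA.Lam_pt ht' hu
  have hhu : P.h α t' u = t' / 4 + w :=
    pt_snd_inj ((P.h_mem α ht' (by linarith) hu).trans_lt h1) (hs.trans_lt h1)
      (congrArg Prod.snd (hqu.symm.trans hqpt))
  have hlow := P.abs_h_sub_ge α (t := t') (-P.pFun α t') u (by linarith)
  have hneg := P.h_neg_pFun α (t := t') (by linarith)
  rw [hat] at hneg hlow
  rw [hhu, hneg, add_sub_cancel_left] at hlow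
  have hu3 : |u - -P.pFun α t'| ≤ 3 * η := by
    by_contra! hlt
    have := mul_lt_mul_of_pos_left hlt (show 0 < t' / 3 by positivity)
    linarith
  have hup := P.abs_h_sub_le α (t := δ 0) (-P.pFun α t') u (by rw [abs_of_pos h0]; linarith)
  rw [dist_pt, max_lt_iff]
  constructor
  · exact (norm_coe_le _).trans_lt (by rwa [sub_zero, hat])
  · refine (norm_coe_le _).trans_lt ?_
    linarith

omit hA in
theorem tendsto_of_ε_lt {u : ℕ → ℝ} (h1 : ∀ k, P.ε (k + 1) < u k) (h2 : ∀ k, u k < P.ε k) :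
    Tendsto u atTop (𝓝[>] 0) := by
  refine tendsto_nhdsWithin_iff.2 ⟨?_, Eventually.of_forall fun k => (P.ε_pos _).trans (h1 k)⟩
  exact squeeze_zero (fun k => ((P.ε_pos _).trans (h1 k)).le) (fun k => (h2 k).le) P.ε_tendsto

/-- If p lies over z₀ + (t, t/4) for Φ_α, then g p lies over the same point for Φ_β. Both are
located by `eventually_dist_lt`, and g is uniformly continuous. -/
theorem tendsto_dist_of_semiconj {β : ℕ → unitInterval} {δ' : ℕ → ℝ} (hB : P.Admissible β δ')
    {g : Torus → Torus} (hg : Continuous g) (h : ∀ p, P.Phi β δ' (g p) = P.Phi α δ p) :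
    Tendsto (fun t => dist (g (pt (P.z 0) 0 (P.h α (δ 0) (-P.pFun α t))))
      (pt (P.z 0) 0 (P.h β (δ' 0) (-P.pFun β t)))) (𝓝[>] 0) (𝓝 0) := by
  rw [Metric.tendsto_nhds]
  intro ε hε
  obtain ⟨r, hr, hgr⟩ := Metric.uniformContinuous_iff.1
    (CompactSpace.uniformContinuous_of_continuous hg) (ε / 2) (by positivity)
  filter_upwards [hA.eventually_dist_lt hr, hB.eventually_dist_lt (half_pos hε)] with t h1 h2
  obtain ⟨p, hp⟩ := hA.Phi_surjective (pt (P.z 0) t (t / 4))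
  have e1 := hgr (h1 p hp)
  have e2 := h2 (g p) ((h p).trans hp)
  rw [Real.dist_eq, sub_zero, abs_of_nonneg dist_nonneg]
  rw [dist_comm] at e1
  linarith [dist_triangle (g (pt (P.z 0) 0 (P.h α (δ 0) (-P.pFun α t)))) (g p)
    (pt (P.z 0) 0 (P.h β (δ' 0) (-P.pFun β t)))]

theorem le_dist_pt_h {a b : ℝ} (ha : a ∈ Set.Icc (0 : ℝ) (1 / 4)) (hb : b ∈ Set.Icc (0 : ℝ) (1 / 4)) :
    δ 0 / 3 * |a - b| ≤ dist (pt (P.z 0) 0 (P.h α (δ 0) (-a))) (pt (P.z 0) 0 (P.h α (δ 0) (-b))) := by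
  obtain ⟨h0, h1⟩ := hA.pos_lt 0
  have had : |δ 0| = δ 0 := abs_of_pos h0
  -- Two such values differ by at most 1/2, so their distance on the circle is the absolute
  -- difference.
  have hbd : ∀ c ∈ Set.Icc (0 : ℝ) (1 / 4), |P.h α (δ 0) (-c)| ≤ 1 / 4 := by
    intro c hc
    have hc' : -c ∈ Set.Icc (-1 / 2 : ℝ) (1 / 2) := ⟨by linarith [hc.2], by linarith [hc.1]⟩
    rw [P.h_eq_hModel α (by linarith), had, hModel_of_mem h0.le hc', abs_mul, had]
    have := abs_kink_le (P.pFun_mem α (t := δ 0) (by linarith)) hc'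
    nlinarith [abs_nonneg (kink (P.pFun α (δ 0)) (-c))]
  have hlow := P.abs_h_sub_ge α (t := δ 0) (-b) (-a) (by linarith)
  have e1 := abs_le.1 (hbd a ha)
  have e2 := abs_le.1 (hbd b hb)
  rw [had] at hlow
  have e3 : |-a - -b| = |a - b| := by rw [← abs_neg]; ring_nf
  rw [e3] at hlow
  rw [dist_pt]
  refine hlow.trans (le_trans (norm_coe_of_abs_le ?_).ge (le_max_right _ _))
  exact abs_le.2 ⟨by linarith, by linarith⟩

/-- The sequence e₃ tests g on the dense set of values q_k/4 common to α and β and determines it on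
an arc of the fibre over z₀; the sequence e₁ then compares α(k) with β(k). -/
theorem c0Equiv_of_semiconj {β : ℕ → unitInterval} {δ' : ℕ → ℝ} (hB : P.Admissible β δ')
    {g : Torus → Torus} (hg : Continuous g) (h : ∀ p, P.Phi β δ' (g p) = P.Phi α δ p) :
    C0Equiv α β := by
  have hlim := hA.tendsto_dist_of_semiconj hB hg h
  obtain ⟨h0, h1⟩ := hA.pos_lt 0
  obtain ⟨h0', h1'⟩ := hB.pos_lt 0
  have hE : ∀ (γ : ℕ → unitInterval) (d : ℝ), |d| < 1 →
      Continuous fun a : unitInterval => pt (P.z 0) 0 (P.h γ d (-((a : ℝ) / 4))) := by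
    intro γ d hd
    have h2 := P.continuous_h γ hd
    unfold pt
    refine continuous_const.prodMk (continuous_const.add (continuous_coe_circle.comp (h2.comp ?_)))
    fun_prop
  have hEα := hg.comp (hE α (δ 0) (by rw [abs_of_pos h0]; linarith))
  have hEβ := hE β (δ' 0) (by rw [abs_of_pos h0']; linarith)
  have hq := hlim.comp (tendsto_of_ε_lt (P := P) (u := P.e₃)
    (fun k => (P.lt_e₁ k).trans ((P.e₁_lt_e₂ k).trans (P.e₂_lt_e₃ k))) P.e₃_lt)
  have hαβ := hlim.comp (tendsto_of_ε_lt (P := P) (u := P.e₁) P.lt_e₁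
    (fun k => (P.e₁_lt_e₂ k).trans ((P.e₂_lt_e₃ k).trans (P.e₃_lt k))))
  have heq : ∀ a : unitInterval, g (pt (P.z 0) 0 (P.h α (δ 0) (-((a : ℝ) / 4)))) =
      pt (P.z 0) 0 (P.h β (δ' 0) (-((a : ℝ) / 4))) := by
    intro a
    by_contra hne
    obtain ⟨ε, hε, hεa⟩ := exists_between (dist_pos.2 hne)
    obtain ⟨K, hK⟩ := eventually_atTop.1 (hq.eventually_lt_const hε)
    have hop : IsOpen {b : unitInterval | ε < dist (g (pt (P.z 0) 0 (P.h α (δ 0) (-((b : ℝ) / 4)))))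
        (pt (P.z 0) 0 (P.h β (δ' 0) (-((b : ℝ) / 4))))} :=
      isOpen_lt continuous_const (hEα.dist hEβ)
    -- A tail of q is still dense, so the failure of equality at a persists at some q_k with k
    -- arbitrarily large.
    have hdense : Dense (Set.range P.q \ P.q '' Set.Iio (K + 1)) :=
      Dense.sdiff_finite P.q_dense ((Set.finite_Iio _).image _)
    obtain ⟨b, hb, ⟨k, rfl⟩, hbk⟩ := hdense.inter_open_nonempty _ hop ⟨a, hεa⟩
    have hk : K + 1 ≤ k := by
      by_contra! hlt
      exact hbk ⟨k, hlt, rfl⟩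
    -- For index 0 the roles of q and α are interchanged, so only positive indices are used.
    obtain ⟨j, rfl⟩ : ∃ j, k = j + 1 := ⟨k - 1, by omega⟩
    have hhigh : ∀ γ : ℕ → unitInterval, P.pFun γ (P.e₃ (j + 1)) = (P.q (j + 1) : ℝ) / 4 :=
      fun γ => P.pFun_of_high γ (P.e₂_lt_e₃ _) le_rfl
    have h2 := hK (j + 1) (by omega)
    simp only [Function.comp_apply, hhigh] at h2
    exact lt_asymm h2 hb
  unfold C0Equiv
  refine squeeze_zero' (Eventually.of_forall fun n => abs_nonneg _) ?_
    -- The factor 12/δ' 0 combines the expansion δ' 0/3 with the scaling of α and β by 1/4.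
    (by simpa using hαβ.const_mul (12 / δ' 0))
  filter_upwards [eventually_ge_atTop 1] with n hn
  obtain ⟨k, rfl⟩ : ∃ k, n = k + 1 := ⟨n - 1, by omega⟩
  have hlow : ∀ γ : ℕ → unitInterval, P.pFun γ (P.e₁ (k + 1)) = (γ (k + 1) : ℝ) / 4 :=
    fun γ => P.pFun_of_low γ (P.lt_e₁ _) le_rfl
  have hmem : ∀ a : unitInterval, (a : ℝ) / 4 ∈ Set.Icc (0 : ℝ) (1 / 4) := fun a =>
    ⟨by linarith [a.2.1], by linarith [a.2.2]⟩
  have hle := hB.le_dist_pt_h (hmem (α (k + 1))) (hmem (β (k + 1)))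
  simp only [hlow, heq]
  rw [div_mul_eq_mul_div, le_div_iff₀ h0']
  rw [← sub_div, abs_div, abs_of_pos (show (0 : ℝ) < 4 by norm_num)] at hle
  linarith

/-- The difference of the two projections is invariant, hence a constant translation. Nondegenerate
fibres go to nondegenerate fibres, so it is a power of T, which a lift through Φ_β cancels. -/
theorem c0Equiv_of_topConj {β : ℕ → unitInterval} {δ' : ℕ → ℝ} (hB : P.Admissible β δ')
    (h : TopConj (P.S α δ) (P.S β δ')) : C0Equiv α β := by
  obtain ⟨g, hg⟩ := h
  set D : Torus → Torus := fun p => P.Phi β δ' (g p) - P.Phi α δ p with hD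
  have hDc : Continuous D := (hB.continuous_Phi.comp g.continuous).sub hA.continuous_Phi
  have hDS : ∀ p, D (P.S α δ p) = D p := fun p => by
    simp only [hD]
    rw [hg, hB.Phi_S, hA.Phi_S, add_sub_add_right_eq_sub]
  obtain ⟨p, q, hne, hp, hq⟩ := hA.exists_ne_Phi_eq_z_zero
  have hconst : {x | D x = D p} = Set.univ :=
    hA.eq_univ_of_isClosed (isClosed_eq hDc continuous_const) (p₀ := p) rfl fun x => by
      simp only [Set.mem_ofPred_eq, hDS]
  have hDp : ∀ x, P.Phi β δ' (g x) = P.Phi α δ x + D p := fun x => by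
    have : x ∈ {x | D x = D p} := hconst ▸ Set.mem_univ x
    have hx : D x = D p := this
    rw [← hx, hD]
    simp
  obtain ⟨n, hn⟩ := hB.exists_Phi_eq_z (p := g p) (q := g q) (fun e => hne (g.injective e))
    (by rw [hDp, hDp, hp, hq])
  have hDn : D p = expo n • P.v := by
    rw [hDp, hp, P.z_eq n, P.z_zero] at hn
    exact add_left_cancel hn
  obtain ⟨G, hG, hG1⟩ := hB.exists_Phi_add_zsmul (-expo n)
  refine hA.c0Equiv_of_semiconj hB (hG.comp g.continuous) fun x => ?_
  change P.Phi β δ' (G (g x)) = _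
  rw [hG1, hDp, hDn, neg_zsmul, add_neg_cancel_right]

end Admissible

end Params

/-! ### Resizing squares and lifting the correction. -/

/-- A fibred map `R` supported in `K` lifts through a fibred surjection that is injective
over `K`. -/
theorem exists_lift_of_injective_over {K : Set Torus} (hK : IsClosed K) {Ψ R : Torus → Torus}
    (hΨ : Continuous Ψ) (hΨ1 : ∀ p, (Ψ p).1 = p.1) (hΨs : Function.Surjective Ψ)
    (hR : Continuous R) (hR1 : ∀ p, (R p).1 = p.1) (hRK : ∀ p ∈ K, R p ∈ K)
    (hRid : ∀ p, p ∉ K → R p = p) (hinj : ∀ p q, Ψ p ∈ K → Ψ p = Ψ q → p = q) {ε : ℝ}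
    (hε : 0 ≤ ε) (hsmall : ∀ p q, p.1 = q.1 → Ψ p ∈ K → Ψ q ∈ K → dist p q ≤ ε) :
    ∃ Q : Torus → Torus, Continuous Q ∧ (∀ p, (Q p).1 = p.1) ∧ (∀ p, Ψ (Q p) = R (Ψ p)) ∧
      ∀ p, dist (Q p) p ≤ ε := by
  classical
  choose s hs using hΨs
  set Q : Torus → Torus := fun p => if Ψ p ∈ K then s (R (Ψ p)) else p with hQ
  have hQK : ∀ p, Ψ p ∈ K → Q p = s (R (Ψ p)) := fun p hp => if_pos hp
  have hQid : ∀ p, Ψ p ∉ K → Q p = p := fun p hp => if_neg hp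
  have hΨQ : ∀ p, Ψ (Q p) = R (Ψ p) := by
    intro p
    by_cases hp : Ψ p ∈ K
    · rw [hQK p hp, hs]
    · rw [hQid p hp, hRid _ hp]
  have hQ1 : ∀ p, (Q p).1 = p.1 := fun p => by rw [← hΨ1 (Q p), hΨQ, hR1, hΨ1]
  refine ⟨Q, continuous_iff_continuousAt.2 fun p => ?_, hQ1, hΨQ, fun p => ?_⟩
  · by_cases hp : Ψ p ∈ K
    -- By compactness it is enough that every cluster value y equals Q p: Ψ y = R (Ψ p) by
    -- continuity, and Ψ is injective over K.
    · refine tendsto_nhds_of_unique_mapClusterPt fun y hy => ?_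
      have h1 : MapClusterPt (Ψ y) (𝓝 p) (Ψ ∘ Q) := hy.continuousAt_comp hΨ.continuousAt
      have h2 : Tendsto (Ψ ∘ Q) (𝓝 p) (𝓝 (R (Ψ p))) := by
        have : Ψ ∘ Q = R ∘ Ψ := funext hΨQ
        rw [this]
        exact (hR.comp hΨ).tendsto p
      have h3 : Ψ y = R (Ψ p) :=
        eq_of_nhds_neBot (h1.clusterPt.neBot.mono (inf_le_inf_left _ h2))
      refine hinj y (Q p) ?_ (h3.trans (hΨQ p).symm)
      rw [h3]
      exact hRK _ hp
    · refine continuousAt_id.congr ?_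
      filter_upwards [(hK.isOpen_compl.preimage hΨ).mem_nhds hp] with q hq
      exact (hQid q hq).symm
  · by_cases hp : Ψ p ∈ K
    · exact hsmall _ _ (hQ1 p) (by rw [hΨQ]; exact hRK _ hp) hp
    · rw [hQid p hp, dist_self]
      exact hε

namespace Params

variable (P : Params) (α : ℕ → unitInterval) {δ : ℕ → ℝ}

/-- If d' ≤ d, the profile max d' |t| does this by `vmap_id_vmap_max`. Otherwise R is the inverse of
the homeomorphism obtained with d and d' exchanged. -/
theorem exists_resize (z : Torus) {d d' : ℝ} (hd0 : 0 < d) (hd : d < 1 / 2) (hd0' : 0 < d')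
    (hd' : d' < 1 / 2) : ∃ R : Torus → Torus, Continuous R ∧ (∀ p, (R p).1 = p.1) ∧
      (∀ p ∈ sq z (max d d'), R p ∈ sq z (max d d')) ∧ (∀ p, p ∉ sq z (max d d') → R p = p) ∧
      ∀ p, P.vmap α z d' id (R p) = P.vmap α z d id p := by
  rcases le_total d' d with h | h
  · have hm := isProfile_max hd0'.le h
    rw [max_eq_left h]
    exact ⟨P.vmap α z d (fun t => max d' |t|), P.continuous_vmap α hd0 hd hm, P.vmap_fst α,
      fun p hp => P.vmap_mem_sq α hd0 hd hm hp, fun p hp => P.vmap_of_notMem α hp,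
      P.vmap_id_vmap_max α hd0' h hd⟩
  · have hm := isProfile_max hd0.le h
    rw [max_eq_right h]
    set V := P.vmap α z d' (fun t => max d |t|) with hV
    have hVc : Continuous V := P.continuous_vmap α hd0' hd' hm
    have hVb : Function.Bijective V := by
      refine ⟨fun p q hpq => P.vmap_injective_of_fst_eq α hd0' hd' hm ?_ (fun t _ _ => ?_) hpq,
        P.vmap_surjective α hd0' hd' hm⟩
      · rw [← P.vmap_fst α p, ← P.vmap_fst α q]
        exact congrArg Prod.fst hpq
      · exact (hd0.trans_le (le_max_left _ _)).ne'
    obtain ⟨e, he⟩ := isHomeomorph_iff_exists_homeomorph.1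
      (isHomeomorph_iff_continuous_bijective.2 ⟨hVc, hVb⟩)
    have hVR : ∀ p, V (e.symm p) = p := fun p => by rw [← he, e.apply_symm_apply]
    refine ⟨e.symm, e.symm.continuous, fun p => ?_, fun p hp => ?_, fun p hp => ?_, fun p => ?_⟩
    · conv_rhs => rw [← hVR p]
      exact (P.vmap_fst α _).symm
    · rw [← hVR p] at hp
      exact (P.vmap_mem_sq_iff α hd0' hd' hm).1 hp
    · have : V p = p := P.vmap_of_notMem α hp
      rw [← he] at this
      conv_lhs => rw [← this]
      exact e.symm_apply_apply p
    · conv_rhs => rw [← hVR p]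
      exact (P.vmap_id_vmap_max α hd0 h hd' _).symm

theorem vmap_add (z w : Torus) (d : ℝ) (m : ℝ → ℝ) (p : Torus) :
    P.vmap α (z + w) d m (p + w) = P.vmap α z d m p + w := by
  have h : p + w ∈ sq (z + w) d ↔ p ∈ sq z d := by simp [sq]
  by_cases hp : p ∈ sq z d
  · rw [vmap, vmap, if_pos hp, if_pos (h.2 hp)]
    refine Prod.ext ?_ ?_
    · rfl
    · simp only [Prod.fst_add, Prod.snd_add, add_sub_add_right_eq_sub]
      abel
  · rw [P.vmap_of_notMem α hp, P.vmap_of_notMem α fun h' => hp (h.1 h')]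

/-- `L` is the identity on `K` and preserves the complement of `K`. -/
def Fixes (L : Torus → Torus) (K : Set Torus) : Prop := (∀ p ∈ K, L p = p) ∧ ∀ p, p ∉ K → L p ∉ K

variable {P α} in
theorem Fixes.comp {L L' : Torus → Torus} {K : Set Torus} (h : Fixes L K) (h' : Fixes L' K) :
    Fixes (L ∘ L') K :=
  ⟨fun p hp => by rw [Function.comp_apply, h'.1 p hp, h.1 p hp], fun p hp => h.2 _ (h'.2 p hp)⟩

theorem fixes_Lam (hδ : ∀ n, 0 < δ n ∧ δ n < 1 / 2) {n : ℕ} {K : Set Torus}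
    (h : Disjoint (P.A δ n) K) : Fixes (P.Lam α δ n) K := by
  refine ⟨fun p hp => P.Lam_of_notMem α (Set.disjoint_right.1 h hp), fun p hp => ?_⟩
  by_cases hA : p ∈ P.A δ n
  · exact Set.disjoint_left.1 h (P.vmap_mem_sq α (hδ n).1 (hδ n).2 (isProfile_id _) hA)
  · rwa [P.Lam_of_notMem α hA]

theorem exists_correction (z : Torus) {d d' : ℝ} (hd0 : 0 < d) (hd : d < 1 / 2) (hd0' : 0 < d')
    (hd' : d' < 1 / 2) {L Φ : Torus → Torus} (hL : Fixes L (sq z (max d d')))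
    (hΦ : Continuous Φ) (hΦ1 : ∀ p, (Φ p).1 = p.1) (hΦs : Function.Surjective Φ)
    (hinj : ∀ p q, Φ p ∈ sq z (max d d') → Φ p = Φ q → p = q) {ε : ℝ} (hε : 0 ≤ ε)
    (hsmall : ∀ p q, p.1 = q.1 → Φ p ∈ sq z (max d d') → Φ q ∈ sq z (max d d') → dist p q ≤ ε) :
    ∃ Q : Torus → Torus, Continuous Q ∧ (∀ p, (Q p).1 = p.1) ∧
      (∀ p, P.vmap α z d' id (L (Φ (Q p))) = P.vmap α z d id (L (Φ p))) ∧
      ∀ p, dist (Q p) p ≤ ε := by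
  obtain ⟨R, hR, hR1, hRK, hRid, hRV⟩ := P.exists_resize α z hd0 hd hd0' hd'
  obtain ⟨Q, hQ, hQ1, hQR, hQε⟩ := exists_lift_of_injective_over (isClosed_sq z _) hΦ hΦ1 hΦs hR hR1
    hRK hRid hinj hε hsmall
  refine ⟨Q, hQ, hQ1, fun p => ?_, hQε⟩
  -- R acts only on the square, L only off it, and both respect this decomposition.
  have hcomm : ∀ x, L (R x) = R (L x) := by
    intro x
    by_cases hx : x ∈ sq z (max d d')
    · rw [hL.1 _ (hRK x hx), hL.1 x hx]
    · rw [hRid x hx, hRid _ (hL.2 x hx)]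
  rw [hQR, hcomm, hRV]

/-- The map `Q` corrects a lift of the translation through `lamComp g n` to one through
`lamComp g (n + 1)`. -/
def IsCorrection (δ : ℕ → ℝ) (g : ℕ → ℕ) (n : ℕ) (ε : ℝ) (Q : Torus → Torus) : Prop :=
  Continuous Q ∧ (∀ p, (Q p).1 = p.1) ∧
    (∀ p, P.Lam α δ (g (n + 1)) (P.lamComp α δ g n (Q p)) =
      P.vmap α (P.z (g (n + 1))) (δ (n + 1)) id (P.lamComp α δ g n p)) ∧ ∀ p, dist (Q p) p ≤ ε

section lifts

variable (hδ : ∀ n, 0 < δ n ∧ δ n < 1 / 2) {g : ℕ → ℕ} {w : Torus}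
include hδ

theorem exists_isCorrection {n j : ℕ} {L Φ : Torus → Torus} (hj : g (n + 1) = j)
    (hLΦ : P.lamComp α δ g n = L ∘ Φ) {ρ : ℝ} (hρ : max (δ (n + 1)) (δ j) = ρ)
    (hL : Fixes L (sq (P.z j) ρ)) (hΦ : Continuous Φ) (hΦ1 : ∀ p, (Φ p).1 = p.1)
    (hΦs : Function.Surjective Φ) (hinj : ∀ p q, Φ p ∈ sq (P.z j) ρ → Φ p = Φ q → p = q)
    {ε : ℝ} (hε : 0 ≤ ε)
    (hsmall : ∀ p q, p.1 = q.1 → Φ p ∈ sq (P.z j) ρ → Φ q ∈ sq (P.z j) ρ → dist p q ≤ ε) :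
    ∃ Q, P.IsCorrection α δ g n ε Q := by
  subst hj hρ
  obtain ⟨Q, hQ, hQ1, hQ2, hQ3⟩ := P.exists_correction α (P.z (g (n + 1))) (hδ _).1 (hδ _).2
    (hδ _).1 (hδ _).2 hL hΦ hΦ1 hΦs hinj hε hsmall
  refine ⟨Q, hQ, hQ1, fun p => ?_, hQ3⟩
  rw [hLΦ]
  exact hQ2 p

/-- The recursion is Fₙ₊₁ = Qₙ ∘ Fₙ: translating Λₙ₊₁ by w centres it at z_{g(n+1)} but keeps the
half-side δₙ₊₁, and Qₙ compensates for this. -/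
theorem exists_continuous_lifts (hg : ∀ n, P.z (g n) = P.z n + w)
    (hQ : ∀ n, ∃ Q, P.IsCorrection α δ g n (4 / 2 ^ n) Q) :
    ∃ F : ℕ → Torus → Torus, (∀ n, Continuous (F n)) ∧ (∀ n p, (F n p).1 = p.1 + w.1) ∧
      (∀ n p, P.lamComp α δ g n (F n p) = P.PhiN α δ n p + w) ∧
      ∀ n p, dist (F n p) (F (n + 1) p) ≤ 8 / 2 / 2 ^ n := by
  choose Q hQc hQ1 hQ2 hQ3 using hQ
  obtain ⟨R, hR, hR1, -, -, hR2⟩ := P.exists_resize α (P.z (g 0)) (hδ 0).1 (hδ 0).2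
    (hδ (g 0)).1 (hδ (g 0)).2
  set F : ℕ → Torus → Torus := fun n => Nat.rec (fun p => R (p + w)) (fun k f => Q k ∘ f) n with hF
  have hF0 : ∀ p, F 0 p = R (p + w) := fun _ => rfl
  have hFs : ∀ n p, F (n + 1) p = Q n (F n p) := fun _ _ => rfl
  refine ⟨F, fun n => ?_, fun n p => ?_, fun n p => ?_, fun n p => ?_⟩
  · induction n with
    | zero => exact hR.comp (continuous_id.add continuous_const)
    | succ n ih => exact (hQc n).comp ih
  · induction n with
    | zero => rw [hF0, hR1, Prod.fst_add]
    | succ n ih => rw [hFs, hQ1, ih]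
  · induction n with
    | zero =>
      rw [hF0]
      refine (hR2 (p + w)).trans ?_
      rw [hg]
      exact P.vmap_add α _ _ _ _ _
    | succ n ih =>
      rw [hFs]
      refine (hQ2 n (F n p)).trans ?_
      rw [ih, hg]
      exact P.vmap_add α _ _ _ _ _
  · rw [hFs, dist_comm]
    refine (hQ3 n _).trans_eq ?_
    norm_num

theorem uniform_of_corrections (hg : ∀ n, P.z (g n) = P.z n + w)
    (hw : ∀ p ∈ P.X, p + w ∈ P.X) (hQ : ∀ n, ∃ Q, P.IsCorrection α δ g n (4 / 2 ^ n) Q)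
    {f : ℕ → Torus → Torus}
    (hf : ∀ n p, f n p = Function.invFunOn (P.lamComp α δ g n) P.X (P.PhiN α δ n p + w)) :
    (∀ n, UniformContinuousOn (f n) P.X) ∧ UniformCauchySeqOn f atTop P.X := by
  obtain ⟨F, hF, hF1, hF2, hF3⟩ := P.exists_continuous_lifts α hδ hg hQ
  have hfF : ∀ n, Set.EqOn (f n) (F n) P.X := by
    intro n p hp
    have hX : P.PhiN α δ n p + w ∈ P.X := hw _ (P.mem_X_of_fst_eq hp (P.PhiN_fst α δ n p))
    obtain ⟨h1, h2⟩ := P.invFunOn_lamComp α hδ g n hX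
    rw [hf]
    refine P.lamComp_injOn_X α hδ g n h1 ?_ (h2.trans (hF2 n p).symm)
    exact P.mem_X_of_fst_eq (hw p hp) (hF1 n p)
  refine ⟨fun n => ?_, ?_⟩
  · exact (CompactSpace.uniformContinuous_of_continuous (hF n)).uniformContinuousOn.congr
      (hfF n).symm
  · rw [Metric.uniformCauchySeqOn_iff]
    intro ε hε
    obtain ⟨N, hN⟩ := eventually_atTop.1
      ((Admissible.tendsto_const_div_two_pow 8).eventually_lt_const (half_pos hε))
    refine ⟨N, fun m hm n hn p hp => ?_⟩
    rw [hfF m hp, hfF n hp]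
    obtain ⟨l, hl⟩ := cauchySeq_tendsto_of_complete
      (cauchySeq_of_le_geometric_two (C := 8) fun n => hF3 n p)
    have hd := fun n => dist_le_of_le_geometric_two_of_tendsto (C := 8) (fun n => hF3 n p) hl n
    have := dist_triangle_right (F m p) (F n p) l
    linarith [hd m, hd n, hN m hm, hN n hn]

end lifts

end Params

/-! ### Recursive choice of the half-sides. -/

theorem torusDist_comm (p q : Torus) : torusDist p q = torusDist q p := by
  unfold torusDist; exact dist_comm _ _

theorem torusDist_triangle (p q r : Torus) : torusDist p r ≤ torusDist p q + torusDist q r := by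
  unfold torusDist; exact dist_triangle _ _ _

/-- A fibred map that is injective over `x` is uniformly injective near `x`. -/
theorem exists_uniform_injective {Φ : Torus → Torus} (hΦ : Continuous Φ) {x : UnitAddCircle}
    (hinj : ∀ p q, p.1 = x → Φ p = Φ q → p = q) {ε : ℝ} (hε : 0 < ε) :
    ∃ η > 0, ∀ p q, ‖p.1 - x‖ ≤ η → dist (Φ p) (Φ q) ≤ η → dist p q < ε := by
  set K : Set (Torus × Torus) := {y | ε ≤ dist y.1 y.2} with hK
  have hKc : IsCompact K := (isClosed_le continuous_const (by fun_prop)).isCompact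
  rcases K.eq_empty_or_nonempty with hKe | hKn
  · refine ⟨1, one_pos, fun p q _ _ => ?_⟩
    by_contra! h
    have : (p, q) ∈ K := h
    rw [hKe] at this
    exact this
  · have hf : Continuous fun y : Torus × Torus => ‖y.1.1 - x‖ + dist (Φ y.1) (Φ y.2) := by fun_prop
    obtain ⟨⟨a, b⟩, hab, hmin⟩ := hKc.exists_isMinOn hKn hf.continuousOn
    have hpos : 0 < ‖a.1 - x‖ + dist (Φ a) (Φ b) := by
      by_contra! hle
      have h1 : ‖a.1 - x‖ = 0 := by linarith [norm_nonneg (a.1 - x), dist_nonneg (x := Φ a) (y := Φ b)]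
      have h2 : dist (Φ a) (Φ b) = 0 := by
        linarith [norm_nonneg (a.1 - x), dist_nonneg (x := Φ a) (y := Φ b)]
      have h3 := hinj a b (sub_eq_zero.1 (norm_eq_zero.1 h1)) (dist_eq_zero.1 h2)
      have h4 : ε ≤ dist a b := hab
      rw [h3, dist_self] at h4
      linarith
    -- A third of the minimum: two terms of this size cannot reach the minimum.
    refine ⟨(‖a.1 - x‖ + dist (Φ a) (Φ b)) / 3, by positivity, fun p q h1 h2 => ?_⟩
    by_contra! h
    have h3 : ‖a.1 - x‖ + dist (Φ a) (Φ b) ≤ ‖p.1 - x‖ + dist (Φ p) (Φ q) :=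
      isMinOn_iff.1 hmin (p, q) h
    linarith

theorem dist_le_of_mem_sq {z : Torus} {d : ℝ} {p q : Torus} (hp : p ∈ sq z d) (hq : q ∈ sq z d) :
    dist p q ≤ 2 * d := by
  rw [Prod.dist_eq]
  refine max_le ?_ ?_
  · refine (dist_triangle_right _ _ z.1).trans ?_
    rw [dist_eq_norm, dist_eq_norm]
    linarith [hp.1, hq.1]
  · refine (dist_triangle_right _ _ z.2).trans ?_
    rw [dist_eq_norm, dist_eq_norm]
    linarith [hp.2, hq.2]

/-- Construction of a sequence by recursion, each term being subject to a condition that involves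
the earlier ones. -/
theorem exists_seq_of_forall_exists {R : ℕ → (ℕ → ℝ) → ℝ → Prop} {C : ℝ → Prop} {c : ℝ} (hc : C c)
    (hcongr : ∀ n δ δ' d, (∀ i < n, δ i = δ' i) → R n δ d → R n δ' d)
    (h : ∀ n δ, (∀ i, C (δ i)) → ∃ d, C d ∧ R n δ d) :
    ∃ δ : ℕ → ℝ, ∀ n, C (δ n) ∧ R n δ (δ n) := by
  classical
  -- The finite initial segment is padded with c, so that C holds at every index; `hcongr` later
  -- replaces the padding by the actual sequence.
  have step : ∀ n (e : ∀ i, i < n → ℝ), ∃ d, (∀ i hi, C (e i hi)) → C d ∧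
      R n (fun i => if hi : i < n then e i hi else c) d := by
    intro n e
    by_cases he : ∀ i hi, C (e i hi)
    · obtain ⟨d, hd⟩ := h n (fun i => if hi : i < n then e i hi else c) (fun i => by
        by_cases hi : i < n
        · simpa only [hi, dif_pos] using he i hi
        · simpa only [hi, dif_neg, not_false_eq_true] using hc)
      exact ⟨d, fun _ => hd⟩
    · exact ⟨0, fun h' => absurd h' he⟩
  choose s hs using step
  set δ : ℕ → ℝ := WellFounded.fix (C := fun _ => ℝ) Nat.lt_wfRel.wf s with hδ
  have hfix : ∀ n, δ n = s n fun i _ => δ i := fun n => WellFounded.fix_eq _ _ n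
  refine ⟨δ, fun n => ?_⟩
  induction n using Nat.strong_induction_on with
  | _ n ih =>
    have := hs n (fun i _ => δ i) fun i hi => (ih i hi).1
    rw [← hfix] at this
    refine ⟨this.1, hcongr n _ _ _ (fun i hi => ?_) this.2⟩
    simp [hi]

namespace Params

variable (P : Params) (α : ℕ → unitInterval)

theorem lamComp_congr {δ δ' : ℕ → ℝ} {g : ℕ → ℕ} {n : ℕ} (h : ∀ i ≤ n, δ (g i) = δ' (g i)) :
    P.lamComp α δ g n = P.lamComp α δ' g n := by
  have hL : ∀ i ≤ n, P.Lam α δ (g i) = P.Lam α δ' (g i) := fun i hi => by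
    rw [P.Lam_eq_vmap, P.Lam_eq_vmap, h i hi]
  induction n with
  | zero => exact hL 0 le_rfl
  | succ n ih =>
    change P.Lam α δ (g (n + 1)) ∘ P.lamComp α δ g n = P.Lam α δ' (g (n + 1)) ∘ P.lamComp α δ' g n
    rw [hL _ le_rfl, ih (fun i hi => h i (by omega)) (fun i hi => hL i (by omega))]

/-- Smallness conditions on the half-side `d` of the `n`th square that do not involve the
maps `Φ`. -/
structure SmallSquare (δ : ℕ → ℝ) (n : ℕ) (d : ℝ) : Prop where
  lt_two_pow : d < 1 / 2 ^ n
  sep : ∀ i j, i ≤ n + 7 → j ≤ n + 7 → i ≠ j → 3 * d < ‖(P.z i).1 - (P.z j).1‖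
  lt_dist : ∀ m < n, d < ‖(P.z m).1 - (P.z n).1‖ / n
  le : ∀ i < n, d ≤ δ i

/-- Smallness conditions on the half-side `d` of the square number `k + 1`, in terms of
`Φ = Φ_k`. -/
structure SmallNext (Φ : Torus → Torus) (k : ℕ) (d : ℝ) : Prop where
  fibre : ∀ p q : Torus, p.1 = (P.z (k + 1)).1 → q.1 = (P.z (k + 1)).1 →
    torusDist (Φ p) (Φ q) ≤ d → torusDist p q < 1 / ((k : ℝ) + 1)
  expansion : ∀ p q : Torus, 1 / ((k : ℝ) + 1) ≤ torusDist p q →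
    (1 - 1 / ((k : ℝ) + 3) ^ 2) * torusDist (Φ p) (Φ q) ≤
      torusDist (P.vmap α (P.z (k + 1)) d id (Φ p)) (P.vmap α (P.z (k + 1)) d id (Φ q))
  close : ∀ p q : Torus, p.1 = q.1 → Φ p ∈ sq (P.z (k + 1)) d → Φ q ∈ sq (P.z (k + 1)) d →
    dist p q ≤ 1 / 2 ^ k

/-- The smallness condition on the half-side `d` of the square number `k + 2`, in terms of
`Φ = Φ_k`. -/
def SmallNextNext (Φ : Torus → Torus) (k : ℕ) (d : ℝ) : Prop :=
  ∀ p q : Torus, p.1 = q.1 → Φ p ∈ sq (P.z (k + 4)) d → Φ q ∈ sq (P.z (k + 4)) d →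
    dist p q ≤ 1 / 2 ^ k

/-- All smallness conditions on the half-side `d` of the `n`th square. -/
structure Small (n : ℕ) (δ : ℕ → ℝ) (d : ℝ) : Prop where
  square : P.SmallSquare δ n d
  next : ∀ k, n = k + 1 → P.SmallNext α (P.PhiN α δ k) k d
  nextNext : ∀ k, n = k + 2 → P.SmallNextNext (P.PhiN α δ k) k d

theorem Small.congr {n : ℕ} {δ δ' : ℕ → ℝ} {d : ℝ} (h : ∀ i < n, δ i = δ' i)
    (hs : P.Small α n δ d) : P.Small α n δ' d := by
  refine ⟨⟨hs.square.lt_two_pow, hs.square.sep, hs.square.lt_dist,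
    fun i hi => h i hi ▸ hs.square.le i hi⟩, fun k hk => ?_, fun k hk => ?_⟩
  · have := hs.next k hk
    rwa [PhiN, P.lamComp_congr α (δ' := δ') (fun i hi => h _ (by simp only [id]; omega))] at this
  · have := hs.nextNext k hk
    rwa [PhiN, P.lamComp_congr α (δ' := δ') (fun i hi => h _ (by simp only [id]; omega))] at this

theorem eventually_lt_right {c : ℝ} (hc : 0 < c) : ∀ᶠ d : ℝ in 𝓝[>] 0, d < c :=
  nhdsWithin_le_nhds (eventually_lt_nhds hc)

theorem norm_sub_pos {i j : ℕ} (h : i ≠ j) : 0 < ‖(P.z i).1 - (P.z j).1‖ :=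
  norm_pos_iff.2 (sub_ne_zero.2 fun e => h (P.fst_z_injective e))

theorem eventually_smallSquare {δ : ℕ → ℝ} (hδ : ∀ i, 0 < δ i ∧ δ i < 1 / 2) (n : ℕ) :
    ∀ᶠ d : ℝ in 𝓝[>] 0, P.SmallSquare δ n d := by
  have h1 : ∀ᶠ d : ℝ in 𝓝[>] 0, d < 1 / 2 ^ n := eventually_lt_right (by positivity)
  have h2 : ∀ᶠ d : ℝ in 𝓝[>] 0, ∀ i ∈ Set.Iic (n + 7), ∀ j ∈ Set.Iic (n + 7), i ≠ j →
      3 * d < ‖(P.z i).1 - (P.z j).1‖ := by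
    refine (eventually_all_finite (Set.finite_Iic _)).2 fun i _ =>
      (eventually_all_finite (Set.finite_Iic _)).2 fun j _ => ?_
    by_cases hij : i = j
    · exact Eventually.of_forall fun d h => absurd hij h
    · filter_upwards [eventually_lt_right (div_pos (P.norm_sub_pos hij) three_pos)] with d hd _
      linarith
  have h3 : ∀ᶠ d : ℝ in 𝓝[>] 0, ∀ m ∈ Set.Iio n, d < ‖(P.z m).1 - (P.z n).1‖ / n := by
    refine (eventually_all_finite (Set.finite_Iio _)).2 fun m hm => ?_
    have hm' : m < n := hm
    have : (0 : ℝ) < n := by exact_mod_cast (by omega : 0 < n)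
    exact eventually_lt_right (div_pos (P.norm_sub_pos hm'.ne) this)
  have h4 : ∀ᶠ d : ℝ in 𝓝[>] 0, ∀ i ∈ Set.Iio n, d < δ i :=
    (eventually_all_finite (Set.finite_Iio _)).2 fun i _ => eventually_lt_right (hδ i).1
  filter_upwards [h1, h2, h3, h4] with d a1 a2 a3 a4
  exact ⟨a1, fun i j hi hj => a2 i hi j hj, a3, fun i hi => (a4 i hi).le⟩

section Small

variable {δ : ℕ → ℝ} (hδ : ∀ n, 0 < δ n ∧ δ n < 1 / 2)
include hδ

theorem exists_uniform_injective_PhiN {k j : ℕ} (hkj : k < j) {ε : ℝ} (hε : 0 < ε) :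
    ∃ η > 0, ∀ p q, ‖p.1 - (P.z j).1‖ ≤ η → dist (P.PhiN α δ k p) (P.PhiN α δ k q) ≤ η →
      dist p q < ε := by
  refine exists_uniform_injective (P.continuous_lamComp α hδ id k) (fun p q hp h => ?_) hε
  refine P.lamComp_injective α hδ id ?_ (fun i hi hi' => ?_) h
  · rw [← P.PhiN_fst α δ k p, ← P.PhiN_fst α δ k q]
    exact congrArg Prod.fst h
  · have := P.fst_z_injective (hp.symm.trans hi')
    simp only [id] at this
    omega

theorem eventually_close {k j : ℕ} (hkj : k < j) : ∀ᶠ d : ℝ in 𝓝[>] 0, ∀ p q : Torus, p.1 = q.1 →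
    P.PhiN α δ k p ∈ sq (P.z j) d → P.PhiN α δ k q ∈ sq (P.z j) d → dist p q ≤ 1 / 2 ^ k := by
  obtain ⟨η, hη, h⟩ := P.exists_uniform_injective_PhiN α hδ hkj
    (show (0 : ℝ) < 1 / 2 ^ k by positivity)
  filter_upwards [eventually_lt_right (half_pos hη), self_mem_nhdsWithin] with d hd hd0 p q _ hp hq
  refine (h p q ?_ ((dist_le_of_mem_sq hp hq).trans (by linarith))).le
  have h1 := hp.1
  rw [P.PhiN_fst] at h1
  linarith

theorem eventually_smallNext (k : ℕ) :
    ∀ᶠ d : ℝ in 𝓝[>] 0, P.SmallNext α (P.PhiN α δ k) k d := by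
  have hk : (0 : ℝ) < (k : ℝ) + 1 := by positivity
  -- The factor 2 converts between the maximum metric and the Euclidean one.
  set ε : ℝ := 1 / (2 * ((k : ℝ) + 1)) with hε
  have hε2 : 2 * ε = 1 / ((k : ℝ) + 1) := by rw [hε]; field_simp
  obtain ⟨η, hη, h⟩ := P.exists_uniform_injective_PhiN α hδ (Nat.lt_succ_self k)
    (show 0 < ε by positivity)
  set c : ℝ := 1 / ((k : ℝ) + 3) ^ 2 with hc
  have hc0 : 0 < c := by positivity
  filter_upwards [P.eventually_close α hδ (Nat.lt_succ_self k), eventually_lt_right hη,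
    eventually_lt_right (show 0 < c * η / 8 by positivity),
    eventually_lt_right (show (0 : ℝ) < 1 / 2 by norm_num), self_mem_nhdsWithin]
    with d hclose hdη hdc hd2 hd0'
  have hd0 : 0 < d := hd0'
  refine ⟨fun p q hp hq hpq => ?_, fun p q hpq => ?_, hclose⟩
  · have h1 := h p q (by rw [hp, sub_self, norm_zero]; exact hη.le)
      ((dist_le_torusDist _ _).trans (hpq.trans hdη.le))
    linarith [torusDist_le p q]
  · set a := P.PhiN α δ k p with ha
    set b := P.PhiN α δ k q with hb
    have hD0 : 0 ≤ torusDist a b := dist_nonneg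
    have hε' : ε ≤ dist p q := by linarith [torusDist_le p q]
    -- If either image is in the new square, uniform injectivity of Φ_k near its column separates
    -- the images by η; otherwise the new map fixes both.
    have hfar : a ∈ sq (P.z (k + 1)) d ∨ b ∈ sq (P.z (k + 1)) d → η < torusDist a b := by
      intro hab
      refine lt_of_lt_of_le ?_ (dist_le_torusDist a b)
      by_contra! hle
      rcases hab with hab | hab
      · have h1 := hab.1
        rw [ha, P.PhiN_fst] at h1
        exact absurd (h p q (h1.trans hdη.le) hle) (not_lt.2 hε')
      · have h1 := hab.1
        rw [hb, P.PhiN_fst] at h1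
        rw [dist_comm] at hle hε'
        exact absurd (h q p (h1.trans hdη.le) hle) (not_lt.2 hε')
    by_cases hab : a ∈ sq (P.z (k + 1)) d ∨ b ∈ sq (P.z (k + 1)) d
    · have h1 := hfar hab
      have h2 := P.dist_vmap_le α (z := P.z (k + 1)) hd0 hd2 (isProfile_id d) a
      have h3 := P.dist_vmap_le α (z := P.z (k + 1)) hd0 hd2 (isProfile_id d) b
      set a' := P.vmap α (P.z (k + 1)) d id a with ha'
      set b' := P.vmap α (P.z (k + 1)) d id b with hb'
      have h4 := torusDist_le a' a
      have h5 := torusDist_le b' b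
      have h6 := torusDist_triangle a a' b
      have h7 := torusDist_triangle a' b' b
      rw [torusDist_comm a a'] at h6
      -- Each endpoint moves by at most 4d in the Euclidean metric, and 8d < cη, so the relative
      -- loss is at most c.
      have h8 : c * η ≤ c * torusDist a b := by gcongr
      nlinarith
    · push Not at hab
      rw [P.vmap_of_notMem α hab.1, P.vmap_of_notMem α hab.2]
      nlinarith

theorem eventually_small (n : ℕ) : ∀ᶠ d : ℝ in 𝓝[>] 0, P.Small α n δ d := by
  have h2 : ∀ᶠ d : ℝ in 𝓝[>] 0, ∀ k, n = k + 1 → P.SmallNext α (P.PhiN α δ k) k d := by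
    rcases n with _ | k
    · exact Eventually.of_forall fun d k hk => by omega
    · filter_upwards [P.eventually_smallNext α hδ k] with d hd j hj
      obtain rfl : k = j := by omega
      exact hd
  have h3 : ∀ᶠ d : ℝ in 𝓝[>] 0, ∀ k, n = k + 2 → P.SmallNextNext (P.PhiN α δ k) k d := by
    rcases n with _ | _ | k
    · exact Eventually.of_forall fun d k hk => by omega
    · exact Eventually.of_forall fun d k hk => by omega
    · filter_upwards [P.eventually_close α hδ (show k < k + 4 by omega)] with d hd j hj
      obtain rfl : k = j := by omega
      exact hd
  filter_upwards [P.eventually_smallSquare hδ n, h2, h3] with d a1 a2 a3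
  exact ⟨a1, a2, a3⟩

end Small

theorem exists_small : ∃ δ : ℕ → ℝ, ∀ n, (0 < δ n ∧ δ n < 1 / 2) ∧ P.Small α n δ (δ n) := by
  refine exists_seq_of_forall_exists (R := P.Small α) (C := fun d => 0 < d ∧ d < 1 / 2) (c := 1 / 4)
    (by norm_num) (fun n δ δ' d h => Small.congr P α h) fun n δ hδ => ?_
  have h1 : ∀ᶠ d : ℝ in 𝓝[>] 0, 0 < d := self_mem_nhdsWithin
  obtain ⟨d, hd⟩ := (h1.and ((eventually_lt_right (c := 1 / 2) (by norm_num)).and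
    (P.eventually_small α hδ n))).exists
  exact ⟨d, ⟨hd.1, hd.2.1⟩, hd.2.2⟩

/-! ### Small half-sides are admissible. -/

section Admissible

variable {δ : ℕ → ℝ} (hδ : ∀ n, (0 < δ n ∧ δ n < 1 / 2) ∧ P.Small α n δ (δ n))
include hδ

theorem disjoint_sq_of_small {i j n : ℕ} {d : ℝ} (hij : i ≠ j) (hi : i ≤ n + 7) (hj : j ≤ n + 7)
    (hn : n ≤ i) (hd : d ≤ δ n) : Disjoint (P.A δ i) (sq (P.z j) d) := by
  rw [Set.disjoint_left]
  intro p hp hq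
  have h1 := (hδ n).2.square.sep i j hi hj hij
  have h2 : δ i ≤ δ n := by
    rcases hn.lt_or_eq with h | rfl
    · exact (hδ i).2.square.le n h
    · exact le_rfl
  have h3 : ‖(P.z i).1 - (P.z j).1‖ ≤ ‖p.1 - (P.z i).1‖ + ‖p.1 - (P.z j).1‖ := by
    rw [← dist_eq_norm, ← dist_eq_norm, ← dist_eq_norm]
    exact dist_triangle_left _ _ _
  linarith [hp.1, hq.1, (hδ n).1.1]

/-- Columns within δₙ of the column of z_j contain none of the collapsed points z₀, …, z_k. -/
theorem PhiN_injective_over {k j n : ℕ} (hkj : k < j) (hj : j ≤ n + 7)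
    (p q : Torus) (hp : P.PhiN α δ k p ∈ sq (P.z j) (δ n)) (h : P.PhiN α δ k p = P.PhiN α δ k q) :
    p = q := by
  refine P.lamComp_injective α (fun n => (hδ n).1) id ?_ (fun i hi hi' => ?_) h
  · rw [← P.PhiN_fst α δ k p, ← P.PhiN_fst α δ k q]
    exact congrArg Prod.fst h
  · have h1 := (hδ n).2.square.sep i j (by omega) hj (by omega)
    have h2 := hp.1
    simp only [id] at hi'
    rw [P.PhiN_fst, hi'] at h2
    linarith [(hδ n).1.1]

theorem le_of_small {m n : ℕ} (h : m ≤ n) : δ n ≤ δ m := by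
  rcases h.lt_or_eq with h | rfl
  · exact (hδ n).2.square.le m h
  · exact le_rfl

theorem disjoint_squares_of_small (m n : ℕ) (hmn : m < n) (hn : n ≤ m + 5) :
    Disjoint (P.A δ m) (P.A δ n) :=
  P.disjoint_sq_of_small α hδ hmn.ne (by omega) (by omega) le_rfl (P.le_of_small α hδ hmn.le)

theorem exists_isCorrection_PhiN {g : ℕ → ℕ} {n j m k : ℕ} {L : Torus → Torus} (hj : g (n + 1) = j)
    (hL : P.lamComp α δ g n = L ∘ P.PhiN α δ k) (hρ : max (δ (n + 1)) (δ j) = δ m)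
    (hLf : Fixes L (sq (P.z j) (δ m))) (hkj : k < j) (hjm : j ≤ m + 7)
    (hnk : n ≤ k + 2)
    (hclose : ∀ p q : Torus, p.1 = q.1 → P.PhiN α δ k p ∈ sq (P.z j) (δ m) →
      P.PhiN α δ k q ∈ sq (P.z j) (δ m) → dist p q ≤ 1 / 2 ^ k) :
    ∃ Q, P.IsCorrection α δ g n (4 / 2 ^ n) Q := by
  refine P.exists_isCorrection α (fun n => (hδ n).1) hj hL hρ hLf
    (P.continuous_lamComp α (fun n => (hδ n).1) id k) (P.PhiN_fst α δ k)
    (P.lamComp_surjective α (fun n => (hδ n).1) id k)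
    (P.PhiN_injective_over α hδ hkj hjm) (by positivity) fun p q h1 h2 h3 =>
      (hclose p q h1 h2 h3).trans ?_
  calc (1 : ℝ) / 2 ^ k = 4 / 2 ^ (k + 2) := by rw [pow_add]; field_simp; norm_num
    _ ≤ 4 / 2 ^ n := by gcongr; norm_num

omit hδ in
theorem dist_le_one (p q : Torus) : dist p q ≤ 1 := by
  rw [Prod.dist_eq, dist_eq_norm, dist_eq_norm]
  exact max_le ((norm_le_half _).trans (by norm_num)) ((norm_le_half _).trans (by norm_num))

/-- For the initial indices the resizing itself serves as Q, with nothing to lift through: the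
allowed displacement 4/2ⁿ is at least 1, which bounds the diameter. -/
theorem exists_isCorrection_id {g : ℕ → ℕ} {n j m : ℕ} (hj : g (n + 1) = j)
    (hρ : max (δ (n + 1)) (δ j) = δ m) (hLf : Fixes (P.lamComp α δ g n) (sq (P.z j) (δ m)))
    (hn : n ≤ 2) : ∃ Q, P.IsCorrection α δ g n (4 / 2 ^ n) Q := by
  refine P.exists_isCorrection α (fun n => (hδ n).1) (Φ := id) hj rfl hρ hLf continuous_id
    (fun _ => rfl) Function.surjective_id (fun _ _ _ h => h) (by positivity)
    fun p q _ _ _ => (dist_le_one p q).trans ?_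
  interval_cases n <;> norm_num

/-- Apart from the first case, Φ^σₙ is some Φ_k with k ≥ n - 2 followed by one or two maps whose
squares miss the square to be resized. Hence lifting through Φ_k is enough. -/
theorem exists_isCorrection_sigma (n : ℕ) :
    ∃ Q, P.IsCorrection α δ sigma n (4 / 2 ^ n) Q := by
  have hδ' := fun n => (hδ n).1
  have hdis := P.disjoint_squares_of_small α hδ
  rcases Nat.even_or_odd' n with ⟨k, rfl | rfl⟩
  · rcases k with _ | k
    · refine P.exists_isCorrection_id α hδ (j := 0) (m := 0) rfl
        (max_eq_right (P.le_of_small α hδ (by omega))) (P.fixes_Lam α hδ' ?_) (by omega)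
      exact P.disjoint_sq_of_small α hδ (i := 2) (by omega) (by omega) (by omega) (by omega) le_rfl
    · refine P.exists_isCorrection_PhiN α hδ (j := 2 * k + 1) (m := 2 * k + 1) (k := 2 * k)
        (L := P.Lam α δ (2 * k + 4) ∘ P.Lam α δ (2 * k + 2)) (sigma_odd k) ?_
        (max_eq_right (P.le_of_small α hδ (by omega)))
        ((P.fixes_Lam α hδ' ?_).comp (P.fixes_Lam α hδ' ?_)) (by omega) (by omega) (by omega)
        ((hδ (2 * k + 1)).2.next (2 * k) rfl).close
      · change P.Lam α δ (sigma (2 * (k + 1))) ∘ P.lamComp α δ sigma (2 * k + 1) = _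
        rw [P.lamComp_sigma_odd α hδ' hdis, sigma_even]
        rfl
      · exact P.disjoint_sq_of_small α hδ (by omega) (by omega) (by omega) (by omega) le_rfl
      · exact P.disjoint_sq_of_small α hδ (by omega) (by omega) (by omega) (by omega) le_rfl
  -- The next centre is z_{2k+4}, but the larger half-side is δ_{2k+2} and only Φ_{2k} is available;
  -- this accounts for the shifts by 4 and 2 in `SmallNextNext` and `Small.nextNext`.
  · refine P.exists_isCorrection_PhiN α hδ (j := 2 * k + 4) (m := 2 * k + 2) (k := 2 * k)
      (sigma_even (k + 1)) (P.lamComp_sigma_odd α hδ' hdis k)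
      (max_eq_left (P.le_of_small α hδ (by omega)))
      (P.fixes_Lam α hδ' ?_) (by omega) (by omega) (by omega)
      ((hδ (2 * k + 2)).2.nextNext (2 * k) rfl)
    exact P.disjoint_sq_of_small α hδ (by omega) (by omega) (by omega) (by omega) le_rfl

theorem exists_isCorrection_tau (n : ℕ) :
    ∃ Q, P.IsCorrection α δ tau n (4 / 2 ^ n) Q := by
  have hδ' := fun n => (hδ n).1
  have hdis := P.disjoint_squares_of_small α hδ
  rcases n with _ | n
  · refine P.exists_isCorrection_id α hδ (j := 3) (m := 1) rfl
      (max_eq_left (P.le_of_small α hδ (by omega))) (P.fixes_Lam α hδ' ?_) (by omega)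
    exact P.disjoint_sq_of_small α hδ (i := 1) (by omega) (by omega) (by omega) (by omega) le_rfl
  rcases Nat.even_or_odd' n with ⟨k, rfl | rfl⟩
  · rcases k with _ | k
    · refine P.exists_isCorrection_id α hδ (j := 0) (m := 0) rfl
        (max_eq_right (P.le_of_small α hδ (by omega)))
        ((P.fixes_Lam α hδ' (n := 3) ?_).comp (P.fixes_Lam α hδ' (n := 1) ?_)) (by omega)
      · exact P.disjoint_sq_of_small α hδ (by omega) (by omega) (by omega) (by omega) le_rfl
      · exact P.disjoint_sq_of_small α hδ (by omega) (by omega) (by omega) (by omega) le_rfl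
    · refine P.exists_isCorrection_PhiN α hδ (j := 2 * k + 2) (m := 2 * k + 2) (k := 2 * k + 1)
        (L := P.Lam α δ (2 * k + 5) ∘ P.Lam α δ (2 * k + 3)) (tau_even (k + 1)) ?_
        (max_eq_right (P.le_of_small α hδ (by omega)))
        ((P.fixes_Lam α hδ' ?_).comp (P.fixes_Lam α hδ' ?_)) (by omega) (by omega) (by omega)
        ((hδ (2 * k + 2)).2.next (2 * k + 1) rfl).close
      · change P.Lam α δ (tau (2 * (k + 1) + 1)) ∘ P.lamComp α δ tau (2 * k + 2) = _
        rw [P.lamComp_tau_even α hδ' hdis, tau_odd]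
        rfl
      · exact P.disjoint_sq_of_small α hδ (by omega) (by omega) (by omega) (by omega) le_rfl
      · exact P.disjoint_sq_of_small α hδ (by omega) (by omega) (by omega) (by omega) le_rfl
  · refine P.exists_isCorrection_PhiN α hδ (j := 2 * k + 5) (m := 2 * k + 3) (k := 2 * k + 1)
      (tau_odd (k + 1)) (P.lamComp_tau_even α hδ' hdis k)
      (max_eq_left (P.le_of_small α hδ (by omega)))
      (P.fixes_Lam α hδ' ?_) (by omega) (by omega) (by omega)
      ((hδ (2 * k + 3)).2.nextNext (2 * k + 1) rfl)
    exact P.disjoint_sq_of_small α hδ (by omega) (by omega) (by omega) (by omega) le_rfl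

-- The product telescopes, since 1 - 1/(r+2)² = (r+1)(r+3)/(r+2)².
omit hδ in
theorem prod_one_sub_eq (m : ℕ) :
    ∏ r ∈ Finset.Icc 1 m, (1 - 1 / (((r + 2) ^ 2 : ℕ) : ℝ)) = 2 / 3 + 2 / 3 * (1 / ((m : ℝ) + 2)) := by
  induction m with
  | zero => norm_num
  | succ m ih =>
    rw [Finset.prod_Icc_succ_top (by omega), ih]
    push_cast
    field_simp
    ring

omit hδ in
theorem tendsto_prod_one_sub :
    Tendsto (fun m => ∏ r ∈ Finset.Icc 1 m, (1 - 1 / (((r + 2) ^ 2 : ℕ) : ℝ))) atTop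
      (𝓝 (2 / 3)) := by
  simp only [prod_one_sub_eq]
  have h : Tendsto (fun m : ℕ => 1 / ((m : ℝ) + 2)) atTop (𝓝 0) := by
    have := (tendsto_add_atTop_iff_nat 1).2 (tendsto_one_div_add_atTop_nhds_zero_nat (𝕜 := ℝ))
    refine this.congr fun m => ?_
    push_cast
    ring
  simpa using (h.const_mul (2 / 3)).const_add (2 / 3 : ℝ)

theorem expansion_of_small {n m : ℕ} (hn : 1 ≤ n) (hnm : n ≤ m) {p q : Torus}
    (hpq : 1 / (n : ℝ) ≤ torusDist p q) :
    (∏ r ∈ Finset.Icc (n + 1) m, (1 - 1 / (((r + 2) ^ 2 : ℕ) : ℝ))) *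
      torusDist (P.PhiN α δ n p) (P.PhiN α δ n q) ≤
        torusDist (P.PhiN α δ m p) (P.PhiN α δ m q) := by
  induction m, hnm using Nat.le_induction with
  | base => simp
  | succ m hm ih =>
    have hn' : (0 : ℝ) < n := by exact_mod_cast hn
    have hm' : (n : ℝ) ≤ m := by exact_mod_cast hm
    have h1 := ((hδ (m + 1)).2.next m rfl).expansion p q
      (le_trans (one_div_le_one_div_of_le hn' (by linarith)) hpq)
    refine le_trans ?_ h1
    rw [Finset.prod_Icc_succ_top (by omega)]
    have e : (((m + 1 + 2) ^ 2 : ℕ) : ℝ) = ((m : ℝ) + 3) ^ 2 := by push_cast; ring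
    rw [e, mul_comm (∏ r ∈ _, _), mul_assoc]
    refine mul_le_mul_of_nonneg_left ih ?_
    have : 1 / ((m : ℝ) + 3) ^ 2 ≤ 1 := by
      rw [div_le_one (by positivity)]
      nlinarith [(Nat.cast_nonneg m : (0 : ℝ) ≤ m)]
    linarith

theorem admissible_of_small : P.Admissible α δ := by
  have hδ' := fun n => (hδ n).1
  obtain ⟨hσ1, hσ2⟩ := P.uniform_of_corrections α hδ' P.z_sigma (fun p hp => P.add_mem_X hp)
    (P.exists_isCorrection_sigma α hδ) (f := P.fwd α δ) (fun _ _ => rfl)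
  obtain ⟨hτ1, hτ2⟩ := P.uniform_of_corrections α hδ' (w := -P.v)
    (fun n => by rw [P.z_tau, sub_eq_add_neg])
    (fun p hp => by rw [← sub_eq_add_neg]; exact P.sub_mem_X hp)
    (P.exists_isCorrection_tau α hδ) (f := P.bwd α δ)
    (fun _ _ => by rw [← sub_eq_add_neg]; rfl)
  refine
    { pos := fun n => (hδ n).1.1
      lt_two_pow := fun n => (hδ n).2.square.lt_two_pow
      disjoint_squares := P.disjoint_squares_of_small α hδ
      disjoint_columns := fun m n hmn p hp e => ?_
      lt_dist := fun m n hmn => (hδ n).2.square.lt_dist m hmn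
      fibre_small := fun n => ((hδ (n + 1)).2.next n rfl).fibre
      expansion := ⟨fun r => (r + 2) ^ 2, fun r => ?_, ⟨2 / 3, by norm_num, tendsto_prod_one_sub⟩,
        fun n m hn hnm p q => P.expansion_of_small α hδ hn hnm.le⟩
      fwd_uniformContinuous := hσ1
      bwd_uniformContinuous := hτ1
      fwd_cauchy := hσ2
      bwd_cauchy := hτ2 }
  · have h1 := (hδ n).2.square.sep m n (by omega) (by omega) hmn.ne
    have h2 := hp.1
    rw [e] at h2
    linarith [(hδ n).1.1]
  · change 2 ≤ (r + 2) ^ 2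
    exact le_trans (by norm_num) (Nat.pow_le_pow_left (Nat.le_add_left 2 r) 2)

end Admissible

theorem exists_admissible : ∃ δ : ℕ → ℝ, P.Admissible α δ := by
  obtain ⟨δ, hδ⟩ := P.exists_small α
  exact ⟨δ, P.admissible_of_small α hδ⟩

end Params

end DenjoyRees

end

/-- Every `α ∈ [0,1]^ω` admits squares as the construction requires, the resulting `S_α` is a
homeomorphism of the torus, and `S_α`, `S_β` are not topologically conjugate if `α` and `β` are
not `c₀`-equivalent, whatever admissible squares are used for `α` and for `β`. -/
theorem mainTheorem3 (P : DenjoyRees.Params) :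
    (∀ α : ℕ → unitInterval, ∃ δ : ℕ → ℝ, P.Admissible α δ) ∧
    (∀ (α : ℕ → unitInterval) (δ : ℕ → ℝ), P.Admissible α δ → IsHomeomorph (P.S α δ)) ∧
    (∀ (α β : ℕ → unitInterval) (δα δβ : ℕ → ℝ), P.Admissible α δα → P.Admissible β δβ →
      ¬ DenjoyRees.C0Equiv α β → ¬ DenjoyRees.TopConj (P.S α δα) (P.S β δβ)) := by
  refine ⟨fun α => P.exists_admissible α, fun α δ hA => hA.isHomeomorph_S,
    fun α β δα δβ hA hB hne h => hne (hA.c0Equiv_of_topConj hB h)⟩
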